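/- **Setting.** Let $1\le N<M$ be integers, $[s]=\{1,\dots,s\}$. Let $\hat A=(\hat A^i_j)$ be a real $N\times M$ matrix with all maximal minors positive, with $\hat A^i_j=0$ for $j<i$ and for $j>M-N+i$, and with all row sums equal to $1$. For columns $c_1,\dots,c_m$ let $\Delta_{[c_1,\dots,c_m]}$ be the minor of the last $m$ rows of $\hat A$ and these columns (the empty minor is $1$). Let $k_1<\dots<k_M$ be real. Only the times $t=(t_1,\dots,t_{j_0})\in\mathbb R^{j_0}$ ($j_0\ge1$, $x=t_1$) may be nonzero; put $\theta(\lambda,t)=\sum_{i\le j_0}\lambda^it_i$ and $\theta_j=\theta(k_j,t)$, and let $f_i(t)=\sum_j\hat A^i_je^{\theta_j}$ (row $i$). Let $D=\partial_x^N-w_1(t)\partial_x^{N-1}-\dots-w_N(t)$ be the operator with $Df_i=0$ for all $i\in[N]$, and $P^{(0)}(z)=z^N-w_1(t)z^{N-1}-\dots-w_N(t)=\prod_{l=1}^N(z-\gamma^{(0)}_l(t))$. Define, for $r\in[N]$ and $l\in[M-N+1]$: $\hat B^{(1)}_l=\hat A^N_{N+l-1}$; for $r\ge2$, $\hat B^{(r)}_1=\hat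 A^{N-r+1}_{N-r+1}$ and, for $l\ge2$, $$\hat B^{(r)}_l=\frac{\Delta_{[N-r+l,\dots,N+l-1]}\sum_{s=N-r+2}^{N-r+l}\Delta_{[s;N-r+l+1,\dots,N+l-2]}}{\Delta_{[N-r+l+1,\dots,N+l-1]}\,\Delta_{[N-r+l,\dots,N+l-2]}}.$$ For $\xi>1$ let $\lambda_1=0$, $\lambda_l=-\xi^{2(l-2)}$ and $\alpha_l=\xi^{2l-5}$ for $2\le l\le M-N+1$. A *vacuum wave function* at $\xi$ is given by real numbers $\mathring B^{(r)}_l$, $b^{(r)}_i\in\,]\lambda_{i+1},\lambda_i[$ $(i\in[M-N])$ and $\epsilon^{(r)}_j>0$ $(j\in[r-1])$ such that the functions $\Psi^{(0)}(\lambda,t)=e^{\theta(\lambda,t)}$ and, for $r\in[N]$, $$\Psi^{(r)}(\lambda,t)=\sum_{l=1}^{M-N+1}\mathring B^{(r)}_l\frac{\prod_{j\ne l}(\lambda-\lambda_j)}{\prod_{i=1}^{M-N}(\lambda-b^{(r)}_i)}V^{(r)}_l(t),$$ with $V^{(1)}_l=e^{\theta_{N+l-1}}$ and, for $r\ge2$,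 $V^{(r)}_1=e^{\theta_{N-r+1}}$, $V^{(r)}_l=\Psi^{(r-1)}(\alpha_l,t)$ $(l\ge2)$, satisfy for all $t$ the gluing rules $\Psi^{(r)}(\lambda_l,t)=V^{(r)}_l(t)$ and $$\lim_{\lambda\to\infty}\Psi^{(r)}(\lambda,t)=\frac{f_{N-r+1}(t)+\sum_{j=1}^{r-1}\epsilon^{(r)}_jf_{N-r+1+j}(t)}{1+\sum_{j=1}^{r-1}\epsilon^{(r)}_j}.$$ The zeros $\gamma^{(r)}_n(t)=\gamma^{(r)}_n(\xi;t)$, $n\in[M-N-1]$, of $D\Psi^{(r)}$ are defined (up to numbering) by $$D\Psi^{(r)}(\lambda,t)=\mathcal R\,\frac{\prod_{n=1}^{M-N-1}(\lambda-\gamma^{(r)}_n(t))}{\prod_{i=1}^{M-N}(\lambda-b^{(r)}_i)},\qquad\mathcal R\neq0;$$ at $t=0$ they form the part $\mathcal D^{(r)}$ of the Krichever divisor on the $r$-th sheet. Finally let $$L^{(r)}_n(t)=\sum_{j=N-r+1}^{N-r+n}\frac{\Delta_{[j;N-r+n+1,\dots,N+n-1]}}{\Delta_{[N-r+n+1,\dots,N+n-1]}}P^{(0)}(k_j)e^{\theta_j},\qquad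 n\in[M-N],$$ and call $t$ *generic on sheet $r$* if $L^{(r)}_n(t)\ne0$ for all $n\in[M-N]$. **Theorem.** 1. For all sufficiently large $\xi$ a vacuum wave function exists. 2. The set of $t\in\mathbb R^{j_0}$ that are generic on all sheets $r\in[N]$ is open and dense in $\mathbb R^{j_0}$. 3. Let $r\in[N]$ and let $K\subset\mathbb R^{j_0}$ be a compact set of times that are generic on sheet $r$. Then there are $\xi_0$ and $C$ such that, for every $\xi>\xi_0$, every vacuum wave function at $\xi$ and every $t\in K$, the function $D\Psi^{(r)}(\cdot,t)$ has the form above with real zeros which, suitably numbered, satisfy for every $n\in[M-N-1]$ $$\gamma^{(r)}_n(t)=-\frac{\sum_{l=1}^n\hat B^{(r)}_lDV^{(r)}_l(t)}{\sum_{l=1}^{n+1}\hat B^{(r)}_lDV^{(r)}_l(t)}\,\xi^{2(n-1)}\bigl(1+O(\xi^{-1})\bigr)=-\frac{L^{(r)}_n(t)}{L^{(r)}_{n+1}(t)}\,\xi^{2(n-1)}\bigl(1+O(\xi^{-1})\bigr),$$ where all denominators and numerators are nonzero and each $O(\xi^{-1})$ is bounded by $C/\xi$. 4. In particular, if $t=0$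 is generic on sheet $r$, the points of $\mathcal D^{(r)}$ satisfy, as $\xi\to\infty$, $$\gamma^{(r)}_n(0)=-\frac{\displaystyle\sum_{j=N-r+1}^{N-r+n}\frac{\Delta_{[j;N-r+n+1,\dots,N+n-1]}}{\Delta_{[N-r+n+1,\dots,N+n-1]}}P^{(0)}(k_j)\big|_{t=0}}{\displaystyle\sum_{j=N-r+1}^{N-r+n+1}\frac{\Delta_{[j;N-r+n+2,\dots,N+n]}}{\Delta_{[N-r+n+2,\dots,N+n]}}P^{(0)}(k_j)\big|_{t=0}}\,\xi^{2(n-1)}\bigl(1+O(\xi^{-1})\bigr),\quad n\in[M-N-1].$$ Moreover, for fixed $\hat A$, the set of $(k_1,\dots,k_M)$ with $k_1<\dots<k_M$ for which $t=0$ is generic on all sheets is open, and dense in the set of all $(k_1,\dots,k_M)$ with $k_1<\dots<k_M$. -/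

import Mathlib

open Filter Topology

noncomputable section

namespace KPSoliton

/-! All row, column, phase, sheet and point labels are one-based natural numbers. -/

/-- The entry in row `i` and column `j` (one-based) of an `N × M` matrix. -/
def entry {N M : ℕ} (A : Matrix (Fin N) (Fin M) ℝ) (i j : ℕ) : ℝ :=
  if h : (1 ≤ i ∧ i ≤ N) ∧ (1 ≤ j ∧ j ≤ M) then
    A ⟨i - 1, by omega⟩ ⟨j - 1, by omega⟩
  else 0

/-- The phase `k_j` (one-based). -/
def phase {M : ℕ} (k : Fin M → ℝ) (j : ℕ) : ℝ :=
  if h : 1 ≤ j ∧ j ≤ M then k ⟨j - 1, by omega⟩ else 0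

/-- Normalized banded matrices representing a point of the totally positive Grassmannian:
entries vanish outside the band `i ≤ j ≤ M - N + i`, rows sum to one, and all maximal minors
are positive. -/
structure IsNormalizedBanded {N M : ℕ} (A : Matrix (Fin N) (Fin M) ℝ) : Prop where
  band : ∀ i ∈ Finset.Icc 1 N, ∀ j ∈ Finset.Icc 1 M,
    (j < i ∨ M - N + i < j) → entry A i j = 0
  row_sum : ∀ i ∈ Finset.Icc 1 N, ∑ j ∈ Finset.Icc 1 M, entry A i j = 1
  maximal_minors : ∀ c : Fin N → Fin M, StrictMono c → 0 < (A.submatrix id c).det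

/-- `Δ_{[c₁, …, c_m]}`: the minor of the last `m` rows and the columns `c₁, …, c_m`. -/
def minor {N M m : ℕ} (A : Matrix (Fin N) (Fin M) ℝ) (c : Fin m → ℕ) : ℝ :=
  (Matrix.of fun p q : Fin m => entry A (N - m + (p : ℕ) + 1) (c q)).det

/-- The `m` consecutive columns `a, a + 1, …, a + m - 1`. -/
def run (a m : ℕ) : Fin m → ℕ := fun q => a + q

/-- The list of columns `j; a, a + 1, …, a + m - 1`. -/
def consRun (j a m : ℕ) : Fin (m + 1) → ℕ := Fin.cons j (run a m)

/-- The leading coefficients `B̂^{(r)}_j`, for `r ∈ [N]` and `j ∈ [M - N + 1]`. -/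
def Bhat {N M : ℕ} (A : Matrix (Fin N) (Fin M) ℝ) (r j : ℕ) : ℝ :=
  if r = 1 then entry A N (N + j - 1)
  else if j = 1 then entry A (N - r + 1) (N - r + 1)
  else
    minor A (run (N - r + j) r) *
        (∑ s ∈ Finset.Icc (N - r + 2) (N - r + j), minor A (consRun s (N - r + j + 1) (r - 2))) /
      (minor A (run (N - r + j + 1) (r - 1)) * minor A (run (N - r + j) (r - 1)))

/-! ### Times, heat hierarchy and Darboux operator. Only `t_1, …, t_J` may be nonzero. -/

/-- `θ(z, t) = ∑_{i = 1}^{J} z^i t_i`. -/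
def theta {J : ℕ} (z : ℝ) (t : Fin J → ℝ) : ℝ := ∑ i : Fin J, z ^ ((i : ℕ) + 1) * t i

/-- The solution of the heat hierarchy attached to row `i`: `∑_j A^i_j e^{θ_j(t)}`. -/
def heat {N M J : ℕ} (A : Matrix (Fin N) (Fin M) ℝ) (k : Fin M → ℝ) (i : ℕ)
    (t : Fin J → ℝ) : ℝ :=
  ∑ j ∈ Finset.Icc 1 M, entry A i j * Real.exp (theta (phase k j) t)

/-- `∂_x^m g` at `t`, where `x = t_1`. -/
def dx {J : ℕ} [NeZero J] (m : ℕ) (g : (Fin J → ℝ) → ℝ) (t : Fin J → ℝ) : ℝ :=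
  iteratedDeriv m (fun x : ℝ => g (Function.update t 0 x)) (t 0)

/-- The coefficients `w_1(t), …, w_N(t)` of the Darboux operator (`w_{m+1}` is entry `m`): the
solution of the linear system
`∂_x^N f^{(i)} = w_1 ∂_x^{N-1} f^{(i)} + ⋯ + w_N f^{(i)}`, `i ∈ [N]`,
whose determinant is, up to sign, the Wronskian of `f^{(1)}, …, f^{(N)}`. -/
def darbouxCoeff {N M J : ℕ} [NeZero J] (A : Matrix (Fin N) (Fin M) ℝ) (k : Fin M → ℝ)
    (t : Fin J → ℝ) : Fin N → ℝ :=
  (Matrix.of fun i m : Fin N => dx (N - 1 - (m : ℕ)) (heat A k ((i : ℕ) + 1)) t)⁻¹.mulVec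
    (fun i : Fin N => dx N (heat A k ((i : ℕ) + 1)) t)

/-- The Darboux operator `D = ∂_x^N - w_1 ∂_x^{N-1} - ⋯ - w_N`. -/
def darboux {N M J : ℕ} [NeZero J] (A : Matrix (Fin N) (Fin M) ℝ) (k : Fin M → ℝ)
    (g : (Fin J → ℝ) → ℝ) (t : Fin J → ℝ) : ℝ :=
  dx N g t - ∑ m : Fin N, darbouxCoeff A k t m * dx (N - 1 - (m : ℕ)) g t

/-- `P^{(0)}(z) = z^N - w_1(t) z^{N-1} - ⋯ - w_N(t) = ∏_l (z - γ^{(0)}_l(t))`. -/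
def darbouxPoly {N M J : ℕ} [NeZero J] (A : Matrix (Fin N) (Fin M) ℝ) (k : Fin M → ℝ)
    (t : Fin J → ℝ) (z : ℝ) : ℝ :=
  z ^ N - ∑ m : Fin N, darbouxCoeff A k t m * z ^ (N - 1 - (m : ℕ))

/-! ### The vacuum wave function. -/

/-- `λ^{(r)}_1 = 0` and `λ^{(r)}_l = -ξ^{2(l-2)}` for `l ≥ 2` (the same on every sheet). -/
def lam (ξ : ℝ) (l : ℕ) : ℝ := if l = 1 then 0 else -ξ ^ (2 * (l - 2))

/-- `α^{(r)}_s = ξ^{2s-5}` for `s ≥ 2` (the same on every sheet). -/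
def alpha (ξ : ℝ) (s : ℕ) : ℝ := ξ ^ (2 * (s : ℤ) - 5)

/-- The unknowns of the construction of the vacuum wave function at a given `ξ`: the coefficients
`B̊^{(r)}_l`, the poles `b^{(r)}_i` and the parameters `ε^{(r)}_j`. -/
structure VacuumData where
  B : ℕ → ℕ → ℝ
  b : ℕ → ℕ → ℝ
  ε : ℕ → ℕ → ℝ

/-- The values `V^{(r)}_l(t)` prescribed at `λ^{(r)}_l`, where `prev` is the wave function on the
sheet `Γ_{r-1}`. -/
def glueValue (N : ℕ) {M J : ℕ} (k : Fin M → ℝ) (ξ : ℝ) (prev : ℝ → (Fin J → ℝ) → ℝ)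
    (r l : ℕ) (t : Fin J → ℝ) : ℝ :=
  if r = 1 then Real.exp (theta (phase k (N + l - 1)) t)
  else if l = 1 then Real.exp (theta (phase k (N - r + 1)) t)
  else prev (alpha ξ l) t

/-- The vacuum wave function `Ψ^{(r)}(z, t)` on the sheet `Γ_r`:
`Ψ^{(0)} = e^{θ}` and
`Ψ^{(r)} = ∑_l B̊^{(r)}_l ∏_{j ≠ l} (z - λ_j) / ∏_i (z - b^{(r)}_i) V^{(r)}_l(t)`. -/
def vacuum (N : ℕ) {M J : ℕ} (k : Fin M → ℝ) (ξ : ℝ) (d : VacuumData) :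
    ℕ → ℝ → (Fin J → ℝ) → ℝ
  | 0 => fun z t => Real.exp (theta z t)
  | r + 1 => fun z t =>
      ∑ l ∈ Finset.Icc 1 (M - N + 1),
        d.B (r + 1) l *
          ((∏ j ∈ (Finset.Icc 1 (M - N + 1)).erase l, (z - lam ξ j)) /
            ∏ i ∈ Finset.Icc 1 (M - N), (z - d.b (r + 1) i)) *
          glueValue N k ξ (vacuum N k ξ d r) (r + 1) l t

/-- `V^{(r)}_l(t)`, for `r ∈ [N]` and `l ∈ [M - N + 1]`. -/
def vacuumValue (N : ℕ) {M J : ℕ} (k : Fin M → ℝ) (ξ : ℝ) (d : VacuumData) (r l : ℕ) :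
    (Fin J → ℝ) → ℝ :=
  glueValue N k ξ (vacuum N k ξ d (r - 1)) r l

/-- The defining properties of the vacuum wave function at a given `ξ`: on each sheet `Γ_r`,
`r ∈ [N]`, there is one pole in each interval `]λ_{i+1}, λ_i[`, the gluing rules hold at the points
`λ_l`, and the value at `Q_r = ∞` is the normalized combination of `f^{(r)}` (row `N - r + 1`) and
the heat solutions of the rows below, with positive parameters `ε`. -/
structure IsVacuum {N M J : ℕ} (A : Matrix (Fin N) (Fin M) ℝ) (k : Fin M → ℝ) (ξ : ℝ)
    (d : VacuumData) : Prop where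
  eps_pos : ∀ r ∈ Finset.Icc 1 N, ∀ j ∈ Finset.Icc 1 (r - 1), 0 < d.ε r j
  pole_mem : ∀ r ∈ Finset.Icc 1 N, ∀ i ∈ Finset.Icc 1 (M - N),
    d.b r i ∈ Set.Ioo (lam ξ (i + 1)) (lam ξ i)
  glue : ∀ r ∈ Finset.Icc 1 N, ∀ l ∈ Finset.Icc 1 (M - N + 1), ∀ t : Fin J → ℝ,
    vacuum N k ξ d r (lam ξ l) t = vacuumValue N k ξ d r l t
  limit : ∀ r ∈ Finset.Icc 1 N, ∀ t : Fin J → ℝ,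
    Tendsto (fun z : ℝ => vacuum N k ξ d r z t) (cocompact ℝ)
      (𝓝 ((heat A k (N - r + 1) t +
            ∑ j ∈ Finset.Icc 1 (r - 1), d.ε r j * heat A k (N - r + 1 + j) t) /
          (1 + ∑ j ∈ Finset.Icc 1 (r - 1), d.ε r j)))

/-! ### After the Darboux transformation. -/

/-- `DΨ^{(r)}(z, t)`. -/
def DPsi {N M J : ℕ} [NeZero J] (A : Matrix (Fin N) (Fin M) ℝ) (k : Fin M → ℝ) (ξ : ℝ)
    (d : VacuumData) (r : ℕ) (z : ℝ) (t : Fin J → ℝ) : ℝ :=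
  darboux A k (vacuum N k ξ d r z) t

/-- `DV^{(r)}_l(t)`. -/
def DV {N M J : ℕ} [NeZero J] (A : Matrix (Fin N) (Fin M) ℝ) (k : Fin M → ℝ) (ξ : ℝ)
    (d : VacuumData) (r l : ℕ) (t : Fin J → ℝ) : ℝ :=
  darboux A k (vacuumValue N k ξ d r l) t

/-- `γ_1, …, γ_{M-N-1}` are the zeros `γ^{(r)}_n(t)` of `DΨ^{(r)}(·, t)`, i.e.
`DΨ^{(r)}(z, t) = R ∏_n (z - γ_n) / ∏_i (z - b^{(r)}_i)` with `R ≠ 0`.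
At `t = 0` they form the part of the Krichever divisor lying on the sheet `Γ_r`. -/
def IsZeroDivisor {N M J : ℕ} [NeZero J] (A : Matrix (Fin N) (Fin M) ℝ) (k : Fin M → ℝ) (ξ : ℝ)
    (d : VacuumData) (r : ℕ) (t : Fin J → ℝ) (γ : ℕ → ℝ) : Prop :=
  ∃ R : ℝ, R ≠ 0 ∧ ∀ z : ℝ, (∀ i ∈ Finset.Icc 1 (M - N), z ≠ d.b r i) →
    DPsi A k ξ d r z t =
      R * (∏ n ∈ Finset.Icc 1 (M - N - 1), (z - γ n)) /
        ∏ i ∈ Finset.Icc 1 (M - N), (z - d.b r i)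

/-- `∑_{l=1}^n B̂^{(r)}_l DV^{(r)}_l(t)`. -/
def partialSum {N M J : ℕ} [NeZero J] (A : Matrix (Fin N) (Fin M) ℝ) (k : Fin M → ℝ) (ξ : ℝ)
    (d : VacuumData) (r n : ℕ) (t : Fin J → ℝ) : ℝ :=
  ∑ l ∈ Finset.Icc 1 n, Bhat A r l * DV A k ξ d r l t

/-- `Δ_{[j; N-r+n+1, …, N+n-1]} / Δ_{[N-r+n+1, …, N+n-1]}`. -/
def minorRatio {N M : ℕ} (A : Matrix (Fin N) (Fin M) ℝ) (r n j : ℕ) : ℝ :=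
  minor A (consRun j (N - r + n + 1) (r - 1)) / minor A (run (N - r + n + 1) (r - 1))

/-- `∑_{j=N-r+1}^{N-r+n} Δ_{[j; N-r+n+1, …, N+n-1]} / Δ_{[N-r+n+1, …, N+n-1]} P^{(0)}(k_j) e^{θ_j}`. -/
def leadingSum {N M J : ℕ} [NeZero J] (A : Matrix (Fin N) (Fin M) ℝ) (k : Fin M → ℝ)
    (r n : ℕ) (t : Fin J → ℝ) : ℝ :=
  ∑ j ∈ Finset.Icc (N - r + 1) (N - r + n),
    minorRatio A r n j * darbouxPoly A k t (phase k j) * Real.exp (theta (phase k j) t)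

/-- The genericity condition on the sheet `Γ_r`: none of the leading-order sums vanishes. -/
def IsGeneric {N M J : ℕ} [NeZero J] (A : Matrix (Fin N) (Fin M) ℝ) (k : Fin M → ℝ)
    (r : ℕ) (t : Fin J → ℝ) : Prop :=
  ∀ n ∈ Finset.Icc 1 (M - N), leadingSum A k r n t ≠ 0

end KPSoliton

end

noncomputable section

namespace KPSoliton

/-! ### Minors of normalized banded matrices -/

section Minors

variable {N M : ℕ} {A : Matrix (Fin N) (Fin M) ℝ}

/-! Every function of $t$ in the construction is a sum $\sum_j c_je^{\theta_j}$, and distinct phases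
make such a sum determine its coefficients (`expSum_injective`). Suppose the values $V^{(r)}_l$ are
known. The gluing rules then say that $\sum_l \mathring B_l\prod_{j\ne l}(\lambda-\lambda_j)$ equals
$\prod_i(\lambda-b_i)$ (`nodePoly_of_glue`). Conversely, positive $\mathring B_l$ with sum one
produce poles interlacing the nodes (`exists_interlacing`). What is left is the limit at infinity:
comparing the coefficients of $e^{\theta_j}$, $N-r+1\le j\le M$, gives a square linear system for
$(1+\sum\epsilon)\mathring B$ and $\epsilon$. Its solution determines the $V^{(r+1)}_l$, so the
whole construction is a recursion (`canV`, `canB`, `canEps`). It gives existence and uniqueness as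
soon as the determinants are nonzero and the solutions positive (`IsAdmissible`).

For large $\xi$ the point $\alpha_l$ lies between $|\lambda_{l-1}|$ and $|\lambda_l|$, far from both
in ratio. Hence $V^{(r+1)}_l$ tends to the average of $V^{(r)}_1,\dots,V^{(r)}_{l-1}$ with weights
$\hat B^{(r)}$. The limiting system is triangular and is solved by $\hat B^{(r)}$ and $\epsilon=0$.
The reason is `IsNormalizedBanded.sum_Bhat_mul_limitCoeff`: the partial sums of $\hat
B^{(r)}_lV^{(r)}_l$ have quotients of minors as limiting coefficients, because a three term Plücker
relation telescopes. As $\epsilon$ tends to zero, its positivity needs the exact order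
$\epsilon_i\asymp\xi^{-i}$, obtained from two-sided estimates of the tails of the $V_l$
(`CoeffAsymptotics.solAsymptotics`, `CoeffAsymptotics.next`).

The operator $D$ kills every $f_i$, so $D\Psi^{(r)}$ vanishes at infinity and its numerator has
degree at most $M-N-1$. Put $a_l=\mathring B_lDV_l$ and $s_n=\sum_{l\le n}a_l$. At
$\lambda=u\xi^{2(n-1)}$ the numerator, divided by all node factors except one, is
$s_{n+1}+s_n/u+O(\xi^{-1})$. This forces a real root near $u=-s_n/s_{n+1}$ (`exists_root_near`). The
roots for different $n$ have different orders of magnitude, so they exhaust the degree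
(`exists_roots`), and $s_n\to L_n$ by the partial sum identity.

For genericity, $L_n$ is $D$ applied to an exponential sum supported on $n\le M-N$ exponentials. The
kernel of $D$ is spanned by the $f_i$, and a nonzero combination of the rows of $\hat A$ cannot
vanish on $N$ columns. So $L_n$ vanishes on no interval in $x$. At $t=0$, $L_n=0$ forces a nonzero
polynomial in the phases to vanish. -/

theorem IsNormalizedBanded.entry_eq_zero (hA : IsNormalizedBanded A) {i j : ℕ}
    (h : j < i ∨ M - N + i < j) : entry A i j = 0 := by
  by_cases hij : (1 ≤ i ∧ i ≤ N) ∧ (1 ≤ j ∧ j ≤ M)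
  · exact hA.band i (Finset.mem_Icc.2 hij.1) j (Finset.mem_Icc.2 hij.2) h
  · unfold entry; rw [dif_neg hij]

@[simp] theorem minor_zero (c : Fin 0 → ℕ) : minor A c = 1 := by
  simp [minor]

theorem run_succ (a m : ℕ) : run a (m + 1) = consRun a (a + 1) m := by
  funext i
  refine Fin.cases ?_ (fun i => ?_) i
  · simp [run, consRun]
  · simp [run, consRun]; omega

/-- The minor with first column `j` is an affine combination of the entries of that column. -/
theorem exists_minor_cons {m : ℕ} (hm : m + 1 ≤ N) (c : Fin m → ℕ) :
    ∃ d : Fin m → ℝ, ∀ j : ℕ, minor A (Fin.cons j c : Fin (m + 1) → ℕ) =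
      entry A (N - m) j * minor A c + ∑ i : Fin m, d i * entry A (N - m + i + 1) j := by
  refine ⟨fun i => (-1) ^ ((i : ℕ) + 1) *
    (Matrix.of fun p q : Fin m => entry A (N - (m + 1) + ((i.succ.succAbove p : Fin (m + 1)) : ℕ) + 1)
      (c q)).det, fun j => ?_⟩
  rw [minor, Matrix.det_succ_column_zero, Fin.sum_univ_succ]
  congr 1
  · have h1 : N - (m + 1) + 0 + 1 = N - m := by omega
    simp only [Fin.val_zero, pow_zero, one_mul, Matrix.of_apply, Fin.cons_zero, h1]
    congr 1
    unfold minor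
    congr 1
    ext p q
    simp only [Matrix.submatrix_apply, Matrix.of_apply, Fin.succAbove_zero, Fin.val_succ,
      Fin.cons_succ]
    congr 1; omega
  · refine Finset.sum_congr rfl fun i _ => ?_
    have h1 : N - (m + 1) + ((i : ℕ) + 1) + 1 = N - m + i + 1 := by omega
    simp only [Fin.val_succ, Matrix.of_apply, Fin.cons_zero, h1]
    have : ((Matrix.of fun p q : Fin (m + 1) => entry A (N - (m + 1) + (p : ℕ) + 1)
        ((Fin.cons j c : Fin (m + 1) → ℕ) q)).submatrix i.succ.succAbove Fin.succ) =
        (Matrix.of fun p q : Fin m =>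
          entry A (N - (m + 1) + ((i.succ.succAbove p : Fin (m + 1)) : ℕ) + 1) (c q)) := by
      ext p q; simp
    rw [this]; ring

/-- A combination of the last `m` rows that vanishes on `m` columns with nonzero minor is zero. -/
theorem eq_zero_of_minor_ne_zero {m : ℕ} {c : Fin m → ℕ} (hc : minor A c ≠ 0) {d : Fin m → ℝ}
    (hd : ∀ q : Fin m, ∑ i : Fin m, d i * entry A (N - m + i + 1) (c q) = 0) : d = 0 := by
  refine Matrix.eq_zero_of_vecMul_eq_zero hc ?_
  funext q
  simpa [Matrix.vecMul, dotProduct] using hd q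

theorem minor_consRun_eq_zero {j a m : ℕ} (h1 : a ≤ j) (h2 : j < a + m) :
    minor A (consRun j a m) = 0 := by
  unfold minor
  refine Matrix.det_zero_of_column_eq (i := 0) (j := Fin.succ ⟨j - a, by omega⟩)
    (Fin.succ_ne_zero _).symm fun p => ?_
  simp only [Matrix.of_apply, consRun, Fin.cons_zero, Fin.cons_succ, run]
  congr 1; omega

/-- The three term relation between minors with consecutive columns. -/
theorem minor_consRun_three_term {a m : ℕ} (hm : m + 2 ≤ N)
    (h1 : minor A (run (a + 1) (m + 1)) ≠ 0) (h2 : minor A (run a (m + 1)) ≠ 0)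
    (h3 : minor A (run (a + 1) m) ≠ 0) (j : ℕ) :
    minor A (consRun j (a + 1) (m + 1)) / minor A (run (a + 1) (m + 1)) =
      minor A (consRun j a (m + 1)) / minor A (run a (m + 1)) +
      minor A (run a (m + 2)) * minor A (run (a + 1) m) /
        (minor A (run (a + 1) (m + 1)) * minor A (run a (m + 1))) *
        (minor A (consRun j (a + 1) m) / minor A (run (a + 1) m)) := by
  obtain ⟨x, hx⟩ := exists_minor_cons (A := A) hm (run (a + 1) (m + 1))
  obtain ⟨y, hy⟩ := exists_minor_cons (A := A) hm (run a (m + 1))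
  obtain ⟨z, hz⟩ := exists_minor_cons (A := A) (m := m) (by omega) (run (a + 1) m)
  set α := minor A (run (a + 1) (m + 1)) with hα
  set β := minor A (run a (m + 1)) with hβ
  set δ := minor A (run (a + 1) m) with hδ
  set ρ := minor A (run a (m + 2)) * δ / (α * β) with hρ
  let e : Fin (m + 1) → ℝ := fun i => x i / α - y i / β -
    ρ * (Fin.cons 1 (fun i => z i / δ) : Fin (m + 1) → ℝ) i
  have key : ∀ j, minor A (consRun j (a + 1) (m + 1)) / α - minor A (consRun j a (m + 1)) / β -
      ρ * (minor A (consRun j (a + 1) m) / δ) =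
      ∑ i : Fin (m + 1), e i * entry A (N - (m + 1) + i + 1) j := by
    intro j
    have hz' : minor A (consRun j (a + 1) m) / δ = ∑ i : Fin (m + 1),
        (Fin.cons 1 (fun i => z i / δ) : Fin (m + 1) → ℝ) i * entry A (N - (m + 1) + i + 1) j := by
      rw [consRun, hz, Fin.sum_univ_succ]
      have e1 : N - (m + 1) + 0 + 1 = N - m := by omega
      have e2 : ∀ i : Fin m, N - (m + 1) + ((i : ℕ) + 1) + 1 = N - m + i + 1 := by
        intro i; omega
      simp only [Fin.cons_zero, Fin.cons_succ, Fin.val_zero, Fin.val_succ, e1, e2, one_mul]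
      rw [add_div, mul_div_assoc, div_self h3, mul_one, Finset.sum_div]
      congr 1
      exact Finset.sum_congr rfl fun i _ => by ring
    rw [hz', consRun, consRun, hx, hy]
    simp only [e, sub_mul, Finset.sum_sub_distrib, Finset.mul_sum, add_div, Finset.sum_div,
      mul_div_assoc, div_self h1, div_self h2]
    simp only [div_mul_eq_mul_div, mul_div_assoc, mul_assoc]
    ring
  have he : e = 0 := by
    -- Each of the first two quotients contains row `N - (m + 1)` with coefficient one, so their
    -- difference involves only the last `m + 1` rows, as does the third term. It therefore suffices
    -- to vanish on the `m + 1` columns `a, …, a + m`. Repeated columns give this for all but column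
    -- `a`, and column `a` is what fixes the value of `ρ`.
    refine eq_zero_of_minor_ne_zero (c := run a (m + 1)) h2 fun q => ?_
    rw [← key]
    rcases Nat.eq_zero_or_pos (q : ℕ) with h | h
    · have hq : run a (m + 1) q = a := by simp [run, h]
      rw [hq, minor_consRun_eq_zero (a := a) le_rfl (by omega), ← run_succ, ← run_succ, ← hβ, hρ]
      field_simp
      ring
    · have hq : run a (m + 1) q = a + q := rfl
      rw [hq, minor_consRun_eq_zero (by omega) (by omega),
        minor_consRun_eq_zero (by omega) (by omega), minor_consRun_eq_zero (by omega) (by omega)]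
      ring
  have := key j
  rw [he] at this
  simp only [Pi.zero_apply, zero_mul, Finset.sum_const_zero] at this
  linarith

theorem minor_cons_of_row_eq_zero {m : ℕ} (hm : m + 1 ≤ N) (j : ℕ) (c : Fin m → ℕ)
    (h : ∀ q, entry A (N - m) (c q) = 0) :
    minor A (Fin.cons j c : Fin (m + 1) → ℕ) = entry A (N - m) j * minor A c := by
  rw [minor, Matrix.det_succ_row_zero, Fin.sum_univ_succ, Finset.sum_eq_zero, add_zero]
  · have h1 : N - (m + 1) + 0 + 1 = N - m := by omega
    simp only [Fin.val_zero, pow_zero, one_mul, Matrix.of_apply, Fin.cons_zero, h1]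
    congr 1
    unfold minor
    congr 1
    ext p q
    simp only [Matrix.submatrix_apply, Matrix.of_apply, Fin.succAbove_zero, Fin.val_succ,
      Fin.cons_succ]
    congr 1; omega
  · intro i _
    have h1 : N - (m + 1) + 0 + 1 = N - m := by omega
    simp [h1, h]

theorem minor_cons_of_col_eq_zero {m : ℕ} (hm : m + 1 ≤ N) (j : ℕ) (c : Fin m → ℕ)
    (h : ∀ i, N - m < i → entry A i j = 0) :
    minor A (Fin.cons j c : Fin (m + 1) → ℕ) = entry A (N - m) j * minor A c := by
  obtain ⟨d, hd⟩ := exists_minor_cons (A := A) hm c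
  rw [hd, Finset.sum_eq_zero, add_zero]
  intro i _
  rw [h _ (by omega), mul_zero]

theorem strictMono_cons {m a : ℕ} {c : Fin m → ℕ} (hc : StrictMono c) (h : ∀ q, a < c q) :
    StrictMono (Fin.cons a c : Fin (m + 1) → ℕ) := by
  intro i j hij
  induction i using Fin.cases with
  | zero =>
    induction j using Fin.cases with
    | zero => exact absurd hij (lt_irrefl _)
    | succ j => simpa using h j
  | succ i =>
    induction j using Fin.cases with
    | zero => exact absurd hij (by simp)
    | succ j => simpa using hc (Fin.succ_lt_succ_iff.1 hij)

/-- This product is the maximal minor on the columns `1, …, p` followed by `c`: the band condition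
clears each of the first `p` columns below the diagonal, so that the determinant splits. Only the
product is known to be positive here; the sign of the factors needs the row sums. -/
theorem IsNormalizedBanded.prod_mul_minor_pos (hA : IsNormalizedBanded A) (p : ℕ) :
    ∀ (m : ℕ), m + p = N → ∀ c : Fin m → ℕ, StrictMono c → (∀ q, N - m < c q ∧ c q ≤ M) →
      0 < (∏ i ∈ Finset.Icc 1 p, entry A i i) * minor A c := by
  induction p with
  | zero =>
    intro m hm c hc hcq
    obtain rfl : m = N := by omega
    have h := hA.maximal_minors (fun q => ⟨c q - 1, by have := hcq q; omega⟩)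
      (fun q q' hq => by
        have h1 := hc hq
        have h2 := hcq q
        simp only [Fin.mk_lt_mk]; omega)
    have : minor A c = (A.submatrix id fun q => ⟨c q - 1, by have := hcq q; omega⟩).det := by
      unfold minor
      congr 1
      ext p q
      have h2 := hcq q
      simp only [Matrix.of_apply, Matrix.submatrix_apply, entry, id]
      rw [dif_pos (by omega)]
      congr 1
      ext
      simp
    simpa [this] using h
  | succ p ih =>
    intro m hm c hc hcq
    have h := ih (m + 1) (by omega) (Fin.cons (N - m) c) (strictMono_cons hc fun q => (hcq q).1) (by
        intro q
        refine Fin.cases ?_ (fun q => ?_) q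
        · simp only [Fin.cons_zero]
          constructor
          · omega
          · have hNM : N ≤ M := by
              by_contra hlt
              have := hA.row_sum N (Finset.mem_Icc.2 ⟨by omega, le_rfl⟩)
              rw [Finset.sum_eq_zero] at this
              · norm_num at this
              · intro j hj
                exact hA.entry_eq_zero (.inl (by have := (Finset.mem_Icc.1 hj).2; omega))
            omega
        · have := hcq q
          simp only [Fin.cons_succ]; omega)
    rw [minor_cons_of_col_eq_zero (by omega) _ _ fun i hi => hA.entry_eq_zero (.inl hi)] at h
    rw [Finset.prod_Icc_succ_top (by omega), mul_assoc]
    have e : N - m = p + 1 := by omega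
    rwa [e] at h

theorem run_strictMono (a m : ℕ) : StrictMono (run a m) := fun _ _ h => by
  simp only [run]; have : (_ : ℕ) < _ := h; omega

/-- Positive maximal minors alone allow two rows to change sign together; the normalization of the
row sums excludes this. With the last `m` columns used for the last `m` rows, every entry of row `N
- m` inside the band has the sign of the product `P` of the preceding diagonal entries. Summing `P *
entry` along the row gives `P` itself. -/
theorem IsNormalizedBanded.prod_diag_pos (hA : IsNormalizedBanded A) (hNM : N ≤ M) (m : ℕ) :
    ∀ p, m + p = N → 0 < ∏ i ∈ Finset.Icc 1 p, entry A i i := by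
  induction m with
  | zero =>
    intro p hp
    simpa using hA.prod_mul_minor_pos p 0 hp Fin.elim0 (fun i => i.elim0) (fun i => i.elim0)
  | succ m ih =>
    intro p hp
    have hpos : 0 < minor A (run (M - m + 1) m) := by
      refine pos_of_mul_pos_right (hA.prod_mul_minor_pos (p + 1) m (by omega) _
        (run_strictMono _ _) fun q => ?_) (ih (p + 1) (by omega)).le
      simp only [run]; omega
    set P := ∏ i ∈ Finset.Icc 1 p, entry A i i with hP
    have hterm : ∀ j ∈ Finset.Icc (N - m) (M - m), 0 < P * entry A (N - m) j := by
      intro j hj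
      rw [Finset.mem_Icc] at hj
      have h := hA.prod_mul_minor_pos p (m + 1) hp (Fin.cons j (run (M - m + 1) m))
        (strictMono_cons (run_strictMono _ _) fun q => by simp only [run]; omega) (by
          intro q
          refine Fin.cases ?_ (fun q => ?_) q
          · simp only [Fin.cons_zero]; omega
          · simp only [Fin.cons_succ, run]; omega)
      rw [minor_cons_of_row_eq_zero (by omega) _ _ fun q =>
        hA.entry_eq_zero (.inr (by simp only [run]; omega)), ← mul_assoc] at h
      exact pos_of_mul_pos_left h hpos.le
    have hsum := hA.row_sum (N - m) (Finset.mem_Icc.2 (by omega))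
    rw [← Finset.sum_subset (s₁ := Finset.Icc (N - m) (M - m))] at hsum
    · calc 0 < ∑ j ∈ Finset.Icc (N - m) (M - m), P * entry A (N - m) j :=
            Finset.sum_pos hterm ⟨N - m, Finset.mem_Icc.2 (by omega)⟩
        _ = P := by rw [← Finset.mul_sum, hsum, mul_one]
    · intro j hj
      rw [Finset.mem_Icc] at hj ⊢; omega
    · intro j hj hj'
      rw [Finset.mem_Icc] at hj hj'
      exact hA.entry_eq_zero (by omega)

/-- Minors of the last `m` rows with increasing columns to the right of column `N - m` are
positive. -/
theorem IsNormalizedBanded.minor_pos (hA : IsNormalizedBanded A) (hNM : N ≤ M) {m : ℕ}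
    (hm : m ≤ N) {c : Fin m → ℕ} (hc : StrictMono c) (hcq : ∀ q, N - m < c q ∧ c q ≤ M) :
    0 < minor A c :=
  pos_of_mul_pos_right (hA.prod_mul_minor_pos (N - m) m (by omega) c hc hcq)
    (hA.prod_diag_pos hNM m (N - m) (by omega)).le

theorem IsNormalizedBanded.minor_run_pos (hA : IsNormalizedBanded A) (hNM : N ≤ M) {a m : ℕ}
    (hm : m ≤ N) (ha : N - m < a) (ham : a + m ≤ M + 1) : 0 < minor A (run a m) :=
  hA.minor_pos hNM hm (run_strictMono a m) fun q => by simp only [run]; omega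

theorem IsNormalizedBanded.minor_consRun_pos (hA : IsNormalizedBanded A) (hNM : N ≤ M)
    {j a m : ℕ} (hm : m + 1 ≤ N) (hj : N - (m + 1) < j) (hja : j < a) (hjM : j ≤ M)
    (ham : a + m ≤ M + 1) : 0 < minor A (consRun j a m) :=
  hA.minor_pos hNM hm (strictMono_cons (run_strictMono a m) fun q => by simp only [run]; omega)
    fun q => by
      refine Fin.cases ?_ (fun q => ?_) q
      · simp only [consRun, Fin.cons_zero]; omega
      · simp only [consRun, Fin.cons_succ, run]; omega

/-! ### Leading order data -/

theorem minorRatio_one (hN : 1 ≤ N) (n j : ℕ) : minorRatio A 1 n j = entry A N j := by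
  have h := minor_cons_of_row_eq_zero (A := A) (m := 0) hN j (run (N - 1 + n + 1) 0)
    (fun q => q.elim0)
  simp only [minor_zero, mul_one, Nat.sub_zero] at h
  have h2 : minor A (run (N - 1 + n + 1) (1 - 1)) = 1 := minor_zero _
  rw [minorRatio, h2, div_one]
  exact h

theorem IsNormalizedBanded.minorRatio_pos (hA : IsNormalizedBanded A) (hNM : N ≤ M) {r n j : ℕ}
    (hr : r ∈ Finset.Icc 1 N) (hn : n ≤ M - N + 1)
    (hj : j ∈ Finset.Icc (N - r + 1) (N - r + n)) : 0 < minorRatio A r n j := by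
  rw [Finset.mem_Icc] at hr hj
  exact div_pos (hA.minor_consRun_pos hNM (by omega) (by omega) (by omega) (by omega) (by omega))
    (hA.minor_run_pos hNM (by omega) (by omega) (by omega))

/-- For `n = M - N + 1` the auxiliary columns are the last `r - 1` ones, where row `N - r + 1`
vanishes; the minor then factors. -/
theorem IsNormalizedBanded.minorRatio_last (hA : IsNormalizedBanded A) (hNM : N ≤ M) {r : ℕ}
    (hr : r ∈ Finset.Icc 1 N) (j : ℕ) :
    minorRatio A r (M - N + 1) j = entry A (N - r + 1) j := by
  rw [Finset.mem_Icc] at hr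
  have hpos : 0 < minor A (run (N - r + (M - N + 1) + 1) (r - 1)) :=
    hA.minor_run_pos hNM (by omega) (by omega) (by omega)
  rw [minorRatio, consRun, minor_cons_of_row_eq_zero (by omega), mul_div_assoc,
    div_self hpos.ne', mul_one]
  · congr 1; omega
  · intro q
    exact hA.entry_eq_zero (.inr (by simp only [run]; omega))

/-- The coefficients of `∑_{l ≤ n} B̂^{(r)}_l V̂^{(r)}_l` in the basis `e^{θ_j}`. -/
def partialCoeff {N M : ℕ} (A : Matrix (Fin N) (Fin M) ℝ) (r n j : ℕ) : ℝ :=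
  if j ∈ Finset.Icc (N - r + 1) (N - r + n) then minorRatio A r n j else 0

theorem minorRatio_eq_zero {r n j : ℕ} (h1 : N - r + n < j) (h2 : j < N - r + n + r) :
    minorRatio A r n j = 0 := by
  rw [minorRatio, minor_consRun_eq_zero (by omega) (by omega), zero_div]

/-- The limits of the coefficients of `V^{(r)}_l` in the basis `e^{θ_j}`. -/
def limitCoeff {N M : ℕ} (A : Matrix (Fin N) (Fin M) ℝ) (r l j : ℕ) : ℝ :=
  if r = 1 then (if j = N + l - 1 then 1 else 0)
  else if l = 1 then (if j = N - r + 1 then 1 else 0)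
  else partialCoeff A (r - 1) (l - 1) j / ∑ s ∈ Finset.Icc 1 M, partialCoeff A (r - 1) (l - 1) s

theorem sum_partialCoeff (r n : ℕ) (h : N - r + n ≤ M) : ∑ s ∈ Finset.Icc 1 M, partialCoeff A r n s =
    ∑ s ∈ Finset.Icc (N - r + 1) (N - r + n), minorRatio A r n s := by
  unfold partialCoeff
  rw [Finset.sum_ite_mem, Finset.inter_eq_right.2]
  intro s; simp only [Finset.mem_Icc]; omega

theorem IsNormalizedBanded.sum_partialCoeff_pos (hA : IsNormalizedBanded A) (hNM : N ≤ M)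
    {r n : ℕ} (hr : r ∈ Finset.Icc 1 N) (hn : n ∈ Finset.Icc 1 (M - N + 1)) :
    0 < ∑ s ∈ Finset.Icc 1 M, partialCoeff A r n s := by
  have h := hr
  rw [Finset.mem_Icc] at h hn
  rw [sum_partialCoeff _ _ (by omega)]
  exact Finset.sum_pos (fun j hj => hA.minorRatio_pos hNM hr hn.2 hj)
    ⟨N - r + 1, Finset.mem_Icc.2 (by omega)⟩

/-- The increment from `n` to `n + 1` is the three term relation of minors. The sum of minors in the
numerator of `Bhat` is, up to one minor, the normalizing denominator of `limitCoeff`, and it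
cancels. Together with `partialCoeff_last` this is why `Bhat` solves the limiting system; for
smaller `n` it produces the sums $L_n$. -/
theorem IsNormalizedBanded.sum_Bhat_mul_limitCoeff (hA : IsNormalizedBanded A) (hNM : N ≤ M)
    {r : ℕ} (hr : r ∈ Finset.Icc 1 N) (j : ℕ) {n : ℕ} (hn : n ≤ M - N + 1) :
    ∑ l ∈ Finset.Icc 1 n, Bhat A r l * limitCoeff A r l j = partialCoeff A r n j := by
  have hr' := Finset.mem_Icc.1 hr
  induction n with
  | zero => simp [partialCoeff]
  | succ n ih =>
    rw [Finset.sum_Icc_succ_top (by omega), ih (by omega)]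
    rcases Nat.lt_or_ge 1 r with hr1 | hr1
    swap
    · obtain rfl : r = 1 := by omega
      simp only [partialCoeff, minorRatio_one hr'.2, Bhat, limitCoeff, if_true, Finset.mem_Icc]
      split_ifs <;> first | omega | simp_all
    have hne : r ≠ 1 := by omega
    rcases Nat.eq_zero_or_pos n with rfl | hn0
    · simp only [partialCoeff, Bhat, limitCoeff, if_neg hne, zero_add, if_true, Finset.mem_Icc]
      by_cases hj : j = N - r + 1
      · subst hj
        have hpos : 0 < minor A (run (N - r + 1 + 1) (r - 1)) :=
          hA.minor_run_pos hNM (by omega) (by omega) (by omega)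
        have e : N - (r - 1) = N - r + 1 := by omega
        have h : minorRatio A r 1 (N - r + 1) = entry A (N - r + 1) (N - r + 1) := by
          rw [minorRatio, consRun, minor_cons_of_col_eq_zero (by omega) _ _
            fun i hi => hA.entry_eq_zero (.inl (by omega)), mul_div_assoc, div_self hpos.ne', e,
            mul_one]
        simp [h]
      · simp only [hj, if_false]
        split_ifs <;> first | omega | simp
    · obtain ⟨m, rfl⟩ : ∃ m, r = m + 2 := ⟨r - 2, by omega⟩
      have hsum := hA.sum_partialCoeff_pos hNM (r := m + 1) (n := n)
        (Finset.mem_Icc.2 (by omega)) (Finset.mem_Icc.2 (by omega))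
      set a := N - (m + 2) + (n + 1) with ha
      have p1 : 0 < minor A (run (a + 1) (m + 1)) :=
        hA.minor_run_pos hNM (by omega) (by omega) (by omega)
      have p2 : 0 < minor A (run a (m + 1)) :=
        hA.minor_run_pos hNM (by omega) (by omega) (by omega)
      have p3 : 0 < minor A (run (a + 1) m) :=
        hA.minor_run_pos hNM (by omega) (by omega) (by omega)
      have h3 := minor_consRun_three_term (A := A) (a := a) (by omega) p1.ne' p2.ne' p3.ne'
      have hX : ∀ j, minorRatio A (m + 2) (n + 1) j =
          minor A (consRun j (a + 1) (m + 1)) / minor A (run (a + 1) (m + 1)) := fun j => rfl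
      have hY : ∀ j, minorRatio A (m + 2) n j =
          minor A (consRun j a (m + 1)) / minor A (run a (m + 1)) := fun j => rfl
      have hZ : ∀ j, minorRatio A (m + 1) n j =
          minor A (consRun j (a + 1) m) / minor A (run (a + 1) m) := fun j => by
        have e : N - (m + 1) + n + 1 = a + 1 := by omega
        unfold minorRatio
        rw [e]; rfl
      have hB : Bhat A (m + 2) (n + 1) * limitCoeff A (m + 2) (n + 1) j =
          minor A (run a (m + 2)) * minor A (run (a + 1) m) /
        (minor A (run (a + 1) (m + 1)) * minor A (run a (m + 1))) * partialCoeff A (m + 1) n j := by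
        rw [sum_partialCoeff _ _ (by omega)] at hsum
        have hBh : Bhat A (m + 2) (n + 1) = minor A (run a (m + 2)) *
            (∑ s ∈ Finset.Icc (N - (m + 2) + 2) a, minor A (consRun s (a + 1) m)) /
            (minor A (run (a + 1) (m + 1)) * minor A (run a (m + 1))) := by
          unfold Bhat
          rw [if_neg hne, if_neg (by omega)]
          rfl
        have hlim : limitCoeff A (m + 2) (n + 1) j = partialCoeff A (m + 1) n j /
            ∑ s ∈ Finset.Icc 1 M, partialCoeff A (m + 1) n s := by
          unfold limitCoeff
          rw [if_neg hne, if_neg (by omega)]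
          rfl
        rw [hlim, sum_partialCoeff _ _ (by omega)]
        have e : ∑ s ∈ Finset.Icc (N - (m + 2) + 2) a, minor A (consRun s (a + 1) m) =
            minor A (run (a + 1) m) * ∑ s ∈ Finset.Icc (N - (m + 1) + 1) (N - (m + 1) + n),
              minorRatio A (m + 1) n s := by
          rw [Finset.mul_sum]
          have e1 : N - (m + 2) + 2 = N - (m + 1) + 1 := by omega
          have e2 : a = N - (m + 1) + n := by omega
          rw [e1, e2]
          refine Finset.sum_congr rfl fun s _ => ?_
          rw [hZ, ← e2]
          field_simp
        rw [hBh, e]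
        field_simp
      rw [hB]
      -- Inside the larger support the truncations in `partialCoeff` may be ignored: a minor with a
      -- repeated column vanishes at the right end, and a column that is zero in the rows involved
      -- does the same at the left end.
      by_cases h1 : j ∈ Finset.Icc (N - (m + 2) + 1) (N - (m + 2) + (n + 1))
      · have hl : (if j ∈ Finset.Icc (N - (m + 2) + 1) (N - (m + 2) + n) then
            minorRatio A (m + 2) n j else 0) = minorRatio A (m + 2) n j := by
          split_ifs with h2
          · rfl
          · rw [Finset.mem_Icc] at h1 h2
            exact (minorRatio_eq_zero (by omega) (by omega)).symm
        have hr : (if j ∈ Finset.Icc (N - (m + 1) + 1) (N - (m + 1) + n) then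
            minorRatio A (m + 1) n j else 0) = minorRatio A (m + 1) n j := by
          split_ifs with h2
          · rfl
          · rw [Finset.mem_Icc] at h1 h2
            rw [minorRatio, consRun, minor_cons_of_col_eq_zero (by omega) _ _
              fun i hi => hA.entry_eq_zero (.inl (by omega)), hA.entry_eq_zero (.inl (by omega))]
            simp
        unfold partialCoeff
        rw [hl, hr, if_pos h1, hX, hY, hZ, h3]
      · unfold partialCoeff
        rw [if_neg h1, if_neg, if_neg]
        · simp
        all_goals
          rw [Finset.mem_Icc] at h1 ⊢
          omega

theorem IsNormalizedBanded.Bhat_pos (hA : IsNormalizedBanded A) (hNM : N ≤ M) {r l : ℕ}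
    (hr : r ∈ Finset.Icc 1 N) (hl : l ∈ Finset.Icc 1 (M - N + 1)) : 0 < Bhat A r l := by
  have hr' := Finset.mem_Icc.1 hr
  rw [Finset.mem_Icc] at hl
  have hdiag : ∀ i j, 1 ≤ i → i ≤ N → i ≤ j → j ≤ M - N + i → 0 < entry A i j := by
    intro i j h1 h2 h3 h4
    have h := hA.minorRatio_pos hNM (r := N - i + 1) (n := M - N + 1) (j := j)
      (Finset.mem_Icc.2 (by omega)) le_rfl (Finset.mem_Icc.2 (by omega))
    rwa [hA.minorRatio_last hNM (Finset.mem_Icc.2 (by omega)),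
      show N - (N - i + 1) + 1 = i by omega] at h
  unfold Bhat
  split_ifs with h1 h2
  · exact hdiag _ _ (by omega) (by omega) (by omega) (by omega)
  · exact hdiag _ _ (by omega) (by omega) (by omega) (by omega)
  · refine div_pos (mul_pos (hA.minor_run_pos hNM (by omega) (by omega) (by omega))
      (Finset.sum_pos (fun s hs => ?_) ⟨N - r + 2, Finset.mem_Icc.2 (by omega)⟩))
      (mul_pos (hA.minor_run_pos hNM (by omega) (by omega) (by omega))
        (hA.minor_run_pos hNM (by omega) (by omega) (by omega)))
    rw [Finset.mem_Icc] at hs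
    exact hA.minor_consRun_pos hNM (by omega) (by omega) (by omega) (by omega) (by omega)

theorem IsNormalizedBanded.entry_top_pos (hA : IsNormalizedBanded A) (hNM : N ≤ M) {r : ℕ}
    (hr : r ∈ Finset.Icc 1 N) : 0 < entry A (N - r + 1) (M - r + 1) := by
  have h := Finset.mem_Icc.1 hr
  rw [← hA.minorRatio_last hNM hr]
  exact hA.minorRatio_pos hNM hr le_rfl (Finset.mem_Icc.2 (by omega))

theorem limitCoeff_eq_zero {r l j : ℕ} (hr : r ∈ Finset.Icc 1 N) (hl : 1 ≤ l)
    (h : N - r + l < j) : limitCoeff A r l j = 0 := by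
  rw [Finset.mem_Icc] at hr
  unfold limitCoeff partialCoeff
  split_ifs with h1 h2 h3 h4 h5 <;> first | rfl | omega | skip
  · rw [Finset.mem_Icc] at h5; omega
  · rw [zero_div]

theorem IsNormalizedBanded.limitCoeff_top_pos (hA : IsNormalizedBanded A) (hNM : N ≤ M) {r l : ℕ}
    (hr : r ∈ Finset.Icc 1 N) (hl : l ∈ Finset.Icc 1 (M - N + 1)) :
    0 < limitCoeff A r l (N - r + l) := by
  rw [Finset.mem_Icc] at hr hl
  unfold limitCoeff
  split_ifs with h1 h2 h3 h4 <;> first | omega | norm_num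
  have hr2 : r - 1 ∈ Finset.Icc 1 N := Finset.mem_Icc.2 (by omega)
  refine div_pos ?_ (hA.sum_partialCoeff_pos hNM hr2 (Finset.mem_Icc.2 (by omega)))
  have hm : N - r + l ∈ Finset.Icc (N - (r - 1) + 1) (N - (r - 1) + (l - 1)) :=
    Finset.mem_Icc.2 (by omega)
  rw [partialCoeff, if_pos hm]
  exact hA.minorRatio_pos hNM hr2 (by omega) hm

theorem IsNormalizedBanded.sum_limitCoeff (hA : IsNormalizedBanded A) (hNM : N ≤ M) {r l : ℕ}
    (hr : r ∈ Finset.Icc 1 N) (hl : l ∈ Finset.Icc 1 (M - N + 1)) :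
    ∑ j ∈ Finset.Icc 1 M, limitCoeff A r l j = 1 := by
  rw [Finset.mem_Icc] at hr hl
  unfold limitCoeff
  split_ifs with h1 h2
  · rw [Finset.sum_ite_eq' , if_pos (Finset.mem_Icc.2 (by omega))]
  · rw [Finset.sum_ite_eq' , if_pos (Finset.mem_Icc.2 (by omega))]
  · rw [← Finset.sum_div, div_self]
    exact (hA.sum_partialCoeff_pos hNM (Finset.mem_Icc.2 (by omega))
      (Finset.mem_Icc.2 (by omega))).ne'

theorem IsNormalizedBanded.sum_Bhat_eq (hA : IsNormalizedBanded A) (hNM : N ≤ M) {r n : ℕ}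
    (hr : r ∈ Finset.Icc 1 N) (hn : n ≤ M - N + 1) :
    ∑ l ∈ Finset.Icc 1 n, Bhat A r l = ∑ j ∈ Finset.Icc 1 M, partialCoeff A r n j := by
  simp_rw [← hA.sum_Bhat_mul_limitCoeff hNM hr _ hn]
  rw [Finset.sum_comm]
  refine Finset.sum_congr rfl fun l hl => ?_
  rw [Finset.mem_Icc] at hl
  rw [← Finset.mul_sum, hA.sum_limitCoeff hNM hr (Finset.mem_Icc.2 (by omega)), mul_one]

/-- This is the $\xi\to\infty$ form of `nextCoeff`, in which the weights at `α_l` have become the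
indicator of `m < l`. -/
theorem IsNormalizedBanded.limitCoeff_succ (hA : IsNormalizedBanded A) (hNM : N ≤ M) {r l : ℕ}
    (hr : r ∈ Finset.Icc 1 N) (hl : l ∈ Finset.Icc 2 (M - N + 1)) (j : ℕ) :
    limitCoeff A (r + 1) l j = (∑ m ∈ Finset.Icc 1 (l - 1), Bhat A r m * limitCoeff A r m j) /
      ∑ m ∈ Finset.Icc 1 (l - 1), Bhat A r m := by
  have hr' := Finset.mem_Icc.1 hr
  rw [Finset.mem_Icc] at hl
  rw [hA.sum_Bhat_mul_limitCoeff hNM hr _ (by omega), hA.sum_Bhat_eq hNM hr (by omega), limitCoeff,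
    if_neg (by omega), if_neg (by omega), Nat.add_sub_cancel]

theorem IsNormalizedBanded.partialCoeff_last (hA : IsNormalizedBanded A) (hNM : N ≤ M) {r : ℕ}
    (hr : r ∈ Finset.Icc 1 N) (j : ℕ) :
    partialCoeff A r (M - N + 1) j = entry A (N - r + 1) j := by
  have hr' := Finset.mem_Icc.1 hr
  unfold partialCoeff
  rw [hA.minorRatio_last hNM hr]
  split_ifs with h
  · rfl
  · rw [Finset.mem_Icc] at h
    exact (hA.entry_eq_zero (by omega)).symm

end Minors

/-! ### Functions of `ξ` equal to a constant up to `O(ξ⁻¹)` -/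

section Near

/-- `f(ξ) = c + O(ξ⁻¹)` as `ξ → ∞`. -/
def Near (f : ℝ → ℝ) (c : ℝ) : Prop := (fun ξ => f ξ - c) =O[atTop] fun ξ : ℝ => ξ⁻¹

theorem Near.tendsto {f : ℝ → ℝ} {c : ℝ} (h : Near f c) : Tendsto f atTop (𝓝 c) :=
  tendsto_sub_nhds_zero_iff.1 (h.trans_tendsto tendsto_inv_atTop_zero)

theorem Near.isBigO_one {f : ℝ → ℝ} {c : ℝ} (h : Near f c) : f =O[atTop] fun _ => (1 : ℝ) :=
  h.tendsto.isBigO_one ℝ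

theorem near_const (c : ℝ) : Near (fun _ => c) c := by
  simpa [Near] using Asymptotics.isBigO_zero _ _

theorem Near.add {f g : ℝ → ℝ} {c d : ℝ} (hf : Near f c) (hg : Near g d) :
    Near (fun ξ => f ξ + g ξ) (c + d) :=
  (Asymptotics.IsBigO.add hf hg).congr_left fun ξ => by ring

theorem Near.mul {f g : ℝ → ℝ} {c d : ℝ} (hf : Near f c) (hg : Near g d) :
    Near (fun ξ => f ξ * g ξ) (c * d) := by
  have h1 := (Asymptotics.IsBigO.mul hf hg.isBigO_one)
  have h2 := Asymptotics.IsBigO.const_mul_left hg c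
  simp only [mul_one] at h1
  exact (h1.add h2).congr_left fun ξ => by ring

theorem Near.inv {f : ℝ → ℝ} {c : ℝ} (hf : Near f c) (hc : c ≠ 0) :
    Near (fun ξ => (f ξ)⁻¹) c⁻¹ := by
  have h1 : (fun ξ => (f ξ)⁻¹ * c⁻¹) =O[atTop] fun _ => (1 : ℝ) :=
    ((hf.tendsto.inv₀ hc).mul_const _).isBigO_one ℝ
  have h2 := (Asymptotics.IsBigO.mul (Asymptotics.IsBigO.neg_left hf) h1)
  simp only [mul_one] at h2
  refine h2.congr' ?_ EventuallyEq.rfl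
  filter_upwards [hf.tendsto.eventually_ne hc] with ξ hξ
  field_simp
  ring

theorem Near.div {f g : ℝ → ℝ} {c d : ℝ} (hf : Near f c) (hg : Near g d) (hd : d ≠ 0) :
    Near (fun ξ => f ξ / g ξ) (c / d) := by
  simpa only [div_eq_mul_inv] using hf.mul (hg.inv hd)

theorem near_sum {ι : Type*} (s : Finset ι) {f : ι → ℝ → ℝ} {c : ι → ℝ}
    (h : ∀ i ∈ s, Near (f i) (c i)) : Near (fun ξ => ∑ i ∈ s, f i ξ) (∑ i ∈ s, c i) := by
  classical
  induction s using Finset.induction_on with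
  | empty => simpa using near_const 0
  | insert a s ha ih =>
    simp only [Finset.sum_insert ha]
    exact (h a (Finset.mem_insert_self _ _)).add
      (ih fun i hi => h i (Finset.mem_insert_of_mem hi))

theorem near_prod {ι : Type*} (s : Finset ι) {f : ι → ℝ → ℝ} {c : ι → ℝ}
    (h : ∀ i ∈ s, Near (f i) (c i)) : Near (fun ξ => ∏ i ∈ s, f i ξ) (∏ i ∈ s, c i) := by
  classical
  induction s using Finset.induction_on with
  | empty => simpa using near_const 1
  | insert a s ha ih =>
    simp only [Finset.prod_insert ha]
    exact (h a (Finset.mem_insert_self _ _)).mul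
      (ih fun i hi => h i (Finset.mem_insert_of_mem hi))

theorem near_det {n : ℕ} {T : ℝ → Matrix (Fin n) (Fin n) ℝ} {T' : Matrix (Fin n) (Fin n) ℝ}
    (h : ∀ p p', Near (fun ξ => T ξ p p') (T' p p')) : Near (fun ξ => (T ξ).det) T'.det := by
  simp only [Matrix.det_apply']
  exact near_sum _ fun σ _ => (near_const _).mul (near_prod _ fun i _ => h _ _)

end Near

/-! ### The weights of the previous sheet at the points `α_s` -/

/-- `α_s / (α_s - λ_l)`. -/
def weight (ξ : ℝ) (s l : ℕ) : ℝ := alpha ξ s / (alpha ξ s - lam ξ l)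

theorem alpha_pos {ξ : ℝ} (hξ : 0 < ξ) (s : ℕ) : 0 < alpha ξ s := zpow_pos hξ _

theorem lam_nonpos {ξ : ℝ} (hξ : 0 < ξ) (l : ℕ) : lam ξ l ≤ 0 := by
  unfold lam; split_ifs
  · exact le_rfl
  · have := pow_pos hξ (2 * (l - 2)); linarith

theorem weight_pos {ξ : ℝ} (hξ : 0 < ξ) (s l : ℕ) : 0 < weight ξ s l :=
  div_pos (alpha_pos hξ s) (by have := alpha_pos hξ s; have := lam_nonpos hξ l; linarith)

theorem weight_one {ξ : ℝ} (hξ : 0 < ξ) (s : ℕ) : weight ξ s 1 = 1 := by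
  have h1 := alpha_pos hξ s
  simp [weight, lam, h1.ne']

theorem weight_of_le {ξ : ℝ} (hξ : 0 < ξ) {s l : ℕ} (hs : 2 ≤ s) (h : s ≤ l) :
    weight ξ s l = (1 + ξ ^ (2 * (l - s) + 1))⁻¹ := by
  have h1 := alpha_pos hξ s
  have h2 : ξ ^ (2 * (l - 2)) = alpha ξ s * ξ ^ (2 * (l - s) + 1) := by
    rw [alpha, ← zpow_natCast, ← zpow_natCast, ← zpow_add₀ hξ.ne']
    congr 1
    push_cast [Nat.cast_sub h, Nat.cast_sub (hs.trans h)]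
    ring
  have h3 := pow_pos hξ (2 * (l - s) + 1)
  rw [weight, lam, if_neg (by omega), h2]
  generalize ξ ^ (2 * (l - s) + 1) = y at h3
  have h4 : alpha ξ s - -(alpha ξ s * y) ≠ 0 := by nlinarith [mul_pos h1 h3]
  rw [div_eq_iff h4]
  have h5 : 1 + y ≠ 0 := by linarith
  field_simp
  ring

theorem weight_of_lt {ξ : ℝ} (hξ : 0 < ξ) {s l : ℕ} (hl : 2 ≤ l) (h : l < s) :
    weight ξ s l = 1 - (1 + ξ ^ (2 * (s - l) - 1))⁻¹ := by
  have h1 := pow_pos hξ (2 * (l - 2))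
  have h2 : alpha ξ s = ξ ^ (2 * (l - 2)) * ξ ^ (2 * (s - l) - 1) := by
    rw [alpha, ← zpow_natCast, ← zpow_natCast, ← zpow_add₀ hξ.ne']
    congr 1
    have : 1 ≤ 2 * (s - l) := by omega
    push_cast [Nat.cast_sub h.le, Nat.cast_sub hl, Nat.cast_sub this]
    ring
  have h3 := pow_pos hξ (2 * (s - l) - 1)
  rw [weight, lam, if_neg (by omega), h2]
  generalize ξ ^ (2 * (s - l) - 1) = y at h3
  generalize ξ ^ (2 * (l - 2)) = x at h1
  have h4 : x * y - -x ≠ 0 := by nlinarith [mul_pos h1 h3]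
  rw [div_eq_iff h4]
  have h5 : 1 + y ≠ 0 := by linarith
  field_simp
  ring

theorem weight_le {ξ : ℝ} (hξ : 0 < ξ) {s l : ℕ} (hs : 2 ≤ s) (h : s ≤ l) :
    weight ξ s l ≤ ξ⁻¹ ^ (2 * (l - s) + 1) := by
  rw [weight_of_le hξ hs h, inv_pow]
  exact inv_anti₀ (pow_pos hξ _) (by linarith)

theorem le_weight_self {ξ : ℝ} (hξ : 1 ≤ ξ) {s : ℕ} (hs : 2 ≤ s) : ξ⁻¹ ≤ 2 * weight ξ s s := by
  have h0 : 0 < ξ := by linarith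
  rw [weight_of_le h0 hs le_rfl]
  simp only [Nat.sub_self, mul_zero, zero_add, pow_one]
  rw [← div_eq_mul_inv, inv_eq_one_div, div_le_div_iff₀ h0 (by linarith)]
  linarith

/-- On the logarithmic scale `α_s` is separated by at least one factor `ξ` from every `|λ_l|`. Nodes
with `l < s` are negligible against `α_s`, and the other nodes dominate it. -/
theorem near_weight {s l : ℕ} (hs : 2 ≤ s) (hl : 1 ≤ l) :
    Near (fun ξ => weight ξ s l) (if l < s then 1 else 0) := by
  refine Asymptotics.IsBigO.of_bound 1 ?_
  filter_upwards [eventually_ge_atTop 1] with ξ hξ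
  have h0 : 0 < ξ := by linarith
  have hi : 0 < ξ⁻¹ := inv_pos.2 h0
  rw [Real.norm_eq_abs, Real.norm_eq_abs, abs_of_pos hi, one_mul]
  split_ifs with h
  · rcases Nat.lt_or_ge l 2 with h2 | h2
    · obtain rfl : l = 1 := by omega
      rw [weight_one h0]; simpa using hi.le
    · rw [weight_of_lt h0 h2 h]
      have h3 : ξ ≤ ξ ^ (2 * (s - l) - 1) := le_self_pow₀ hξ (by omega)
      rw [abs_sub_comm, sub_sub_cancel, abs_of_pos (by positivity)]
      exact inv_anti₀ h0 (by linarith)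
  · rw [sub_zero, abs_of_pos (weight_pos h0 _ _)]
    refine (weight_le h0 hs (by omega)).trans ?_
    exact pow_le_of_le_one hi.le (inv_le_one_of_one_le₀ hξ) (by omega)

/-! ### The linear system on each sheet and its solution -/

section System

variable {N M : ℕ}

/-- The coefficients of `V^{(r)}_l` in the basis `e^{θ_j}`, given the coefficients `v` of
`V^{(r-1)}` and the coefficients `B = B^{(r-1)}`. -/
def nextCoeff (N M : ℕ) (ξ : ℝ) (B : ℕ → ℝ) (v : ℕ → ℕ → ℝ) (r l j : ℕ) : ℝ :=
  if l = 1 then (if j = N - r + 1 then 1 else 0)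
  else (∑ m ∈ Finset.Icc 1 (M - N + 1), B m * weight ξ l m * v m j) /
    ∑ m ∈ Finset.Icc 1 (M - N + 1), B m * weight ξ l m

/-- The matrix of the linear system for the unnormalized coefficients `B^{(r)}_l` and the
parameters `ε^{(r)}_i`. -/
def sysMat (A : Matrix (Fin N) (Fin M) ℝ) (r : ℕ) (v : ℕ → ℕ → ℝ) :
    Matrix (Fin (M - N + r)) (Fin (M - N + r)) ℝ :=
  Matrix.of fun p p' => if (p' : ℕ) ≤ M - N then v (p' + 1) (N - r + 1 + p)
    else -entry A (N - r + 1 + (p' - (M - N))) (N - r + 1 + p)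

def sysVec (A : Matrix (Fin N) (Fin M) ℝ) (r : ℕ) : Fin (M - N + r) → ℝ :=
  fun p => entry A (N - r + 1) (N - r + 1 + p)

/-- The solution of the linear system, by Cramer's rule. -/
def sysSol (A : Matrix (Fin N) (Fin M) ℝ) (r : ℕ) (v : ℕ → ℕ → ℝ) (p : ℕ) : ℝ :=
  if h : p < M - N + r then
    ((sysMat A r v).updateCol ⟨p, h⟩ (sysVec A r)).det / (sysMat A r v).det
  else 0

/-- The positions `0, …, M - N` of the solution carry the coefficients `B_1, …, B_{M-N+1}`, so `ε_i`
with `i ≥ 1` sits at `M - N + i`. -/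
def solEps (A : Matrix (Fin N) (Fin M) ℝ) (r : ℕ) (v : ℕ → ℕ → ℝ) (i : ℕ) : ℝ :=
  sysSol A r v (M - N + i)

/-- The limit at infinity contains the denominator $1+\sum\epsilon$. The system becomes linear in
the products $(1+\sum\epsilon)B_l$, and the division undoes this. -/
def solB (A : Matrix (Fin N) (Fin M) ℝ) (r : ℕ) (v : ℕ → ℕ → ℝ) (l : ℕ) : ℝ :=
  sysSol A r v (l - 1) / (1 + ∑ i ∈ Finset.Icc 1 (r - 1), solEps A r v i)

theorem sum_Icc_one_eq_sum_range (f : ℕ → ℝ) (n : ℕ) :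
    ∑ l ∈ Finset.Icc 1 n, f l = ∑ p ∈ Finset.range n, f (p + 1) := by
  induction n with
  | zero => simp
  | succ n ih => rw [Finset.sum_Icc_succ_top (by omega), ih, Finset.sum_range_succ]

theorem sysMat_mulVec (A : Matrix (Fin N) (Fin M) ℝ) {r : ℕ} (hr : 1 ≤ r) (v : ℕ → ℕ → ℝ)
    (x : ℕ → ℝ) (p : Fin (M - N + r)) :
    ((sysMat A r v).mulVec fun p' => x p') p =
      ∑ l ∈ Finset.Icc 1 (M - N + 1), x (l - 1) * v l (N - r + 1 + p) -
      ∑ i ∈ Finset.Icc 1 (r - 1), x (M - N + i) * entry A (N - r + 1 + i) (N - r + 1 + p) := by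
  generalize ha : N - r + 1 + (p : ℕ) = a
  let f : ℕ → ℝ := fun n => (if n ≤ M - N then v (n + 1) a
    else -entry A (N - r + 1 + (n - (M - N))) a) * x n
  have h1 : ((sysMat A r v).mulVec fun p' => x p') p = ∑ p' : Fin (M - N + r), f p' := by
    subst ha; rfl
  have h2 : ∑ n ∈ Finset.range (M - N + r), f n = ∑ n ∈ Finset.range (M - N + 1), f n +
      ∑ n ∈ Finset.range (r - 1), f (M - N + 1 + n) := by
    rw [← Finset.sum_range_add]; congr 2; omega
  rw [h1, Fin.sum_univ_eq_sum_range f, h2, sum_Icc_one_eq_sum_range, sum_Icc_one_eq_sum_range,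
    sub_eq_add_neg, ← Finset.sum_neg_distrib]
  congr 1
  · refine Finset.sum_congr rfl fun n hn => ?_
    rw [Finset.mem_range] at hn
    simp only [f]
    rw [if_pos (by omega), Nat.add_sub_cancel, mul_comm]
  · refine Finset.sum_congr rfl fun n hn => ?_
    simp only [f]
    rw [if_neg (by omega), show M - N + 1 + n - (M - N) = n + 1 by omega,
      show M - N + 1 + n = M - N + (n + 1) by omega]
    ring

theorem sysSol_eq {A : Matrix (Fin N) (Fin M) ℝ} {r : ℕ} (hr : r ∈ Finset.Icc 1 N) (hNM : N ≤ M)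
    {v : ℕ → ℕ → ℝ} (hdet : (sysMat A r v).det ≠ 0) {j : ℕ} (hj : j ∈ Finset.Icc (N - r + 1) M) :
    ∑ l ∈ Finset.Icc 1 (M - N + 1), sysSol A r v (l - 1) * v l j =
      entry A (N - r + 1) j +
        ∑ i ∈ Finset.Icc 1 (r - 1), solEps A r v i * entry A (N - r + 1 + i) j := by
  rw [Finset.mem_Icc] at hr hj
  have h := sysMat_mulVec A hr.1 v (sysSol A r v) ⟨j - (N - r + 1), by omega⟩
  have h2 : (fun p' : Fin (M - N + r) => sysSol A r v p') =
      ((sysMat A r v).det)⁻¹ • (sysMat A r v).cramer (sysVec A r) := by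
    funext p
    simp only [sysSol, p.2, dif_pos, Pi.smul_apply, Matrix.cramer_apply, smul_eq_mul]
    rw [div_eq_inv_mul]
  rw [h2, Matrix.mulVec_smul, Matrix.mulVec_cramer, inv_smul_smul₀ hdet] at h
  simp only [sysVec] at h
  rw [show N - r + 1 + (j - (N - r + 1)) = j by omega] at h
  unfold solEps
  linarith

theorem eq_sysSol {A : Matrix (Fin N) (Fin M) ℝ} {r : ℕ} (hr : r ∈ Finset.Icc 1 N) (hNM : N ≤ M)
    {v : ℕ → ℕ → ℝ} (hdet : (sysMat A r v).det ≠ 0) {x : ℕ → ℝ}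
    (hx : ∀ j ∈ Finset.Icc (N - r + 1) M,
      ∑ l ∈ Finset.Icc 1 (M - N + 1), x (l - 1) * v l j = entry A (N - r + 1) j +
        ∑ i ∈ Finset.Icc 1 (r - 1), x (M - N + i) * entry A (N - r + 1 + i) j) {p : ℕ}
    (hp : p < M - N + r) : x p = sysSol A r v p := by
  have hr' := Finset.mem_Icc.1 hr
  have h : (sysMat A r v).mulVec ((fun p' : Fin (M - N + r) => x p') -
      fun p' : Fin (M - N + r) => sysSol A r v p') = 0 := by
    rw [Matrix.mulVec_sub]
    funext p
    have hj : N - r + 1 + p ∈ Finset.Icc (N - r + 1) M := Finset.mem_Icc.2 (by omega)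
    have h1 := hx _ hj
    have h2 := sysSol_eq hr hNM hdet hj
    unfold solEps at h2
    rw [Pi.sub_apply, sysMat_mulVec A hr'.1, sysMat_mulVec A hr'.1, h1, h2, Pi.zero_apply]
    ring
  have h := congr_fun (Matrix.eq_zero_of_mulVec_eq_zero hdet h) ⟨p, hp⟩
  simpa [sub_eq_zero] using h

/-- The coefficients of `V^{(r)}_l` in the basis `e^{θ_j}` for the solution of the construction. -/
def canV (A : Matrix (Fin N) (Fin M) ℝ) (ξ : ℝ) : ℕ → ℕ → ℕ → ℝ
  | 0 => 0
  | 1 => fun l j => if j = N + l - 1 then 1 else 0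
  | r + 2 => nextCoeff N M ξ (solB A (r + 1) (canV A ξ (r + 1))) (canV A ξ (r + 1)) (r + 2)

def canB (A : Matrix (Fin N) (Fin M) ℝ) (ξ : ℝ) (r : ℕ) : ℕ → ℝ := solB A r (canV A ξ r)

def canEps (A : Matrix (Fin N) (Fin M) ℝ) (ξ : ℝ) (r : ℕ) : ℕ → ℝ := solEps A r (canV A ξ r)

theorem canV_succ (A : Matrix (Fin N) (Fin M) ℝ) (ξ : ℝ) {r : ℕ} (hr : 1 ≤ r) :
    canV A ξ (r + 1) = nextCoeff N M ξ (canB A ξ r) (canV A ξ r) (r + 1) := by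
  obtain ⟨r, rfl⟩ : ∃ s, r = s + 1 := ⟨r - 1, by omega⟩
  rfl

end System

/-! ### Large `ξ` asymptotics of the linear systems -/

section Asymptotics

variable {N M : ℕ} {A : Matrix (Fin N) (Fin M) ℝ}

/-- The matrix of the limiting system is upper triangular. -/
theorem IsNormalizedBanded.sysMat_limitCoeff_det_ne_zero (hA : IsNormalizedBanded A) (hNM : N ≤ M)
    {r : ℕ} (hr : r ∈ Finset.Icc 1 N) : (sysMat A r (limitCoeff A r)).det ≠ 0 := by
  have hr' := Finset.mem_Icc.1 hr
  rw [Matrix.det_of_isUpperTriangular]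
  -- The diagonal consists of the last nonzero coefficients: that of the limiting $V_l$ for the `B`
  -- columns, and the right end of the band for the `ε` columns.
  · refine Finset.prod_ne_zero_iff.2 fun p _ => ?_
    have hp := p.2
    simp only [sysMat, Matrix.of_apply]
    split_ifs with h
    · have := hA.limitCoeff_top_pos hNM hr (l := p + 1) (Finset.mem_Icc.2 (by omega))
      rw [show N - r + ((p : ℕ) + 1) = N - r + 1 + p by omega] at this
      exact this.ne'
    · have := hA.entry_top_pos hNM (r := r - (p - (M - N))) (Finset.mem_Icc.2 (by omega))
      rw [show N - (r - ((p : ℕ) - (M - N))) + 1 = N - r + 1 + (p - (M - N)) by omega,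
        show M - (r - ((p : ℕ) - (M - N))) + 1 = N - r + 1 + p by omega] at this
      exact neg_ne_zero.2 this.ne'
  · intro p p' hpp
    have hpp' : (p' : ℕ) < p := hpp
    simp only [sysMat, Matrix.of_apply]
    split_ifs with h
    · exact limitCoeff_eq_zero hr (by omega) (by omega)
    · rw [hA.entry_eq_zero (by omega), neg_zero]

/-- By the partial sum identity for `n = M - N + 1`, the combination with coefficients `Bhat`
already equals row `N - r + 1`, so no lower row is needed. -/
theorem IsNormalizedBanded.sysSol_limitCoeff (hA : IsNormalizedBanded A) (hNM : N ≤ M)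
    {r : ℕ} (hr : r ∈ Finset.Icc 1 N) {p : ℕ} (hp : p < M - N + r) :
    sysSol A r (limitCoeff A r) p = if p ≤ M - N then Bhat A r (p + 1) else 0 := by
  symm
  refine eq_sysSol (x := fun p => if p ≤ M - N then Bhat A r (p + 1) else 0) hr hNM
    (hA.sysMat_limitCoeff_det_ne_zero hNM hr) (fun j _ => ?_) hp
  rw [Finset.sum_eq_zero (s := Finset.Icc 1 (r - 1)), add_zero, ← hA.partialCoeff_last hNM hr,
    ← hA.sum_Bhat_mul_limitCoeff hNM hr _ le_rfl]
  · refine Finset.sum_congr rfl fun l hl => ?_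
    rw [Finset.mem_Icc] at hl
    rw [if_pos (by omega), Nat.sub_add_cancel hl.1]
  · intro i hi
    rw [Finset.mem_Icc] at hi
    rw [if_neg (by omega), zero_mul]

/-- Cramer's rule expresses the solution by polynomials in the entries, divided by a determinant
with nonzero limit, so an error $O(\xi^{-1})$ in the entries stays $O(\xi^{-1})$. -/
theorem near_sysSol (hA : IsNormalizedBanded A) (hNM : N ≤ M)
    {r : ℕ} (hr : r ∈ Finset.Icc 1 N) {v : ℝ → ℕ → ℕ → ℝ}
    (hv : ∀ l ∈ Finset.Icc 1 (M - N + 1), ∀ j, Near (fun ξ => v ξ l j) (limitCoeff A r l j)) :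
    (∀ᶠ ξ in atTop, (sysMat A r (v ξ)).det ≠ 0) ∧ ∀ p < M - N + r,
      Near (fun ξ => sysSol A r (v ξ) p) (if p ≤ M - N then Bhat A r (p + 1) else 0) := by
  have hT : ∀ p p', Near (fun ξ => sysMat A r (v ξ) p p') (sysMat A r (limitCoeff A r) p p') := by
    intro p p'
    simp only [sysMat, Matrix.of_apply]
    split_ifs with h
    · exact hv _ (Finset.mem_Icc.2 (by omega)) _
    · exact near_const _
  have hdet := near_det hT
  have h0 := hA.sysMat_limitCoeff_det_ne_zero hNM hr
  refine ⟨hdet.tendsto.eventually_ne h0, fun p hp => ?_⟩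
  rw [← hA.sysSol_limitCoeff hNM hr hp]
  simp only [sysSol, dif_pos hp]
  refine Near.div (near_det fun i i' => ?_) hdet h0
  simp only [Matrix.updateCol_apply]
  split_ifs
  · exact near_const _
  · exact hT _ _

/-- The asymptotic properties of the coefficients of `V^{(r)}_l` that are propagated from sheet to
sheet. -/
structure CoeffAsymptotics (A : Matrix (Fin N) (Fin M) ℝ) (r : ℕ) (v : ℝ → ℕ → ℕ → ℝ) : Prop where
  near : ∀ l ∈ Finset.Icc 1 (M - N + 1), ∀ j, Near (fun ξ => v ξ l j) (limitCoeff A r l j)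
  nonneg : ∀ᶠ ξ in atTop, ∀ l ∈ Finset.Icc 1 (M - N + 1), ∀ j, 0 ≤ v ξ l j
  upper : ∀ l ∈ Finset.Icc 1 (M - N + 1), ∀ j,
    (fun ξ => v ξ l j) =O[atTop] fun ξ : ℝ => ξ⁻¹ ^ (j - (N - r + l))
  lower : ∀ i < r, (fun ξ : ℝ => ξ⁻¹ ^ i) =O[atTop] fun ξ => v ξ (M - N + 1) (M - r + 1 + i)

/-- The asymptotic properties of the solution of the linear system on the sheet `r`. -/
structure SolAsymptotics (A : Matrix (Fin N) (Fin M) ℝ) (r : ℕ) (v : ℝ → ℕ → ℕ → ℝ) : Prop where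
  det_ne_zero : ∀ᶠ ξ in atTop, (sysMat A r (v ξ)).det ≠ 0
  near : ∀ l ∈ Finset.Icc 1 (M - N + 1), Near (fun ξ => solB A r (v ξ) l) (Bhat A r l)
  pos : ∀ᶠ ξ in atTop, ∀ l ∈ Finset.Icc 1 (M - N + 1), 0 < solB A r (v ξ) l
  eps_pos : ∀ᶠ ξ in atTop, ∀ i ∈ Finset.Icc 1 (r - 1), 0 < solEps A r (v ξ) i

theorem isBigO_inv_pow {a b : ℕ} (h : b ≤ a) :
    (fun ξ : ℝ => ξ⁻¹ ^ a) =O[atTop] fun ξ : ℝ => ξ⁻¹ ^ b := by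
  refine Asymptotics.IsBigO.of_bound 1 ?_
  filter_upwards [eventually_ge_atTop 1] with ξ hξ
  have hi : 0 < ξ⁻¹ := inv_pos.2 (by linarith)
  rw [Real.norm_of_nonneg (by positivity), Real.norm_of_nonneg (by positivity), one_mul]
  exact pow_le_pow_of_le_one hi.le (inv_le_one_of_one_le₀ hξ) h

theorem isLittleO_inv_pow_succ (a : ℕ) :
    (fun ξ : ℝ => ξ⁻¹ ^ (a + 1)) =o[atTop] fun ξ : ℝ => ξ⁻¹ ^ a := by
  have h : (fun ξ : ℝ => ξ⁻¹) =o[atTop] fun _ => (1 : ℝ) :=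
    (Asymptotics.isLittleO_one_iff ℝ).2 tendsto_inv_atTop_zero
  simpa [pow_succ] using (Asymptotics.isBigO_refl (fun ξ : ℝ => ξ⁻¹ ^ a) atTop).mul_isLittleO h

/-- The limits come from `near_sysSol`, but `ε` tends to zero and its sign requires the next orders.
In column `M - r + 1 + i` the band kills row `N - r + 1` and the rows of all `ε_{i'}` with `i' < i`.
The equation thus reads `ε_i e + R = S`, where `R` contains the later `ε` only. The `upper` bounds
give `S = O(ξ⁻¹ ^ i)`, nonnegativity and the `lower` bound give the reverse estimate, and `R` is one
order smaller. -/
theorem CoeffAsymptotics.solAsymptotics (hA : IsNormalizedBanded A) (hNM : N ≤ M)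
    {r : ℕ} (hr : r ∈ Finset.Icc 1 N) {v : ℝ → ℕ → ℕ → ℝ} (hv : CoeffAsymptotics A r v) :
    SolAsymptotics A r v := by
  have hr' := Finset.mem_Icc.1 hr
  obtain ⟨hdet, hsol⟩ := near_sysSol hA hNM hr hv.near
  have heps : ∀ i ∈ Finset.Icc 1 (r - 1), Near (fun ξ => solEps A r (v ξ) i) 0 := by
    intro i hi
    rw [Finset.mem_Icc] at hi
    simpa [solEps, show ¬ (i = 0) by omega] using hsol (M - N + i) (by omega)
  have hB' : ∀ l ∈ Finset.Icc 1 (M - N + 1),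
      Near (fun ξ => sysSol A r (v ξ) (l - 1)) (Bhat A r l) := by
    intro l hl
    rw [Finset.mem_Icc] at hl
    simpa [show l ≤ M - N + 1 by omega, Nat.sub_add_cancel hl.1] using hsol (l - 1) (by omega)
  have hnear : ∀ l ∈ Finset.Icc 1 (M - N + 1), Near (fun ξ => solB A r (v ξ) l) (Bhat A r l) := by
    intro l hl
    have h := (hB' l hl).div ((near_const 1).add (near_sum _ heps)) (by simp)
    simpa [solB] using h
  let P : ℕ → Prop := fun i => (fun ξ => solEps A r (v ξ) i) =O[atTop] (fun ξ : ℝ => ξ⁻¹ ^ i) ∧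
      ∀ᶠ ξ in atTop, 0 < solEps A r (v ξ) i
  -- Downward induction: the order of magnitude of the later parameters is needed to see that `R` is
  -- negligible.
  have step : ∀ i ∈ Finset.Icc 1 (r - 1), (∀ i' ∈ Finset.Icc 1 (r - 1), i < i' → P i') → P i := by
    intro i hi ih
    rw [Finset.mem_Icc] at hi
    set e := entry A (N - r + 1 + i) (M - r + 1 + i) with he
    have hepos : 0 < e := by
      have := hA.entry_top_pos hNM (r := r - i) (Finset.mem_Icc.2 (by omega))
      rwa [show N - (r - i) + 1 = N - r + 1 + i by omega,
        show M - (r - i) + 1 = M - r + 1 + i by omega] at this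
    set S : ℝ → ℝ := fun ξ => ∑ l ∈ Finset.Icc 1 (M - N + 1),
      sysSol A r (v ξ) (l - 1) * v ξ l (M - r + 1 + i) with hS
    set R : ℝ → ℝ := fun ξ => ∑ i' ∈ Finset.Icc (i + 1) (r - 1),
      solEps A r (v ξ) i' * entry A (N - r + 1 + i') (M - r + 1 + i) with hR
    have heq : ∀ᶠ ξ in atTop, solEps A r (v ξ) i = (S ξ - R ξ) * e⁻¹ := by
      filter_upwards [hdet] with ξ hξ
      have h := sysSol_eq hr hNM hξ (j := M - r + 1 + i) (Finset.mem_Icc.2 (by omega))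
      rw [hA.entry_eq_zero (i := N - r + 1) (by omega), zero_add,
        ← Finset.sum_subset (s₁ := Finset.Icc i (r - 1)) (s₂ := Finset.Icc 1 (r - 1)), ← Finset.add_sum_Ioc_eq_sum_Icc
          (show i ≤ r - 1 by omega)] at h
      · rw [eq_mul_inv_iff_mul_eq₀ hepos.ne']
        have : Finset.Ioc i (r - 1) = Finset.Icc (i + 1) (r - 1) := by
          ext; simp only [Finset.mem_Ioc, Finset.mem_Icc]; omega
        rw [this] at h
        simp only [hS, hR, h]
        ring
      · intro x hx
        rw [Finset.mem_Icc] at hx ⊢; omega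
      · intro x hx hx'
        rw [Finset.mem_Icc] at hx hx'
        rw [hA.entry_eq_zero (by omega), mul_zero]
    have hRO : R =O[atTop] fun ξ : ℝ => ξ⁻¹ ^ (i + 1) := by
      refine Asymptotics.IsBigO.fun_sum fun i' hi' => ?_
      rw [Finset.mem_Icc] at hi'
      have h := (ih i' (Finset.mem_Icc.2 (by omega)) (by omega)).1.trans
        (isBigO_inv_pow (show i + 1 ≤ i' by omega))
      simpa [mul_comm] using h.const_mul_left (entry A (N - r + 1 + i') (M - r + 1 + i))
    have hSO : S =O[atTop] fun ξ : ℝ => ξ⁻¹ ^ i := by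
      refine Asymptotics.IsBigO.fun_sum fun l hl => ?_
      have h := (hB' l hl).isBigO_one.mul (hv.upper l hl (M - r + 1 + i))
      simp only [one_mul] at h
      rw [Finset.mem_Icc] at hl
      exact h.trans (isBigO_inv_pow (by omega))
    refine ⟨?_, ?_⟩
    · have h := (hSO.sub (hRO.trans (isBigO_inv_pow (Nat.le_succ i)))).const_mul_left e⁻¹
      refine h.congr' ?_ EventuallyEq.rfl
      filter_upwards [heq] with ξ hξ
      rw [hξ, mul_comm]
    · have hlast : M - N + 1 ∈ Finset.Icc 1 (M - N + 1) := Finset.mem_Icc.2 (by omega)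
      -- All summands of `S` are eventually nonnegative, so the last one bounds the sum from below.
      have hlow : (fun ξ : ℝ => ξ⁻¹ ^ i) =O[atTop] S := by
        have h1 : (fun ξ : ℝ => ξ⁻¹ ^ i) =O[atTop] fun ξ =>
            sysSol A r (v ξ) (M - N + 1 - 1) * v ξ (M - N + 1) (M - r + 1 + i) := by
          have h2 := ((Asymptotics.isEquivalent_const_iff_tendsto
            (hA.Bhat_pos hNM hr hlast).ne').2 (hB' _ hlast).tendsto).isBigO_symm
          have h3 := (Asymptotics.isBigO_const_const (1 : ℝ)
            (hA.Bhat_pos hNM hr hlast).ne' atTop).trans h2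
          simpa using h3.mul (hv.lower i (by omega))
        refine h1.trans (Asymptotics.IsBigO.of_bound 1 ?_)
        filter_upwards [hv.nonneg, (Finset.eventually_all (Finset.Icc 1 (M - N + 1))).2 fun l hl =>
          (hB' l hl).tendsto.eventually_const_lt (hA.Bhat_pos hNM hr hl)] with ξ hξ hξ'
        have hpos : ∀ l ∈ Finset.Icc 1 (M - N + 1),
            0 ≤ sysSol A r (v ξ) (l - 1) * v ξ l (M - r + 1 + i) := fun l hl =>
          mul_nonneg (hξ' l hl).le (hξ l hl _)
        rw [one_mul, Real.norm_of_nonneg (hpos _ hlast),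
          Real.norm_of_nonneg (Finset.sum_nonneg hpos)]
        exact Finset.single_le_sum hpos hlast
      have hSpos : ∀ᶠ ξ in atTop, 0 ≤ S ξ := by
        filter_upwards [hv.nonneg, (Finset.eventually_all (Finset.Icc 1 (M - N + 1))).2 fun l hl =>
          (hB' l hl).tendsto.eventually_const_lt (hA.Bhat_pos hNM hr hl)] with ξ hξ hξ'
        exact Finset.sum_nonneg fun l hl => mul_nonneg (hξ' l hl).le (hξ l hl _)
      have hRS := ((hRO.trans_isLittleO (isLittleO_inv_pow_succ i)).trans_isBigO hlow).def
        (show (0 : ℝ) < 1 / 2 by norm_num)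
      obtain ⟨c, hc⟩ := hlow.bound
      filter_upwards [heq, hRS, hc, hSpos, eventually_gt_atTop 0] with ξ h1 h2 h3 h4 hξ
      rw [h1]
      have h5 : 0 < ξ⁻¹ ^ i := pow_pos (inv_pos.2 hξ) _
      rw [Real.norm_of_nonneg h4] at h2 h3
      rw [Real.norm_of_nonneg h5.le] at h3
      have h6 : S ξ ≠ 0 := fun h => by rw [h, mul_zero] at h3; linarith
      have h7 : 0 < S ξ := lt_of_le_of_ne h4 h6.symm
      have h8 := le_abs_self (R ξ)
      rw [Real.norm_eq_abs] at h2
      exact mul_pos (by linarith) (inv_pos.2 hepos)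
  have key : ∀ k, ∀ i ∈ Finset.Icc 1 (r - 1), r - 1 ≤ i + k → P i := by
    intro k
    induction k with
    | zero => exact fun i hi hk => step i hi fun i' hi' h => by rw [Finset.mem_Icc] at hi'; omega
    | succ k ih => exact fun i hi hk => step i hi fun i' hi' h => ih i' hi' (by omega)
  refine ⟨hdet, hnear, ?_, ?_⟩
  · refine (Finset.eventually_all _).2 fun l hl => ?_
    exact (hnear l hl).tendsto.eventually_const_lt (hA.Bhat_pos hNM hr hl)
  · exact (Finset.eventually_all _).2 fun i hi => (key (r - 1) i hi (by omega)).2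

theorem coeffAsymptotics_one (hNM : N ≤ M) (hN : 1 ≤ N) :
    CoeffAsymptotics A 1 (fun ξ => canV A ξ 1) := by
  refine ⟨fun l hl j => ?_, ?_, fun l hl j => ?_, fun i hi => ?_⟩
  · simpa [canV, limitCoeff] using near_const _
  · refine Eventually.of_forall fun ξ l hl j => ?_
    simp only [canV]; split_ifs <;> norm_num
  · rw [Finset.mem_Icc] at hl
    simp only [canV]
    split_ifs with h
    · rw [show j - (N - 1 + l) = 0 by omega]
      simpa only [pow_zero] using Asymptotics.isBigO_refl (fun _ : ℝ => (1 : ℝ)) atTop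
    · exact Asymptotics.isBigO_zero _ _
  · obtain rfl : i = 0 := by omega
    simp only [canV]
    rw [if_pos (by omega)]
    simpa only [pow_zero] using Asymptotics.isBigO_refl (fun _ : ℝ => (1 : ℝ)) atTop

/-- In the average defining the next values, a node `m < l` keeps its tail, whose support starts at
most one column earlier than required. A node `m ≥ l` has a tail reaching further right, but its
weight `ξ⁻¹ ^ (2 * (m - l) + 1)` more than pays for the shift. For the lower bound the last node
suffices: its own weight costs one factor `ξ⁻¹`, which is the new power in the next column. -/
theorem CoeffAsymptotics.next (hA : IsNormalizedBanded A) (hNM : N < M)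
    {r : ℕ} (hr : 1 ≤ r) (hrN : r < N) {v : ℝ → ℕ → ℕ → ℝ} (hv : CoeffAsymptotics A r v) :
    CoeffAsymptotics A (r + 1)
      (fun ξ => nextCoeff N M ξ (solB A r (v ξ)) (v ξ) (r + 1)) := by
  have hrm : r ∈ Finset.Icc 1 N := Finset.mem_Icc.2 (by omega)
  have hrm' : r + 1 ∈ Finset.Icc 1 N := Finset.mem_Icc.2 (by omega)
  have hs := hv.solAsymptotics hA hNM.le hrm
  have hBw : ∀ l ∈ Finset.Icc 2 (M - N + 1), ∀ m ∈ Finset.Icc 1 (M - N + 1),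
      Near (fun ξ => solB A r (v ξ) m * weight ξ l m) (if m < l then Bhat A r m else 0) := by
    intro l hl m hm
    rw [Finset.mem_Icc] at hl
    have h := (hs.near m hm).mul (near_weight (s := l) (l := m) (by omega) (Finset.mem_Icc.1 hm).1)
    simpa using h
  have hfilter : ∀ l ∈ Finset.Icc 2 (M - N + 1), ∀ f : ℕ → ℝ,
      ∑ m ∈ Finset.Icc 1 (M - N + 1), (if m < l then f m else 0) =
        ∑ m ∈ Finset.Icc 1 (l - 1), f m := by
    intro l hl f
    rw [Finset.mem_Icc] at hl
    rw [← Finset.sum_filter]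
    congr 1
    ext m
    simp only [Finset.mem_filter, Finset.mem_Icc]
    omega
  have hden : ∀ l ∈ Finset.Icc 2 (M - N + 1),
      Near (fun ξ => ∑ m ∈ Finset.Icc 1 (M - N + 1), solB A r (v ξ) m * weight ξ l m)
        (∑ m ∈ Finset.Icc 1 (l - 1), Bhat A r m) := by
    intro l hl
    rw [← hfilter l hl]
    exact near_sum _ fun m hm => hBw l hl m hm
  have hden0 : ∀ l ∈ Finset.Icc 2 (M - N + 1), 0 < ∑ m ∈ Finset.Icc 1 (l - 1), Bhat A r m := by
    intro l hl
    rw [Finset.mem_Icc] at hl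
    refine Finset.sum_pos (fun m hm => hA.Bhat_pos hNM.le hrm ?_) ⟨1, Finset.mem_Icc.2 (by omega)⟩
    rw [Finset.mem_Icc] at hm ⊢; omega
  have hnear : ∀ l ∈ Finset.Icc 1 (M - N + 1), ∀ j,
      Near (fun ξ => nextCoeff N M ξ (solB A r (v ξ)) (v ξ) (r + 1) l j)
        (limitCoeff A (r + 1) l j) := by
    intro l hl j
    rw [Finset.mem_Icc] at hl
    by_cases h1 : l = 1
    · simpa [nextCoeff, limitCoeff, h1, show r ≠ 0 by omega] using near_const _
    have hl2 : l ∈ Finset.Icc 2 (M - N + 1) := Finset.mem_Icc.2 (by omega)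
    rw [hA.limitCoeff_succ hNM.le hrm hl2]
    simp only [nextCoeff, if_neg h1]
    refine Near.div ?_ (hden l hl2) (hden0 l hl2).ne'
    rw [← hfilter l hl2]
    refine near_sum _ fun m hm => ?_
    simpa using (hBw l hl2 m hm).mul (hv.near m hm j)
  refine ⟨hnear, ?_, fun l hl j => ?_, fun i hi => ?_⟩
  · filter_upwards [hv.nonneg, hs.pos, eventually_gt_atTop 0] with ξ h1 h2 hξ l hl j
    unfold nextCoeff
    split_ifs
    · norm_num
    · norm_num
    · exact div_nonneg (Finset.sum_nonneg fun m hm => mul_nonneg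
        (mul_nonneg (h2 m hm).le (weight_pos hξ _ _).le) (h1 m hm j))
        (Finset.sum_nonneg fun m hm => mul_nonneg (h2 m hm).le (weight_pos hξ _ _).le)
  · rw [Finset.mem_Icc] at hl
    by_cases h1 : l = 1
    · simp only [nextCoeff, if_pos h1]
      split_ifs with hj
      · rw [show j - (N - (r + 1) + l) = 0 by omega]
        simpa only [pow_zero] using Asymptotics.isBigO_refl (fun _ : ℝ => (1 : ℝ)) atTop
      · exact Asymptotics.isBigO_zero _ _
    have hl2 : l ∈ Finset.Icc 2 (M - N + 1) := Finset.mem_Icc.2 (by omega)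
    simp only [nextCoeff, if_neg h1, div_eq_mul_inv]
    rw [← mul_one (fun ξ : ℝ => ξ⁻¹ ^ (j - (N - (r + 1) + l)))]
    refine Asymptotics.IsBigO.mul (Asymptotics.IsBigO.fun_sum fun m hm => ?_)
      ((hden l hl2).inv (hden0 l hl2).ne').isBigO_one
    have hm' := Finset.mem_Icc.1 hm
    rcases Nat.lt_or_ge m l with hml | hml
    · have h := (hBw l hl2 m hm).isBigO_one.mul (hv.upper m hm j)
      simp only [one_mul] at h
      exact h.trans (isBigO_inv_pow (by omega))
    · have hw : (fun ξ : ℝ => weight ξ l m) =O[atTop] fun ξ : ℝ => ξ⁻¹ ^ (2 * (m - l) + 1) := by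
        refine Asymptotics.IsBigO.of_bound 1 ?_
        filter_upwards [eventually_gt_atTop 0] with ξ hξ
        have hi : 0 < ξ⁻¹ := inv_pos.2 hξ
        rw [one_mul, Real.norm_of_nonneg (weight_pos hξ _ _).le,
          Real.norm_of_nonneg (by positivity)]
        exact weight_le hξ (by omega) hml
      have h := ((hs.near m hm).isBigO_one.mul hw).mul (hv.upper m hm j)
      simp only [one_mul, ← pow_add] at h
      exact h.trans (isBigO_inv_pow (by omega))
  · have hlast : M - N + 1 ∈ Finset.Icc 1 (M - N + 1) := Finset.mem_Icc.2 (by omega)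
    have hlast2 : M - N + 1 ∈ Finset.Icc 2 (M - N + 1) := Finset.mem_Icc.2 (by omega)
    have hone : ∀ {f : ℝ → ℝ} {c : ℝ}, 0 < c → Near f c → (fun _ => (1 : ℝ)) =O[atTop] f :=
      fun hc hf => (Asymptotics.isBigO_const_const (1 : ℝ) hc.ne' atTop).trans
        ((Asymptotics.isEquivalent_const_iff_tendsto hc.ne').2 hf.tendsto).isBigO_symm
    rcases Nat.eq_zero_or_pos i with rfl | hi0
    -- At `i = 0` the column is the last one in the limiting support, where the limit is already
    -- positive.
    · have h := hA.limitCoeff_top_pos hNM.le hrm' hlast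
      have h2 := hone h (hnear _ hlast _)
      rw [show N - (r + 1) + (M - N + 1) = M - (r + 1) + 1 + 0 by omega] at h2
      simpa only [pow_zero] using h2
    · have hw : (fun ξ : ℝ => ξ⁻¹) =O[atTop] fun ξ : ℝ => weight ξ (M - N + 1) (M - N + 1) := by
        refine Asymptotics.IsBigO.of_bound 2 ?_
        filter_upwards [eventually_ge_atTop 1] with ξ hξ
        have hi : 0 < ξ⁻¹ := inv_pos.2 (by linarith)
        rw [Real.norm_of_nonneg (weight_pos (by linarith) _ _).le, Real.norm_of_nonneg hi.le]
        exact le_weight_self hξ (by omega)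
      have h1 := ((hone (hA.Bhat_pos hNM.le hrm hlast) (hs.near _ hlast)).mul hw).mul
        (hv.lower (i - 1) (by omega))
      simp only [one_mul, ← pow_succ'] at h1
      rw [show i - 1 + 1 = i by omega,
        show M - r + 1 + (i - 1) = M - (r + 1) + 1 + i by omega] at h1
      have h2 : (fun ξ => solB A r (v ξ) (M - N + 1) * weight ξ (M - N + 1) (M - N + 1) *
            v ξ (M - N + 1) (M - (r + 1) + 1 + i)) =O[atTop] fun ξ =>
          ∑ m ∈ Finset.Icc 1 (M - N + 1), solB A r (v ξ) m * weight ξ (M - N + 1) m *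
            v ξ m (M - (r + 1) + 1 + i) := by
        refine Asymptotics.IsBigO.of_bound 1 ?_
        filter_upwards [hv.nonneg, hs.pos, eventually_gt_atTop 0] with ξ h1 h2 hξ
        have hpos : ∀ m ∈ Finset.Icc 1 (M - N + 1), 0 ≤ solB A r (v ξ) m *
            weight ξ (M - N + 1) m * v ξ m (M - (r + 1) + 1 + i) := fun m hm =>
          mul_nonneg (mul_nonneg (h2 m hm).le (weight_pos hξ _ _).le) (h1 m hm _)
        rw [one_mul, Real.norm_of_nonneg (hpos _ hlast),
          Real.norm_of_nonneg (Finset.sum_nonneg hpos)]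
        exact Finset.single_le_sum hpos hlast
      have h3 := hone (inv_pos.2 (hden0 _ hlast2)) ((hden _ hlast2).inv (hden0 _ hlast2).ne')
      simpa only [nextCoeff, if_neg (show ¬ (M - N + 1 = 1) by omega), div_eq_mul_inv, mul_one] using
        (h1.trans h2).mul h3

theorem coeffAsymptotics_canV (hA : IsNormalizedBanded A) (hNM : N < M) {r : ℕ}
    (hr : r ∈ Finset.Icc 1 N) : CoeffAsymptotics A r (fun ξ => canV A ξ r) := by
  rw [Finset.mem_Icc] at hr
  induction r, hr.1 using Nat.le_induction with
  | base => exact coeffAsymptotics_one hNM.le hr.2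
  | succ r h1 ih =>
    simp only [canV_succ A _ h1]
    exact (ih (by omega)).next hA hNM h1 (by omega)

end Asymptotics

/-! ### Positivity of the determinant of a product -/

section CauchyBinet

/-- Cauchy–Binet summed over all maps `f` instead of increasing ones: noninjective maps contribute
zero and each column set is counted `n!` times. Multilinearity gives one expansion of `det (A * B)`;
replacing `f` by `f ∘ σ` gives another for each permutation `σ`, and their sum over `σ` assembles
the second determinant. -/
theorem factorial_mul_det_mul {n m : ℕ} (A : Matrix (Fin n) (Fin m) ℝ)
    (B : Matrix (Fin m) (Fin n) ℝ) :
    (n.factorial : ℝ) * (A * B).det =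
      ∑ f : Fin n → Fin m, (A.submatrix id f).det * (B.submatrix f id).det := by
  have h1 : (A * B).det = ∑ f : Fin n → Fin m, (∏ i, B (f i) i) * (A.submatrix id f).det := by
    have h : (A * B).transpose = fun i => ∑ j, B j i • fun p => A p j := by
      funext i p
      simp [Matrix.mul_apply, Finset.sum_apply, mul_comm]
    rw [← Matrix.det_transpose, h]
    change Matrix.detRowAlternating.toMultilinearMap (fun i => ∑ j, B j i • fun p => A p j) = _
    rw [MultilinearMap.map_sum]
    refine Finset.sum_congr rfl fun f _ => ?_
    rw [MultilinearMap.map_smul_univ, smul_eq_mul]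
    congr 1
    rw [← Matrix.det_transpose]
    rfl
  have h2 : ∀ σ : Equiv.Perm (Fin n), (A * B).det = ∑ f : Fin n → Fin m,
      (A.submatrix id f).det * ((Equiv.Perm.sign σ : ℤ) * ∏ i, B (f (σ i)) i) := by
    intro σ
    rw [h1, ← Equiv.sum_comp (Equiv.arrowCongr σ.symm (Equiv.refl (Fin m)))]
    refine Finset.sum_congr rfl fun f _ => ?_
    have h3 : A.submatrix id (f ∘ σ) = (A.submatrix id f).submatrix id σ := rfl
    have h4 : (Equiv.arrowCongr σ.symm (Equiv.refl (Fin m))) f = f ∘ σ := by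
      funext i; simp
    rw [h4, h3, Matrix.det_permute']
    simp only [Function.comp_apply]
    ring
  have h3 : (n.factorial : ℝ) * (A * B).det = ∑ _σ : Equiv.Perm (Fin n), (A * B).det := by
    rw [Finset.sum_const, Finset.card_univ, Fintype.card_perm, Fintype.card_fin, nsmul_eq_mul]
  rw [h3, Finset.sum_congr rfl fun σ _ => h2 σ, Finset.sum_comm]
  refine Finset.sum_congr rfl fun f _ => ?_
  rw [← Finset.mul_sum, Matrix.det_apply' (B.submatrix f id)]
  rfl

theorem det_mul_pos_of_minors_pos {n m : ℕ} (hnm : n ≤ m) {A : Matrix (Fin n) (Fin m) ℝ}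
    {B : Matrix (Fin m) (Fin n) ℝ}
    (hA : ∀ c : Fin n → Fin m, StrictMono c → 0 < (A.submatrix id c).det)
    (hB : ∀ c : Fin n → Fin m, StrictMono c → 0 < (B.submatrix c id).det) :
    0 < (A * B).det := by
  have hpos : 0 < (n.factorial : ℝ) * (A * B).det := by
    rw [factorial_mul_det_mul]
    refine Finset.sum_pos' (fun f _ => ?_) ⟨Fin.castLE hnm, Finset.mem_univ _,
      mul_pos (hA _ (Fin.strictMono_castLE hnm)) (hB _ (Fin.strictMono_castLE hnm))⟩
    by_cases hf : Function.Injective f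
    -- Sorting the columns multiplies both determinants by the same sign, which drops out of their
    -- product.
    · set σ := Tuple.sort f
      have hc : StrictMono (f ∘ σ) :=
        (Tuple.monotone_sort f).strictMono_of_injective (hf.comp σ.injective)
      have h1 := hA _ hc
      have h2 := hB _ hc
      rw [show A.submatrix id (f ∘ σ) = (A.submatrix id f).submatrix id σ from rfl,
        Matrix.det_permute'] at h1
      rw [show B.submatrix (f ∘ σ) id = (B.submatrix f id).submatrix σ id from rfl,
        Matrix.det_permute] at h2
      have h3 := mul_pos h1 h2
      rcases Int.units_eq_one_or (Equiv.Perm.sign σ) with h | h <;> rw [h] at h3 <;>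
        simp at h3 <;> exact h3.le
    · rw [Function.Injective] at hf
      push Not at hf
      obtain ⟨a, b, hab, hne⟩ := hf
      rw [Matrix.det_zero_of_column_eq hne (fun i => by simp [hab]), zero_mul]
  exact pos_of_mul_pos_right hpos (by positivity)

end CauchyBinet

/-! ### Exponential sums and the Darboux operator -/

section Darboux

variable {N M J : ℕ}

/-- `∑_j c_j e^{θ_j(t)}`. -/
def expSum {M J : ℕ} (c : ℕ → ℝ) (k : Fin M → ℝ) (t : Fin J → ℝ) : ℝ :=
  ∑ j ∈ Finset.Icc 1 M, c j * Real.exp (theta (phase k j) t)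

theorem heat_eq_expSum (A : Matrix (Fin N) (Fin M) ℝ) (k : Fin M → ℝ) (i : ℕ) :
    (heat A k i : (Fin J → ℝ) → ℝ) = expSum (entry A i) k := rfl

theorem continuous_theta {X : Type*} [TopologicalSpace X] {z : X → ℝ} {t : X → Fin J → ℝ}
    (hz : Continuous z) (ht : Continuous t) : Continuous fun x => theta (z x) (t x) := by
  unfold theta
  fun_prop

theorem continuous_phase (j : ℕ) : Continuous fun k : Fin M → ℝ => phase k j := by
  unfold phase
  split_ifs <;> fun_prop

theorem sum_Icc_one_eq_sum_fin (n : ℕ) (f : ℕ → ℝ) :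
    ∑ j ∈ Finset.Icc 1 n, f j = ∑ j : Fin n, f (j + 1) := by
  rw [sum_Icc_one_eq_sum_range, Fin.sum_univ_eq_sum_range (fun j => f (j + 1))]

theorem phase_succ (k : Fin M → ℝ) (j : Fin M) : phase k ((j : ℕ) + 1) = k j := by
  unfold phase; rw [dif_pos (by omega)]; rfl

theorem entry_succ (A : Matrix (Fin N) (Fin M) ℝ) (i : Fin N) (j : Fin M) :
    entry A ((i : ℕ) + 1) ((j : ℕ) + 1) = A i j := by
  unfold entry; rw [dif_pos (by omega)]; rfl

variable [NeZero J]

theorem theta_update (z : ℝ) (t : Fin J → ℝ) (x : ℝ) :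
    theta z (Function.update t 0 x) = theta z t - z * t 0 + z * x := by
  unfold theta
  rw [← Finset.add_sum_erase _ _ (Finset.mem_univ (0 : Fin J)),
    ← Finset.add_sum_erase (a := (0 : Fin J)) _ (fun i : Fin J => z ^ ((i : ℕ) + 1) * t i)
      (Finset.mem_univ _)]
  have : ∑ i ∈ Finset.univ.erase (0 : Fin J), z ^ ((i : ℕ) + 1) * Function.update t 0 x i =
      ∑ i ∈ Finset.univ.erase (0 : Fin J), z ^ ((i : ℕ) + 1) * t i := by
    refine Finset.sum_congr rfl fun i hi => ?_
    rw [Function.update_of_ne (Finset.ne_of_mem_erase hi)]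
  rw [this]
  simp
  ring

theorem hasDerivAt_sum_exp (s : Finset ℕ) (c a κ : ℕ → ℝ) (x : ℝ) :
    HasDerivAt (fun x => ∑ j ∈ s, c j * Real.exp (a j + κ j * x))
      (∑ j ∈ s, c j * κ j * Real.exp (a j + κ j * x)) x := by
  refine HasDerivAt.fun_sum fun j _ => ?_
  have h := ((((hasDerivAt_id x).const_mul (κ j)).const_add (a j)).exp).const_mul (c j)
  refine h.congr_deriv ?_
  simp only [id]
  ring

theorem iteratedDeriv_sum_exp (s : Finset ℕ) (c a κ : ℕ → ℝ) (m : ℕ) :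
    iteratedDeriv m (fun x => ∑ j ∈ s, c j * Real.exp (a j + κ j * x)) =
      fun x => ∑ j ∈ s, c j * κ j ^ m * Real.exp (a j + κ j * x) := by
  induction m with
  | zero => funext x; simp
  | succ m ih =>
    funext x
    rw [iteratedDeriv_succ, ih, (hasDerivAt_sum_exp s _ a κ x).deriv]
    exact Finset.sum_congr rfl fun j _ => by ring

theorem expSum_update (c : ℕ → ℝ) (k : Fin M → ℝ) (t : Fin J → ℝ) (x : ℝ) :
    expSum c k (Function.update t 0 x) = ∑ j ∈ Finset.Icc 1 M,
      c j * Real.exp (theta (phase k j) t - phase k j * t 0 + phase k j * x) := by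
  simp only [expSum, theta_update]

theorem dx_expSum (m : ℕ) (c : ℕ → ℝ) (k : Fin M → ℝ) (t : Fin J → ℝ) :
    dx m (expSum c k) t = expSum (fun j => c j * phase k j ^ m) k t := by
  unfold dx
  simp only [expSum_update]
  rw [iteratedDeriv_sum_exp]
  simp only [expSum]
  refine Finset.sum_congr rfl fun j _ => ?_
  rw [sub_add_cancel]

/-- The matrix of the linear system for the coefficients of the Darboux operator. -/
def wronskian (A : Matrix (Fin N) (Fin M) ℝ) (k : Fin M → ℝ) (t : Fin J → ℝ) :
    Matrix (Fin N) (Fin N) ℝ :=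
  Matrix.of fun i m : Fin N => dx (N - 1 - (m : ℕ)) (heat A k ((i : ℕ) + 1)) t

theorem wronskian_apply (A : Matrix (Fin N) (Fin M) ℝ) (k : Fin M → ℝ) (t : Fin J → ℝ)
    (i m : Fin N) : wronskian A k t i m =
      ∑ j : Fin M, A i j * (Real.exp (theta (k j) t) * k j ^ (N - 1 - (m : ℕ))) := by
  simp only [wronskian, Matrix.of_apply, heat_eq_expSum, dx_expSum, expSum]
  rw [sum_Icc_one_eq_sum_fin]
  refine Finset.sum_congr rfl fun j _ => ?_
  rw [entry_succ, phase_succ]; ring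

/-- The Wronskian matrix is $\hat A$ times a Vandermonde matrix with rows scaled by $e^{\theta_j}$.
Ordered phases make all maximal minors of the second factor positive, so Cauchy–Binet gives a
positive determinant, up to the sign of reversing the columns. -/
theorem wronskian_det_ne_zero {A : Matrix (Fin N) (Fin M) ℝ} (hA : IsNormalizedBanded A)
    (hNM : N ≤ M) {k : Fin M → ℝ} (hk : StrictMono k) (t : Fin J → ℝ) :
    (wronskian A k t).det ≠ 0 := by
  let B : Matrix (Fin M) (Fin N) ℝ := Matrix.of fun j m => Real.exp (theta (k j) t) * k j ^ (m : ℕ)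
  have h1 : 0 < (A * B).det := by
    refine det_mul_pos_of_minors_pos hNM hA.maximal_minors fun c hc => ?_
    have h : B.submatrix c id = Matrix.of fun i m : Fin N =>
        (fun i => Real.exp (theta (k (c i)) t)) i * Matrix.vandermonde (k ∘ c) i m := by
      ext i m; simp [B, Matrix.vandermonde_apply]
    rw [h, Matrix.det_mul_column, Matrix.det_vandermonde]
    refine mul_pos (Finset.prod_pos fun i _ => Real.exp_pos _)
      (Finset.prod_pos fun i _ => Finset.prod_pos fun j hj => ?_)
    exact sub_pos.2 (hk (hc (Finset.mem_Ioi.1 hj)))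
  have h2 : wronskian A k t = (A * B).submatrix id Fin.revPerm := by
    ext i m
    rw [wronskian_apply, Matrix.submatrix_apply, Matrix.mul_apply]
    refine Finset.sum_congr rfl fun j _ => ?_
    simp only [id, B, Matrix.of_apply, Fin.revPerm_apply, Fin.val_rev]
    congr 3; omega
  rw [h2, Matrix.det_permute']
  exact mul_ne_zero (by
    rcases Int.units_eq_one_or (Equiv.Perm.sign (Fin.revPerm : Equiv.Perm (Fin N))) with h | h <;>
      rw [h] <;> simp) h1.ne'

theorem darboux_expSum (A : Matrix (Fin N) (Fin M) ℝ) (k : Fin M → ℝ) (c : ℕ → ℝ)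
    (t : Fin J → ℝ) : darboux A k (expSum c k) t =
      ∑ j ∈ Finset.Icc 1 M, c j * darbouxPoly A k t (phase k j) *
        Real.exp (theta (phase k j) t) := by
  simp only [darboux, dx_expSum, expSum, darbouxPoly, Finset.mul_sum]
  rw [Finset.sum_comm, ← Finset.sum_sub_distrib]
  refine Finset.sum_congr rfl fun j _ => ?_
  rw [mul_sub, sub_mul, Finset.mul_sum, Finset.sum_mul]
  congr 1
  exact Finset.sum_congr rfl fun m _ => by ring

theorem darboux_heat {A : Matrix (Fin N) (Fin M) ℝ} (hA : IsNormalizedBanded A)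
    (hNM : N ≤ M) {k : Fin M → ℝ} (hk : StrictMono k) (t : Fin J → ℝ) {i : ℕ}
    (hi : i ∈ Finset.Icc 1 N) : darboux A k (heat A k i) t = 0 := by
  rw [Finset.mem_Icc] at hi
  have h : (wronskian A k t).mulVec (darbouxCoeff A k t) =
      fun i : Fin N => dx N (heat A k ((i : ℕ) + 1)) t := by
    change (wronskian A k t).mulVec ((wronskian A k t)⁻¹.mulVec _) = _
    rw [Matrix.mulVec_mulVec, Matrix.mul_nonsing_inv _ (wronskian_det_ne_zero hA hNM hk t).isUnit,
      Matrix.one_mulVec]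
  have h2 := congr_fun h ⟨i - 1, by omega⟩
  simp only [Matrix.mulVec, dotProduct, wronskian, Matrix.of_apply, Nat.sub_add_cancel hi.1] at h2
  rw [darboux, ← h2, sub_eq_zero]
  exact Finset.sum_congr rfl fun m _ => mul_comm _ _

theorem continuous_dx_heat (A : Matrix (Fin N) (Fin M) ℝ) (m i : ℕ) :
    Continuous fun p : (Fin M → ℝ) × (Fin J → ℝ) => dx m (heat A p.1 i) p.2 := by
  simp only [heat_eq_expSum, dx_expSum]
  unfold expSum
  refine continuous_finsetSum _ fun j _ => (continuous_const.mul
    (((continuous_phase j).comp continuous_fst).pow _)).mul (Real.continuous_exp.comp ?_)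
  exact continuous_theta ((continuous_phase j).comp continuous_fst) continuous_snd

theorem continuousAt_inv_mulVec {X : Type*} [TopologicalSpace X] {n : ℕ}
    {W : X → Matrix (Fin n) (Fin n) ℝ} {y : X → Fin n → ℝ} (hW : Continuous W)
    (hy : Continuous y) {x : X} (hx : (W x).det ≠ 0) :
    ContinuousAt (fun x => (W x)⁻¹.mulVec (y x)) x := by
  have h : ∀ x, (W x)⁻¹.mulVec (y x) =
      ((W x).det)⁻¹ • ((W x).adjugate.mulVec (y x)) := fun x => by
    rw [Matrix.inv_def, Ring.inverse_eq_inv', Matrix.smul_mulVec]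
  simp only [h]
  have h1 : Continuous fun x => (W x).adjugate.mulVec (y x) := hW.matrix_adjugate.matrix_mulVec hy
  have h2 : ContinuousAt (fun x => ((W x).det)⁻¹) x := hW.matrix_det.continuousAt.inv₀ hx
  exact h2.smul h1.continuousAt

/-- Continuity is taken jointly in phases and times, because openness is needed both for times at
fixed `k` and for phases at `t = 0`. It holds only where the Wronskian is nonzero, hence the
pointwise form. -/
theorem continuousAt_darbouxCoeff {A : Matrix (Fin N) (Fin M) ℝ} (hA : IsNormalizedBanded A)
    (hNM : N ≤ M) {k : Fin M → ℝ} (hk : StrictMono k) (t : Fin J → ℝ) :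
    ContinuousAt (fun p : (Fin M → ℝ) × (Fin J → ℝ) => darbouxCoeff A p.1 p.2) (k, t) := by
  have hW : Continuous fun p : (Fin M → ℝ) × (Fin J → ℝ) => wronskian A p.1 p.2 :=
    continuous_matrix fun i m => continuous_dx_heat A _ _
  have hy : Continuous fun p : (Fin M → ℝ) × (Fin J → ℝ) =>
      (fun i : Fin N => dx N (heat A p.1 ((i : ℕ) + 1)) p.2) :=
    continuous_pi fun i => continuous_dx_heat A _ _
  exact continuousAt_inv_mulVec hW hy (wronskian_det_ne_zero hA hNM hk t)

theorem continuousAt_darbouxPoly {A : Matrix (Fin N) (Fin M) ℝ} (hA : IsNormalizedBanded A)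
    (hNM : N ≤ M) {k : Fin M → ℝ} (hk : StrictMono k) (t : Fin J → ℝ) (j : ℕ) :
    ContinuousAt (fun p : (Fin M → ℝ) × (Fin J → ℝ) => darbouxPoly A p.1 p.2 (phase p.1 j))
      (k, t) := by
  have hc := continuousAt_darbouxCoeff hA hNM hk t
  have hp : ContinuousAt (fun p : (Fin M → ℝ) × (Fin J → ℝ) => phase p.1 j) (k, t) :=
    ((continuous_phase j).comp continuous_fst).continuousAt
  unfold darbouxPoly
  refine (hp.pow _).sub (tendsto_finsetSum _ fun m _ => ?_)
  exact (((continuous_apply m).continuousAt.comp hc).mul (hp.pow _))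

theorem continuousAt_leadingSum {A : Matrix (Fin N) (Fin M) ℝ} (hA : IsNormalizedBanded A)
    (hNM : N ≤ M) {k : Fin M → ℝ} (hk : StrictMono k) (t : Fin J → ℝ) (r n : ℕ) :
    ContinuousAt (fun p : (Fin M → ℝ) × (Fin J → ℝ) => leadingSum A p.1 r n p.2) (k, t) := by
  unfold leadingSum
  refine tendsto_finsetSum _ fun j _ => ?_
  refine ((continuousAt_const.mul (continuousAt_darbouxPoly hA hNM hk t j))).mul ?_
  exact (Real.continuous_exp.comp (continuous_theta ((continuous_phase j).comp continuous_fst)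
    continuous_snd)).continuousAt

/-- All `x`-derivatives vanish at the point, and the first `M` of them form a Vandermonde system for
the numbers $c_je^{\theta_j}$. -/
theorem expSum_eq_zero_of_eventually {c : ℕ → ℝ} {k : Fin M → ℝ} (hk : StrictMono k)
    {t : Fin J → ℝ} (h : ∀ᶠ x in 𝓝 (t 0), expSum c k (Function.update t 0 x) = 0) {j : ℕ}
    (hj : j ∈ Finset.Icc 1 M) : c j = 0 := by
  rw [Finset.mem_Icc] at hj
  have hm : ∀ m, ∑ i : Fin M, (c (i + 1) * Real.exp (theta (k i) t)) * k i ^ m = 0 := by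
    intro m
    have h1 : dx m (expSum c k) t = 0 := by
      have h2 : (fun x => expSum c k (Function.update t 0 x)) =ᶠ[𝓝 (t 0)] fun _ => (0 : ℝ) := h
      rw [dx, h2.iteratedDeriv_eq]
      simp
    rw [dx_expSum, expSum, sum_Icc_one_eq_sum_fin] at h1
    rw [← h1]
    refine Finset.sum_congr rfl fun i _ => ?_
    rw [phase_succ]; ring
  have h3 := Matrix.eq_zero_of_vecMul_eq_zero (Matrix.det_vandermonde_ne_zero_iff.2 hk.injective)
    (v := fun i : Fin M => c (i + 1) * Real.exp (theta (k i) t)) (by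
      funext m
      simpa [Matrix.vecMul, dotProduct, Matrix.vandermonde_apply] using hm m)
  have h4 := congr_fun h3 ⟨j - 1, by omega⟩
  simp only [Nat.sub_add_cancel hj.1, Pi.zero_apply, mul_eq_zero, Real.exp_ne_zero, or_false] at h4
  exact h4

theorem expSum_injective {c c' : ℕ → ℝ} {k : Fin M → ℝ} (hk : StrictMono k)
    (h : ∀ t : Fin J → ℝ, expSum c k t = expSum c' k t) {j : ℕ} (hj : j ∈ Finset.Icc 1 M) :
    c j = c' j := by
  refine sub_eq_zero.1 (expSum_eq_zero_of_eventually (c := fun j => c j - c' j) hk (t := (0 : Fin J → ℝ))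
    (Eventually.of_forall fun x => ?_) hj)
  have h1 := h (Function.update 0 0 x)
  simp only [expSum, sub_mul, Finset.sum_sub_distrib] at h1 ⊢
  linarith

end Darboux

/-! ### Interpolation at the nodes `λ_l` -/

section Interpolation

open Polynomial in
/-- `∑_l a_l ∏_{j ≠ l} (X - λ_j)`, for `n + 1` nodes `λ_1, …, λ_{n+1}`. -/
def nodePoly (n : ℕ) (μ a : ℕ → ℝ) : Polynomial ℝ :=
  ∑ l ∈ Finset.Icc 1 (n + 1), C (a l) * ∏ j ∈ (Finset.Icc 1 (n + 1)).erase l, (X - C (μ j))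

theorem nodePoly_eval (n : ℕ) (μ a : ℕ → ℝ) (z : ℝ) : (nodePoly n μ a).eval z =
    ∑ l ∈ Finset.Icc 1 (n + 1), a l * ∏ j ∈ (Finset.Icc 1 (n + 1)).erase l, (z - μ j) := by
  simp [nodePoly, Polynomial.eval_finsetSum, Polynomial.eval_prod]

theorem card_erase_Icc {n l : ℕ} (hl : l ∈ Finset.Icc 1 (n + 1)) :
    ((Finset.Icc 1 (n + 1)).erase l).card = n := by
  rw [Finset.card_erase_of_mem hl]; simp

theorem natDegree_prod_X_sub_C (s : Finset ℕ) (μ : ℕ → ℝ) :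
    (∏ j ∈ s, (Polynomial.X - Polynomial.C (μ j))).natDegree = s.card := by
  rw [Polynomial.natDegree_prod_of_monic _ _ fun j _ => Polynomial.monic_X_sub_C _]
  simp

theorem nodePoly_natDegree_le (n : ℕ) (μ a : ℕ → ℝ) : (nodePoly n μ a).natDegree ≤ n := by
  refine Polynomial.natDegree_sum_le_of_forall_le _ _ fun l hl => ?_
  refine (Polynomial.natDegree_C_mul_le _ _).trans ?_
  rw [natDegree_prod_X_sub_C, card_erase_Icc hl]

theorem nodePoly_coeff (n : ℕ) (μ a : ℕ → ℝ) :
    (nodePoly n μ a).coeff n = ∑ l ∈ Finset.Icc 1 (n + 1), a l := by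
  rw [nodePoly, Polynomial.finsetSum_coeff]
  refine Finset.sum_congr rfl fun l hl => ?_
  have h : (∏ j ∈ (Finset.Icc 1 (n + 1)).erase l, (Polynomial.X - Polynomial.C (μ j))).coeff n = 1 := by
    have h1 := Polynomial.monic_prod_of_monic ((Finset.Icc 1 (n + 1)).erase l) _
      fun j _ => Polynomial.monic_X_sub_C (μ j)
    have h2 := natDegree_prod_X_sub_C ((Finset.Icc 1 (n + 1)).erase l) μ
    rw [card_erase_Icc hl] at h2
    have h3 := h1.coeff_natDegree
    rwa [h2] at h3
  rw [Polynomial.coeff_C_mul, h, mul_one]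

theorem nodePoly_eval_node (n : ℕ) (μ a : ℕ → ℝ) {l : ℕ} (hl : l ∈ Finset.Icc 1 (n + 1)) :
    (nodePoly n μ a).eval (μ l) = a l * ∏ j ∈ (Finset.Icc 1 (n + 1)).erase l, (μ l - μ j) := by
  rw [nodePoly_eval]
  refine Finset.sum_eq_single_of_mem l hl fun l' _ hne => ?_
  rw [Finset.prod_eq_zero (Finset.mem_erase.2 ⟨hne.symm, hl⟩) (sub_self _), mul_zero]

/-- A polynomial of degree at most `n` with `n` distinct roots is the product of its linear
factors. -/
theorem eval_eq_of_roots {n : ℕ} {p : Polynomial ℝ} (hp : p.natDegree ≤ n) {γ : ℕ → ℝ}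
    (hγ : Set.InjOn γ (Finset.Icc 1 n)) (hroot : ∀ i ∈ Finset.Icc 1 n, p.eval (γ i) = 0) (z : ℝ) :
    p.eval z = p.coeff n * ∏ i ∈ Finset.Icc 1 n, (z - γ i) := by
  set w : Polynomial ℝ := ∏ i ∈ Finset.Icc 1 n, (Polynomial.X - Polynomial.C (γ i)) with hw
  have hwd : w.natDegree = n := by rw [hw, natDegree_prod_X_sub_C]; simp
  have hwc : w.coeff n = 1 := by
    have h1 := Polynomial.monic_prod_of_monic (Finset.Icc 1 n) _
      fun j _ => Polynomial.monic_X_sub_C (γ j)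
    have h3 := h1.coeff_natDegree
    rwa [← hw, hwd] at h3
  have h0 : p - Polynomial.C (p.coeff n) * w = 0 := by
    refine Polynomial.eq_zero_of_degree_lt_of_eval_index_eq_zero (Finset.Icc 1 n) hγ ?_ fun i hi => ?_
    · rw [Nat.card_Icc, Nat.add_sub_cancel, Polynomial.degree_lt_iff_coeff_zero]
      intro m hm
      rw [Polynomial.coeff_sub, Polynomial.coeff_C_mul]
      rcases hm.eq_or_lt with rfl | hm
      · rw [hwc, mul_one, sub_self]
      · rw [Polynomial.coeff_eq_zero_of_natDegree_lt (hp.trans_lt hm),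
          Polynomial.coeff_eq_zero_of_natDegree_lt (hwd.trans_lt hm), mul_zero, sub_self]
    · rw [Polynomial.eval_sub, hroot i hi, Polynomial.eval_mul, hw, Polynomial.eval_prod,
        Finset.prod_eq_zero hi (by simp), mul_zero, sub_zero]
  rw [sub_eq_zero] at h0
  have h1 := congr_arg (Polynomial.eval z) h0
  rw [h1, Polynomial.eval_mul, hw, Polynomial.eval_prod]
  simp

/-- Sign count behind the interlacing: node differences and pole differences at `λ_l` both have
exactly `l - 1` negative factors, so their quotients are positive. -/
theorem neg_one_pow_mul_prod_pos {s : Finset ℕ} {f : ℕ → ℝ} {l : ℕ}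
    (hcard : (s.filter (· < l)).card = l - 1) (hneg : ∀ j ∈ s, j < l → f j < 0)
    (hpos : ∀ j ∈ s, l ≤ j → 0 < f j) : 0 < (-1) ^ (l - 1) * ∏ j ∈ s, f j := by
  rw [← Finset.prod_filter_mul_prod_filter_not s (· < l), ← hcard, ← mul_assoc,
    ← Finset.prod_const, ← Finset.prod_mul_distrib]
  refine mul_pos (Finset.prod_pos fun j hj => ?_) (Finset.prod_pos fun j hj => ?_)
  · rw [Finset.mem_filter] at hj
    linarith [hneg j hj.1 hj.2]
  · rw [Finset.mem_filter, not_lt] at hj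
    exact hpos j hj.1 hj.2

theorem card_filter_Icc {n l : ℕ} (hl : l ∈ Finset.Icc 1 (n + 1)) :
    ((Finset.Icc 1 n).filter (· < l)).card = l - 1 := by
  rw [Finset.mem_Icc] at hl
  have : (Finset.Icc 1 n).filter (· < l) = Finset.Icc 1 (l - 1) := by
    ext; simp only [Finset.mem_filter, Finset.mem_Icc]; omega
  rw [this]; simp

theorem node_prod_sign {n : ℕ} {μ : ℕ → ℝ} (hμ : StrictAntiOn μ (Finset.Icc 1 (n + 1))) {l : ℕ}
    (hl : l ∈ Finset.Icc 1 (n + 1)) :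
    0 < (-1) ^ (l - 1) * ∏ j ∈ (Finset.Icc 1 (n + 1)).erase l, (μ l - μ j) := by
  refine neg_one_pow_mul_prod_pos ?_ (fun j hj hjl => ?_) fun j hj hjl => ?_
  · have : ((Finset.Icc 1 (n + 1)).erase l).filter (· < l) = (Finset.Icc 1 n).filter (· < l) := by
      rw [Finset.mem_Icc] at hl
      ext; simp only [Finset.mem_filter, Finset.mem_Icc, Finset.mem_erase]; omega
    rw [this, card_filter_Icc hl]
  · exact sub_neg.2 (hμ (Finset.mem_of_mem_erase hj) hl hjl)
  · exact sub_pos.2 (hμ hl (Finset.mem_of_mem_erase hj)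
      (lt_of_le_of_ne hjl (Finset.ne_of_mem_erase hj).symm))

theorem pole_prod_sign {n : ℕ} {μ b : ℕ → ℝ} (hμ : StrictAntiOn μ (Finset.Icc 1 (n + 1)))
    (hb : ∀ i ∈ Finset.Icc 1 n, b i ∈ Set.Ioo (μ (i + 1)) (μ i)) {l : ℕ}
    (hl : l ∈ Finset.Icc 1 (n + 1)) :
    0 < (-1) ^ (l - 1) * ∏ i ∈ Finset.Icc 1 n, (μ l - b i) := by
  have hl' := Finset.mem_Icc.1 hl
  refine neg_one_pow_mul_prod_pos (card_filter_Icc hl) (fun j hj hjl => ?_) fun j hj hjl => ?_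
  · have h := (hb j hj).1
    rw [Finset.mem_Icc] at hj
    have h2 := hμ.antitoneOn (a := j + 1) (b := l) (Finset.mem_coe.2 (Finset.mem_Icc.2 (by omega))) hl hjl
    linarith
  · have h := (hb j hj).2
    rw [Finset.mem_Icc] at hj
    have h2 := hμ.antitoneOn (a := l) (b := j) hl (Finset.mem_coe.2 (Finset.mem_Icc.2 (by omega))) hjl
    linarith

/-- If the rational function `∑_l a_l ∏_{j ≠ l} (z - μ_j) / ∏_i (z - b_i)` is normalized at the nodes,
then its coefficients are positive, sum to one, and determine its denominator. -/
theorem nodePoly_of_glue {n : ℕ} {μ a b : ℕ → ℝ} (hμ : StrictAntiOn μ (Finset.Icc 1 (n + 1)))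
    (hb : ∀ i ∈ Finset.Icc 1 n, b i ∈ Set.Ioo (μ (i + 1)) (μ i))
    (h : ∀ l ∈ Finset.Icc 1 (n + 1), a l * ∏ j ∈ (Finset.Icc 1 (n + 1)).erase l, (μ l - μ j) =
      ∏ i ∈ Finset.Icc 1 n, (μ l - b i)) :
    (∀ l ∈ Finset.Icc 1 (n + 1), 0 < a l) ∧
      ∀ z, (nodePoly n μ a).eval z = ∏ i ∈ Finset.Icc 1 n, (z - b i) := by
  constructor
  · intro l hl
    have h1 := pole_prod_sign hμ hb hl
    rw [← h l hl, mul_left_comm] at h1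
    exact pos_of_mul_pos_left h1 (node_prod_sign hμ hl).le
  · intro z
    set w : Polynomial ℝ := ∏ i ∈ Finset.Icc 1 n, (Polynomial.X - Polynomial.C (b i)) with hw
    have hwd : w.natDegree = n := by rw [hw, natDegree_prod_X_sub_C]; simp
    have hweval : ∀ z, w.eval z = ∏ i ∈ Finset.Icc 1 n, (z - b i) := fun z => by
      simp [hw, Polynomial.eval_prod]
    have h0 : nodePoly n μ a - w = 0 := by
      -- Both polynomials have degree at most `n` and agree at `n + 1` nodes. No normalization of
      -- the `a l` has to be assumed; comparing leading coefficients shows that they sum to one.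
      refine Polynomial.eq_zero_of_degree_lt_of_eval_index_eq_zero (Finset.Icc 1 (n + 1)) hμ.injOn ?_ fun l hl => ?_
      · rw [Nat.card_Icc, Nat.add_sub_cancel, Polynomial.degree_lt_iff_coeff_zero]
        intro m hm
        have hm' : n < m := hm
        rw [Polynomial.coeff_sub, Polynomial.coeff_eq_zero_of_natDegree_lt
          ((nodePoly_natDegree_le n μ a).trans_lt hm'),
          Polynomial.coeff_eq_zero_of_natDegree_lt (hwd.trans_lt hm'), sub_self]
      · rw [Polynomial.eval_sub, nodePoly_eval_node n μ a hl, h l hl, hweval, sub_self]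
    rw [← hweval, sub_eq_zero.1 h0]

/-- The zeros of `∑_l a_l / (z - μ_l)` interlace the nodes if all `a_l` are positive. -/
theorem exists_interlacing {n : ℕ} {μ a : ℕ → ℝ} (hμ : StrictAntiOn μ (Finset.Icc 1 (n + 1)))
    (ha : ∀ l ∈ Finset.Icc 1 (n + 1), 0 < a l) (hsum : ∑ l ∈ Finset.Icc 1 (n + 1), a l = 1) :
    ∃ b : ℕ → ℝ, (∀ i ∈ Finset.Icc 1 n, b i ∈ Set.Ioo (μ (i + 1)) (μ i)) ∧
      ∀ z, (nodePoly n μ a).eval z = ∏ i ∈ Finset.Icc 1 n, (z - b i) := by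
  have hex : ∀ i ∈ Finset.Icc 1 n, ∃ x ∈ Set.Ioo (μ (i + 1)) (μ i), (nodePoly n μ a).eval x = 0 := by
    intro i hi
    rw [Finset.mem_Icc] at hi
    have hi1 : i ∈ Finset.Icc 1 (n + 1) := Finset.mem_Icc.2 (by omega)
    have hi2 : i + 1 ∈ Finset.Icc 1 (n + 1) := Finset.mem_Icc.2 (by omega)
    have h1 := mul_pos (ha _ hi1) (node_prod_sign hμ hi1)
    have h2 := mul_pos (ha _ hi2) (node_prod_sign hμ hi2)
    rw [mul_left_comm, ← nodePoly_eval_node n μ a hi1] at h1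
    rw [mul_left_comm, ← nodePoly_eval_node n μ a hi2] at h2
    have hcont : ContinuousOn (fun x => (-1) ^ (i - 1) * (nodePoly n μ a).eval x)
        (Set.Icc (μ (i + 1)) (μ i)) := ((nodePoly n μ a).continuous.const_mul _).continuousOn
    have hle := (hμ hi1 hi2 (Nat.lt_succ_self i)).le
    -- At consecutive nodes the signs are `(-1) ^ (i - 1)` and `(-1) ^ i`, so the polynomial has a
    -- zero in between.
    have h3 : (-1) ^ (i - 1) * (nodePoly n μ a).eval (μ (i + 1)) < 0 := by
      have : ((-1 : ℝ)) ^ (i + 1 - 1) = -(-1) ^ (i - 1) := by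
        rw [show i + 1 - 1 = (i - 1) + 1 by omega, pow_succ]; ring
      rw [this] at h2
      linarith
    obtain ⟨x, hx, hx0⟩ := intermediate_value_Ioo hle hcont ⟨h3, h1⟩
    exact ⟨x, hx, (mul_eq_zero.1 hx0).resolve_left (pow_ne_zero _ (by norm_num))⟩
  choose! b hb hb0 using hex
  refine ⟨b, hb, fun z => ?_⟩
  have hinj : Set.InjOn b (Finset.Icc 1 n) := by
    have hanti : StrictAntiOn b (Finset.Icc 1 n) := by
      intro i hi j hj hij
      have h1 := (hb i hi).1
      have h2 := (hb j hj).2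
      rw [Finset.mem_coe, Finset.mem_Icc] at hi hj
      have h3 := hμ.antitoneOn (a := i + 1) (b := j) (Finset.mem_coe.2 (Finset.mem_Icc.2 (by omega)))
        (Finset.mem_coe.2 (Finset.mem_Icc.2 (by omega))) hij
      linarith
    exact hanti.injOn
  rw [eval_eq_of_roots (nodePoly_natDegree_le n μ a) hinj hb0, nodePoly_coeff, hsum, one_mul]

theorem tendsto_node_quotient {n : ℕ} (μ b : ℕ → ℝ) {l : ℕ} (hl : l ∈ Finset.Icc 1 (n + 1)) :
    Tendsto (fun z : ℝ => (∏ j ∈ (Finset.Icc 1 (n + 1)).erase l, (z - μ j)) /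
      ∏ i ∈ Finset.Icc 1 n, (z - b i)) (cocompact ℝ) (𝓝 1) := by
  have hprod : ∀ (s : Finset ℕ) (c : ℕ → ℝ),
      Tendsto (fun z : ℝ => ∏ j ∈ s, (1 - c j * z⁻¹)) (cocompact ℝ) (𝓝 1) := by
    intro s c
    have h : Tendsto (fun z : ℝ => z⁻¹) (cocompact ℝ) (𝓝 0) := by
      rw [← Metric.cobounded_eq_cocompact]; exact tendsto_inv₀_cobounded
    have h2 := tendsto_finsetProd s fun j _ => (h.const_mul (c j)).const_sub 1
    simpa using h2
  have h := (hprod ((Finset.Icc 1 (n + 1)).erase l) μ).div (hprod (Finset.Icc 1 n) b) one_ne_zero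
  rw [div_one] at h
  refine h.congr' ?_
  have hne : ∀ᶠ z : ℝ in cocompact ℝ, z ≠ 0 := by
    have := (isCompact_singleton (x := (0 : ℝ))).compl_mem_cocompact
    filter_upwards [this] with z hz using hz
  filter_upwards [hne] with z hz
  have hfac : ∀ (s : Finset ℕ) (c : ℕ → ℝ), s.card = n →
      ∏ j ∈ s, (z - c j) = z ^ n * ∏ j ∈ s, (1 - c j * z⁻¹) := by
    intro s c hs
    rw [← hs, ← Finset.prod_const, ← Finset.prod_mul_distrib]
    refine Finset.prod_congr rfl fun j _ => ?_
    field_simp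
  rw [Pi.div_apply, hfac _ μ (card_erase_Icc hl), hfac _ b (by simp),
    mul_div_mul_left _ _ (pow_ne_zero _ hz)]

theorem lam_strictAnti {ξ : ℝ} (hξ : 1 < ξ) (n : ℕ) :
    StrictAntiOn (lam ξ) (Finset.Icc 1 n) := by
  intro i hi j hj hij
  rw [Finset.mem_coe, Finset.mem_Icc] at hi hj
  unfold lam
  rw [if_neg (show ¬ j = 1 by omega)]
  split_ifs with h
  · have := pow_pos (show 0 < ξ by linarith) (2 * (j - 2)); linarith
  · exact neg_lt_neg (pow_lt_pow_right₀ hξ (by omega))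

end Interpolation

/-! ### The vacuum wave function and the solution of the linear systems -/

section Vacuum

variable {N M J : ℕ}

theorem vacuum_eq (N : ℕ) (k : Fin M → ℝ) (ξ : ℝ) (d : VacuumData) {r : ℕ} (hr : 1 ≤ r) (z : ℝ)
    (t : Fin J → ℝ) : vacuum N k ξ d r z t = ∑ l ∈ Finset.Icc 1 (M - N + 1),
      d.B r l * ((∏ j ∈ (Finset.Icc 1 (M - N + 1)).erase l, (z - lam ξ j)) /
        ∏ i ∈ Finset.Icc 1 (M - N), (z - d.b r i)) * vacuumValue N k ξ d r l t := by
  obtain ⟨r, rfl⟩ : ∃ s, r = s + 1 := ⟨r - 1, by omega⟩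
  rfl

theorem vacuum_eq_div (N : ℕ) (k : Fin M → ℝ) (ξ : ℝ) (d : VacuumData) {r : ℕ} (hr : 1 ≤ r) (z : ℝ)
    (t : Fin J → ℝ) : vacuum N k ξ d r z t =
      (nodePoly (M - N) (lam ξ) fun l => d.B r l * vacuumValue N k ξ d r l t).eval z /
        ∏ i ∈ Finset.Icc 1 (M - N), (z - d.b r i) := by
  rw [vacuum_eq N k ξ d hr, nodePoly_eval, Finset.sum_div]
  exact Finset.sum_congr rfl fun l _ => by ring

theorem tendsto_vacuum (N : ℕ) (k : Fin M → ℝ) (ξ : ℝ) (d : VacuumData) {r : ℕ} (hr : 1 ≤ r)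
    (t : Fin J → ℝ) : Tendsto (fun z : ℝ => vacuum N k ξ d r z t) (cocompact ℝ)
      (𝓝 (∑ l ∈ Finset.Icc 1 (M - N + 1), d.B r l * vacuumValue N k ξ d r l t)) := by
  simp only [vacuum_eq N k ξ d hr]
  refine tendsto_finsetSum _ fun l hl => ?_
  have h := ((tendsto_node_quotient (lam ξ) (d.b r) hl).const_mul (d.B r l)).mul_const
    (vacuumValue N k ξ d r l t)
  simpa using h

/-- Numerator and denominator of the wave function at `α_l` are both of the form `nodePoly`, since
`hW` rewrites the pole product. Removing the common factor turns each product of node differences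
into a weight, so the value is a weighted average of the previous values. -/
theorem vacuumValue_succ_of_pos (k : Fin M → ℝ) {ξ : ℝ} (hξ : 0 < ξ) (d : VacuumData) {r : ℕ}
    (hr : 1 ≤ r)
    (hW : ∀ z, (nodePoly (M - N) (lam ξ) (d.B r)).eval z =
      ∏ i ∈ Finset.Icc 1 (M - N), (z - d.b r i)) {v : ℕ → ℕ → ℝ}
    (hv : ∀ l ∈ Finset.Icc 1 (M - N + 1), ∀ t : Fin J → ℝ,
      vacuumValue N k ξ d r l t = expSum (v l) k t) (hrN : r < N) (hNM : N ≤ M) (l : ℕ)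
    (t : Fin J → ℝ) :
    vacuumValue N k ξ d (r + 1) l t = expSum (nextCoeff N M ξ (d.B r) v (r + 1) l) k t := by
  unfold vacuumValue glueValue
  rw [if_neg (by omega), Nat.add_sub_cancel]
  split_ifs with h1
  · rw [expSum, Finset.sum_eq_single_of_mem (N - (r + 1) + 1) (Finset.mem_Icc.2 (by omega))]
    · simp [nextCoeff, h1]
    · intro j _ hj
      simp [nextCoeff, h1, hj]
  · have hα := alpha_pos hξ l
    set w := ∏ j ∈ Finset.Icc 1 (M - N + 1), (alpha ξ l - lam ξ j) with hw
    have hne : ∀ j, alpha ξ l - lam ξ j ≠ 0 := fun j => by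
      have := lam_nonpos hξ j; linarith
    have hw0 : w ≠ 0 := Finset.prod_ne_zero_iff.2 fun j _ => hne j
    have herase : ∀ a : ℕ → ℝ, (nodePoly (M - N) (lam ξ) a).eval (alpha ξ l) =
        (w / alpha ξ l) * ∑ m ∈ Finset.Icc 1 (M - N + 1), a m * weight ξ l m := by
      intro a
      rw [nodePoly_eval, Finset.mul_sum]
      refine Finset.sum_congr rfl fun m hm => ?_
      have h2 := Finset.mul_prod_erase _ (fun j => alpha ξ l - lam ξ j) hm
      rw [← hw] at h2
      rw [weight, ← h2]
      have := hne m
      field_simp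
    rw [vacuum_eq_div N k ξ d hr, ← hW, herase, herase,
      mul_div_mul_left _ _ (div_ne_zero hw0 hα.ne')]
    simp only [nextCoeff, if_neg h1, expSum]
    simp_rw [div_mul_eq_mul_div]
    rw [← Finset.sum_div]
    congr 1
    simp_rw [Finset.sum_mul]
    rw [Finset.sum_comm]
    refine Finset.sum_congr rfl fun m hm => ?_
    rw [hv m hm, expSum, Finset.mul_sum, Finset.sum_mul]
    exact Finset.sum_congr rfl fun j _ => by ring

theorem vacuumValue_one (k : Fin M → ℝ) (ξ : ℝ) (d : VacuumData) (A : Matrix (Fin N) (Fin M) ℝ)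
    (hN : 1 ≤ N) (hNM : N ≤ M) {l : ℕ} (hl : l ∈ Finset.Icc 1 (M - N + 1)) (t : Fin J → ℝ) :
    vacuumValue N k ξ d 1 l t = expSum (canV A ξ 1 l) k t := by
  rw [Finset.mem_Icc] at hl
  rw [expSum, Finset.sum_eq_single_of_mem (N + l - 1) (Finset.mem_Icc.2 (by omega))]
  · simp [canV, vacuumValue, glueValue]
  · intro j _ hj
    simp [canV, hj]

/-- The linear system has no equation for the columns left of `N - r + 1`; this shows that the
identity it expresses is trivial there. -/
theorem canV_eq_zero (A : Matrix (Fin N) (Fin M) ℝ) (ξ : ℝ) {r : ℕ} (hr : r ∈ Finset.Icc 1 N)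
    {l j : ℕ} (hl : 1 ≤ l) (hj : j < N - r + 1) : canV A ξ r l j = 0 := by
  rw [Finset.mem_Icc] at hr
  induction r, hr.1 using Nat.le_induction generalizing l with
  | base => simp only [canV]; rw [if_neg (by omega)]
  | succ r h1 ih =>
    rw [canV_succ A ξ h1, nextCoeff]
    split_ifs with h2 h3
    · omega
    · rfl
    · rw [Finset.sum_eq_zero, zero_div]
      intro m hm
      rw [ih (by omega) (Finset.mem_Icc.1 hm).1 (by omega), mul_zero]

theorem sum_nextCoeff {ξ : ℝ} (hξ : 0 < ξ) (hNM : N ≤ M) {B : ℕ → ℝ}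
    (hB : ∀ l ∈ Finset.Icc 1 (M - N + 1), 0 < B l) {v : ℕ → ℕ → ℝ}
    (hv : ∀ l ∈ Finset.Icc 1 (M - N + 1), ∑ j ∈ Finset.Icc 1 M, v l j = 1) {r : ℕ}
    (hr : r ∈ Finset.Icc 1 N) (l : ℕ) :
    ∑ j ∈ Finset.Icc 1 M, nextCoeff N M ξ B v r l j = 1 := by
  rw [Finset.mem_Icc] at hr
  unfold nextCoeff
  split_ifs with h
  · rw [Finset.sum_ite_eq', if_pos (Finset.mem_Icc.2 (by omega))]
  · rw [← Finset.sum_div, Finset.sum_comm, div_eq_one_iff_eq]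
    · refine Finset.sum_congr rfl fun m hm => ?_
      rw [← Finset.mul_sum, hv m hm, mul_one]
    · exact (Finset.sum_pos (fun m hm => mul_pos (hB m hm) (weight_pos hξ _ _))
        ⟨1, Finset.mem_Icc.2 (by omega)⟩).ne'

theorem expSum_zero (c : ℕ → ℝ) (k : Fin M → ℝ) :
    expSum c k (0 : Fin J → ℝ) = ∑ j ∈ Finset.Icc 1 M, c j := by
  simp [expSum, theta]

/-- At a node only one summand survives. Both sides still carry the factor $V^{(r)}_l(t)$: existence
multiplies by it, uniqueness removes it at `t = 0`, where it equals one. -/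
theorem glue_iff {ξ : ℝ} (hξ : 1 < ξ) (k : Fin M → ℝ) (d : VacuumData) {r : ℕ} (hr : 1 ≤ r)
    (hb : ∀ i ∈ Finset.Icc 1 (M - N), d.b r i ∈ Set.Ioo (lam ξ (i + 1)) (lam ξ i)) {l : ℕ}
    (hl : l ∈ Finset.Icc 1 (M - N + 1)) (t : Fin J → ℝ) :
    vacuum N k ξ d r (lam ξ l) t = vacuumValue N k ξ d r l t ↔
      d.B r l * (∏ j ∈ (Finset.Icc 1 (M - N + 1)).erase l, (lam ξ l - lam ξ j)) *
        vacuumValue N k ξ d r l t =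
      (∏ i ∈ Finset.Icc 1 (M - N), (lam ξ l - d.b r i)) * vacuumValue N k ξ d r l t := by
  have h0 : ∏ i ∈ Finset.Icc 1 (M - N), (lam ξ l - d.b r i) ≠ 0 := fun h => by
    have := pole_prod_sign (lam_strictAnti hξ _) hb hl
    rw [h, mul_zero] at this
    exact lt_irrefl _ this
  rw [vacuum_eq_div N k ξ d hr, nodePoly_eval_node _ _ _ hl, div_eq_iff h0]
  constructor <;> intro h <;> linarith

/-- The conditions on `ξ` under which the construction has a unique solution. -/
structure IsAdmissible (A : Matrix (Fin N) (Fin M) ℝ) (ξ : ℝ) : Prop where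
  one_lt : 1 < ξ
  det_ne_zero : ∀ r ∈ Finset.Icc 1 N, (sysMat A r (canV A ξ r)).det ≠ 0
  B_pos : ∀ r ∈ Finset.Icc 1 N, ∀ l ∈ Finset.Icc 1 (M - N + 1), 0 < canB A ξ r l
  eps_pos : ∀ r ∈ Finset.Icc 1 N, ∀ i ∈ Finset.Icc 1 (r - 1), 0 < canEps A ξ r i

theorem eventually_isAdmissible {A : Matrix (Fin N) (Fin M) ℝ} (hA : IsNormalizedBanded A)
    (hNM : N < M) : ∀ᶠ ξ in atTop, IsAdmissible A ξ := by
  have h : ∀ r ∈ Finset.Icc 1 N, SolAsymptotics A r (fun ξ => canV A ξ r) := fun r hr =>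
    (coeffAsymptotics_canV hA hNM hr).solAsymptotics hA hNM.le hr
  filter_upwards [eventually_gt_atTop 1,
    (Finset.eventually_all _).2 fun r hr => (h r hr).det_ne_zero,
    (Finset.eventually_all _).2 fun r hr => (h r hr).pos,
    (Finset.eventually_all _).2 fun r hr => (h r hr).eps_pos] with ξ h1 h2 h3 h4
  exact ⟨h1, h2, h3, h4⟩

theorem IsAdmissible.sum_canV {A : Matrix (Fin N) (Fin M) ℝ} {ξ : ℝ} (h : IsAdmissible A ξ)
    (hNM : N ≤ M) {r : ℕ} (hr : r ∈ Finset.Icc 1 N) {l : ℕ} (hl : l ∈ Finset.Icc 1 (M - N + 1)) :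
    ∑ j ∈ Finset.Icc 1 M, canV A ξ r l j = 1 := by
  have hr' := Finset.mem_Icc.1 hr
  clear hr
  induction r, hr'.1 using Nat.le_induction generalizing l with
  | base =>
    rw [Finset.mem_Icc] at hl
    simp only [canV]
    rw [Finset.sum_ite_eq', if_pos (Finset.mem_Icc.2 (by omega))]
  | succ r h1 ih =>
    rw [canV_succ A ξ h1]
    exact sum_nextCoeff (by linarith [h.one_lt]) hNM (h.B_pos r (Finset.mem_Icc.2 (by omega)))
      (fun l hl => ih hl (by omega)) (Finset.mem_Icc.2 hr') l

theorem IsAdmissible.one_add_eps_pos {A : Matrix (Fin N) (Fin M) ℝ} {ξ : ℝ}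
    (h : IsAdmissible A ξ) {r : ℕ} (hr : r ∈ Finset.Icc 1 N) :
    0 < 1 + ∑ i ∈ Finset.Icc 1 (r - 1), canEps A ξ r i := by
  have := Finset.sum_nonneg fun i hi => (h.eps_pos r hr i hi).le
  linarith

theorem IsAdmissible.sum_canB_mul_canV {A : Matrix (Fin N) (Fin M) ℝ} {ξ : ℝ}
    (h : IsAdmissible A ξ) (hA : IsNormalizedBanded A) (hNM : N ≤ M) {r : ℕ}
    (hr : r ∈ Finset.Icc 1 N) {j : ℕ} (hj : j ∈ Finset.Icc 1 M) :
    ∑ l ∈ Finset.Icc 1 (M - N + 1), canB A ξ r l * canV A ξ r l j =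
      (entry A (N - r + 1) j + ∑ i ∈ Finset.Icc 1 (r - 1),
        canEps A ξ r i * entry A (N - r + 1 + i) j) /
        (1 + ∑ i ∈ Finset.Icc 1 (r - 1), canEps A ξ r i) := by
  have hr' := Finset.mem_Icc.1 hr
  rw [Finset.mem_Icc] at hj
  rcases Nat.lt_or_ge j (N - r + 1) with h1 | h1
  · rw [Finset.sum_eq_zero, hA.entry_eq_zero (.inl h1), Finset.sum_eq_zero, zero_add, zero_div]
    · intro i _; rw [hA.entry_eq_zero (by omega), mul_zero]
    · intro l hl; rw [canV_eq_zero A ξ hr (Finset.mem_Icc.1 hl).1 h1, mul_zero]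
  · have h2 := sysSol_eq hr hNM (h.det_ne_zero r hr) (j := j) (Finset.mem_Icc.2 (by omega))
    rw [canEps, ← h2, Finset.sum_div]
    refine Finset.sum_congr rfl fun l _ => ?_
    rw [canB, solB]; ring

/-- This is the limit at infinity evaluated at `t = 0`: all $V_l$ and all $f_i$ equal one there
because their coefficients sum to one. -/
theorem IsAdmissible.sum_canB {A : Matrix (Fin N) (Fin M) ℝ} {ξ : ℝ}
    (h : IsAdmissible A ξ) (hA : IsNormalizedBanded A) (hNM : N ≤ M) {r : ℕ}
    (hr : r ∈ Finset.Icc 1 N) : ∑ l ∈ Finset.Icc 1 (M - N + 1), canB A ξ r l = 1 := by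
  have hr' := Finset.mem_Icc.1 hr
  have h1 : ∑ l ∈ Finset.Icc 1 (M - N + 1), canB A ξ r l = ∑ j ∈ Finset.Icc 1 M,
      ∑ l ∈ Finset.Icc 1 (M - N + 1), canB A ξ r l * canV A ξ r l j := by
    rw [Finset.sum_comm]
    refine Finset.sum_congr rfl fun l hl => ?_
    rw [← Finset.mul_sum, h.sum_canV hNM hr hl, mul_one]
  rw [h1, Finset.sum_congr rfl fun j hj => h.sum_canB_mul_canV hA hNM hr hj, ← Finset.sum_div,
    Finset.sum_add_distrib, hA.row_sum _ (Finset.mem_Icc.2 (by omega)), Finset.sum_comm,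
    div_eq_one_iff_eq (h.one_add_eps_pos hr).ne']
  congr 1
  refine Finset.sum_congr rfl fun i hi => ?_
  rw [Finset.mem_Icc] at hi
  rw [← Finset.mul_sum, hA.row_sum _ (Finset.mem_Icc.2 (by omega)), mul_one]

theorem limit_eq_expSum (A : Matrix (Fin N) (Fin M) ℝ) (k : Fin M → ℝ) (ε : ℕ → ℝ) (r : ℕ)
    (t : Fin J → ℝ) :
    (heat A k (N - r + 1) t + ∑ j ∈ Finset.Icc 1 (r - 1), ε j * heat A k (N - r + 1 + j) t) /
      (1 + ∑ j ∈ Finset.Icc 1 (r - 1), ε j) =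
    expSum (fun j => (entry A (N - r + 1) j + ∑ i ∈ Finset.Icc 1 (r - 1),
        ε i * entry A (N - r + 1 + i) j) / (1 + ∑ i ∈ Finset.Icc 1 (r - 1), ε i)) k t := by
  simp only [heat, expSum, div_mul_eq_mul_div]
  rw [← Finset.sum_div]
  congr 1
  simp only [add_mul, Finset.sum_add_distrib, Finset.sum_mul, Finset.mul_sum]
  congr 1
  rw [Finset.sum_comm]
  exact Finset.sum_congr rfl fun j _ => Finset.sum_congr rfl fun i _ => by ring

theorem sum_mul_expSum (s : Finset ℕ) (B : ℕ → ℝ) (v : ℕ → ℕ → ℝ) (k : Fin M → ℝ)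
    (t : Fin J → ℝ) : ∑ l ∈ s, B l * expSum (v l) k t = expSum (fun j => ∑ l ∈ s, B l * v l j) k t := by
  simp only [expSum, Finset.mul_sum, Finset.sum_mul]
  rw [Finset.sum_comm]
  exact Finset.sum_congr rfl fun j _ => Finset.sum_congr rfl fun i _ => by ring

/-- Existence of the vacuum wave function. -/
theorem IsAdmissible.exists_isVacuum {A : Matrix (Fin N) (Fin M) ℝ} {ξ : ℝ}
    (h : IsAdmissible A ξ) (hA : IsNormalizedBanded A) (hNM : N ≤ M) (k : Fin M → ℝ) :
    ∃ d : VacuumData, IsVacuum (J := J) A k ξ d := by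
  have hex : ∀ r ∈ Finset.Icc 1 N, ∃ b : ℕ → ℝ,
      (∀ i ∈ Finset.Icc 1 (M - N), b i ∈ Set.Ioo (lam ξ (i + 1)) (lam ξ i)) ∧
      ∀ z, (nodePoly (M - N) (lam ξ) (canB A ξ r)).eval z =
        ∏ i ∈ Finset.Icc 1 (M - N), (z - b i) := fun r hr =>
    exists_interlacing (lam_strictAnti h.one_lt _) (h.B_pos r hr) (h.sum_canB hA hNM hr)
  -- The poles are not unknowns of the linear system; they are recovered as the zeros of the
  -- interpolating polynomial.
  choose! b hb hW using hex
  let d : VacuumData := ⟨canB A ξ, b, canEps A ξ⟩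
  have hξ : 0 < ξ := by linarith [h.one_lt]
  have hval : ∀ r ∈ Finset.Icc 1 N, ∀ l ∈ Finset.Icc 1 (M - N + 1), ∀ t : Fin J → ℝ,
      vacuumValue N k ξ d r l t = expSum (canV A ξ r l) k t := by
    intro r hr
    have hr' := Finset.mem_Icc.1 hr
    clear hr
    induction r, hr'.1 using Nat.le_induction with
    | base => exact fun l hl t => vacuumValue_one k ξ d A hr'.2 hNM hl t
    | succ r h1 ih =>
      intro l _ t
      rw [canV_succ A ξ h1]
      exact vacuumValue_succ_of_pos k hξ d h1 (hW r (Finset.mem_Icc.2 (by omega)))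
        (ih (by omega)) (by omega) hNM l t
  refine ⟨d, h.eps_pos, hb, fun r hr l hl t => ?_, fun r hr t => ?_⟩
  · have hr' := Finset.mem_Icc.1 hr
    rw [glue_iff h.one_lt k d hr'.1 (hb r hr) hl]
    congr 1
    rw [← nodePoly_eval_node _ _ _ hl]
    exact hW r hr _
  · have hr' := Finset.mem_Icc.1 hr
    have hlim := tendsto_vacuum N k ξ d hr'.1 t
    rw [Finset.sum_congr rfl fun l hl => by rw [hval r hr l hl t], sum_mul_expSum] at hlim
    rw [limit_eq_expSum]
    convert hlim using 2
    exact Finset.sum_congr rfl fun j hj =>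
      congr_arg (· * Real.exp (theta (phase k j) t)) (h.sum_canB_mul_canV hA hNM hr hj).symm

/-- Uniqueness of the vacuum wave function. -/
theorem IsVacuum.eq_can [NeZero J] {A : Matrix (Fin N) (Fin M) ℝ} {ξ : ℝ} {d : VacuumData}
    {k : Fin M → ℝ} (hd : IsVacuum (J := J) A k ξ d) (h : IsAdmissible A ξ)
    (hNM : N ≤ M) (hk : StrictMono k) {r : ℕ} (hr : r ∈ Finset.Icc 1 N) :
    (∀ l ∈ Finset.Icc 1 (M - N + 1), ∀ t : Fin J → ℝ,
      vacuumValue N k ξ d r l t = expSum (canV A ξ r l) k t) ∧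
    (∀ l ∈ Finset.Icc 1 (M - N + 1), d.B r l = canB A ξ r l) := by
  have hξ : 0 < ξ := by linarith [h.one_lt]
  have hW : ∀ r ∈ Finset.Icc 1 N, (∀ l ∈ Finset.Icc 1 (M - N + 1), ∀ t : Fin J → ℝ,
      vacuumValue N k ξ d r l t = expSum (canV A ξ r l) k t) →
      ∀ z, (nodePoly (M - N) (lam ξ) (d.B r)).eval z =
        ∏ i ∈ Finset.Icc 1 (M - N), (z - d.b r i) := by
    intro r hr hv
    refine (nodePoly_of_glue (lam_strictAnti h.one_lt _) (hd.pole_mem r hr) fun l hl => ?_).2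
    have h1 := (glue_iff h.one_lt k d (Finset.mem_Icc.1 hr).1 (hd.pole_mem r hr) hl
      (0 : Fin J → ℝ)).1 (hd.glue r hr l hl 0)
    rwa [hv l hl, expSum_zero, h.sum_canV hNM hr hl, mul_one, mul_one] at h1
  have hB : ∀ r ∈ Finset.Icc 1 N, (∀ l ∈ Finset.Icc 1 (M - N + 1), ∀ t : Fin J → ℝ,
      vacuumValue N k ξ d r l t = expSum (canV A ξ r l) k t) →
      ∀ l ∈ Finset.Icc 1 (M - N + 1), d.B r l = canB A ξ r l := by
    intro r hr hv l hl
    have hr' := Finset.mem_Icc.1 hr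
    set c := 1 + ∑ i ∈ Finset.Icc 1 (r - 1), d.ε r i with hc
    have hc0 : 0 < c := by
      have := Finset.sum_nonneg fun i hi => (hd.eps_pos r hr i hi).le
      linarith
    have hlim : ∀ j ∈ Finset.Icc 1 M, ∑ l ∈ Finset.Icc 1 (M - N + 1), d.B r l * canV A ξ r l j =
        (entry A (N - r + 1) j + ∑ i ∈ Finset.Icc 1 (r - 1),
          d.ε r i * entry A (N - r + 1 + i) j) / c := by
      intro j hj
      refine expSum_injective (J := J)
        (c := fun j => ∑ l ∈ Finset.Icc 1 (M - N + 1), d.B r l * canV A ξ r l j)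
        (c' := fun j => (entry A (N - r + 1) j + ∑ i ∈ Finset.Icc 1 (r - 1),
          d.ε r i * entry A (N - r + 1 + i) j) / c) hk (fun t => ?_) hj
      have h1 := tendsto_nhds_unique (tendsto_vacuum N k ξ d hr'.1 t) (hd.limit r hr t)
      rwa [Finset.sum_congr rfl fun l hl => by rw [hv l hl t], sum_mul_expSum,
        limit_eq_expSum] at h1
    -- The given data, multiplied by `c` in the `B` positions, solve the linear system and hence
    -- agree with Cramer's solution. The `ε` are read off first, which identifies `c`.
    have hx : ∀ p < M - N + r, (if p ≤ M - N then c * d.B r (p + 1) else d.ε r (p - (M - N))) =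
        sysSol A r (canV A ξ r) p := fun p hp => eq_sysSol (A := A) hr hNM (h.det_ne_zero r hr)
      (x := fun p => if p ≤ M - N then c * d.B r (p + 1) else d.ε r (p - (M - N))) (by
        intro j hj
        have h1 := hlim j (by rw [Finset.mem_Icc] at hj ⊢; omega)
        rw [eq_div_iff hc0.ne'] at h1
        have h2 : ∀ i ∈ Finset.Icc 1 (r - 1),
            (if M - N + i ≤ M - N then c * d.B r (M - N + i + 1) else
              d.ε r (M - N + i - (M - N))) * entry A (N - r + 1 + i) j =
            d.ε r i * entry A (N - r + 1 + i) j := by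
          intro i hi
          rw [Finset.mem_Icc] at hi
          rw [if_neg (by omega), Nat.add_sub_cancel_left]
        rw [Finset.sum_congr rfl h2, ← h1, Finset.sum_mul]
        refine Finset.sum_congr rfl fun l hl => ?_
        rw [Finset.mem_Icc] at hl
        rw [if_pos (by omega), Nat.sub_add_cancel hl.1]
        ring) hp
    have heps : ∀ i ∈ Finset.Icc 1 (r - 1), canEps A ξ r i = d.ε r i := by
      intro i hi
      rw [Finset.mem_Icc] at hi
      have h1 := hx (M - N + i) (by omega)
      rw [if_neg (by omega), Nat.add_sub_cancel_left] at h1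
      exact h1.symm
    rw [Finset.mem_Icc] at hl
    have h1 := hx (l - 1) (by omega)
    rw [if_pos (by omega), Nat.sub_add_cancel hl.1] at h1
    have heps' : ∑ i ∈ Finset.Icc 1 (r - 1), solEps A r (canV A ξ r) i =
        ∑ i ∈ Finset.Icc 1 (r - 1), d.ε r i := Finset.sum_congr rfl heps
    rw [canB, solB, ← h1, heps', ← hc]
    field_simp
  have hv : ∀ l ∈ Finset.Icc 1 (M - N + 1), ∀ t : Fin J → ℝ,
      vacuumValue N k ξ d r l t = expSum (canV A ξ r l) k t := by
    have hr' := Finset.mem_Icc.1 hr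
    clear hr
    induction r, hr'.1 using Nat.le_induction with
    | base => exact fun l hl t => vacuumValue_one k ξ d A hr'.2 hNM hl t
    | succ r h1 ih =>
      intro l _ t
      have hrm : r ∈ Finset.Icc 1 N := Finset.mem_Icc.2 (by omega)
      have ih' := ih (by omega)
      rw [canV_succ A ξ h1, vacuumValue_succ_of_pos k hξ d h1 (hW r hrm ih') ih' (by omega) hNM l t]
      congr 1
      funext j
      unfold nextCoeff
      have h2 := hB r hrm ih'
      split_ifs
      · rfl
      · rfl
      · congr 1
        · exact Finset.sum_congr rfl fun m hm => by rw [h2 m hm]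
        · exact Finset.sum_congr rfl fun m hm => by rw [h2 m hm]
  exact ⟨hv, hB r hr hv⟩

end Vacuum

/-! ### Roots of polynomials with widely separated nodes -/

section Roots

theorem lam_succ {ξ : ℝ} {n : ℕ} (hn : 1 ≤ n) : lam ξ (n + 1) = -ξ ^ (2 * (n - 1)) := by
  unfold lam; rw [if_neg (by omega)]; rfl

/-- At the scale $z=u\xi^{2(n-1)}$ with $u$ bounded above and below, the nodes before `n + 1` are at
least a factor `ξ` smaller than `z` and those after it at least a factor `ξ` larger. The constant
`24 * ρ ^ 3` is `3 * ρ`, a bound for `|u + 1|`, times `8 * ρ ^ 2`, a bound for the reciprocal of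
`|u| * |u - μ|` in the first case. -/
theorem node_weight_estimate {ξ ρ u : ℝ} (hρ : 1 ≤ ρ) (hξ : 4 * ρ ≤ ξ) (hu1 : 1 ≤ 2 * ρ * |u|)
    (hu2 : |u| ≤ 2 * ρ) {n l : ℕ} (hn : 1 ≤ n) (hl : 1 ≤ l) (hne : l ≠ n + 1) :
    u * ξ ^ (2 * (n - 1)) - lam ξ l ≠ 0 ∧
      |(u * ξ ^ (2 * (n - 1)) - lam ξ (n + 1)) / (u * ξ ^ (2 * (n - 1)) - lam ξ l) -
        (if l ≤ n then (u + 1) / u else 0)| ≤ 24 * ρ ^ 3 / ξ := by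
  have hξ0 : 0 < ξ := by linarith
  have hξ1 : 1 ≤ ξ := by linarith
  set X := ξ ^ (2 * (n - 1)) with hX
  have hX0 : 0 < X := pow_pos hξ0 _
  have hu0 : u ≠ 0 := by
    rintro rfl
    rw [abs_zero, mul_zero] at hu1
    linarith
  have hua : 0 < |u| := abs_pos.2 hu0
  have hu3 : |u + 1| ≤ 3 * ρ := by
    have := abs_add_le u 1
    rw [abs_one] at this; linarith
  -- Rescaling by `X` removes the size of the root, leaving a small or a large `μ` to compare with
  -- `u`.
  obtain ⟨μ, hμ⟩ : ∃ μ, lam ξ l = μ * X := ⟨lam ξ l / X, by field_simp⟩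
  rw [lam_succ hn, ← hX, hμ, ← sub_mul, show u * X - -X = (u + 1) * X by ring]
  have key : ∀ {c : ℝ}, u - μ ≠ 0 → |(u + 1) / (u - μ) - c| ≤ 24 * ρ ^ 3 / ξ →
      (u - μ) * X ≠ 0 ∧ |(u + 1) * X / ((u - μ) * X) - c| ≤ 24 * ρ ^ 3 / ξ := by
    intro c h1 h2
    exact ⟨mul_ne_zero h1 hX0.ne', by rwa [mul_div_mul_right _ _ hX0.ne']⟩
  have hρ3 : ρ ≤ ρ ^ 3 := le_self_pow₀ hρ (by norm_num)
  split_ifs with h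
  · have hμ1 : |μ| * ξ ≤ 1 := by
      rcases Nat.lt_or_ge l 2 with h2 | h2
      · obtain rfl : l = 1 := by omega
        have h3 : μ = 0 := by
          have h4 : (0 : ℝ) = μ * X := by rw [← hμ]; simp [lam]
          exact (mul_eq_zero.1 h4.symm).resolve_right hX0.ne'
        rw [h3]; simp
      · have h3 : |μ| * X = ξ ^ (2 * (l - 2)) := by
          have h4 : lam ξ l = -ξ ^ (2 * (l - 2)) := by unfold lam; rw [if_neg (by omega)]
          rw [← abs_of_pos hX0, ← abs_mul, ← hμ, h4, abs_neg, abs_of_pos (pow_pos hξ0 _)]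
        have h5 : ξ ^ (2 * (l - 2)) * ξ ≤ X := by
          rw [hX, ← pow_succ]
          exact pow_le_pow_right₀ hξ1 (by omega)
        rw [← h3, mul_right_comm] at h5
        exact le_of_mul_le_mul_right (by linarith) hX0
    have hμ2 : |μ| ≤ |u| / 2 := by
      have h1 : |μ| * (4 * ρ) ≤ 1 := (mul_le_mul_of_nonneg_left hξ (abs_nonneg _)).trans hμ1
      have h2 : |μ| * (4 * ρ) ≤ |u| / 2 * (4 * ρ) := by linarith
      exact le_of_mul_le_mul_right h2 (by linarith)
    have hlow : |u| / 2 ≤ |u - μ| := by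
      have := abs_sub_abs_le_abs_sub u μ; linarith
    have hne0 : u - μ ≠ 0 := abs_pos.1 (by linarith)
    refine key hne0 ?_
    have h1 : (u + 1) / (u - μ) - (u + 1) / u = (u + 1) * μ / (u * (u - μ)) := by
      field_simp; ring
    rw [h1, abs_div, abs_mul, abs_mul, div_le_div_iff₀ (mul_pos hua (abs_pos.2 hne0)) hξ0]
    have h2 : 1 ≤ 8 * ρ ^ 2 * (|u| * |u - μ|) := by
      have h3 : 1 ≤ (2 * ρ * |u|) * (4 * ρ * |u - μ|) :=
        one_le_mul_of_one_le_of_one_le hu1 (by nlinarith)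
      linarith
    calc |u + 1| * |μ| * ξ = |u + 1| * (|μ| * ξ) := by ring
      _ ≤ 3 * ρ * 1 := mul_le_mul hu3 hμ1 (by positivity) (by positivity)
      _ ≤ 3 * ρ * (8 * ρ ^ 2 * (|u| * |u - μ|)) := mul_le_mul_of_nonneg_left h2 (by positivity)
      _ = 24 * ρ ^ 3 * (|u| * |u - μ|) := by ring
  · have hμ1 : ξ ≤ |μ| := by
      have h3 : |μ| * X = ξ ^ (2 * (l - 2)) := by
        have h4 : lam ξ l = -ξ ^ (2 * (l - 2)) := by unfold lam; rw [if_neg (by omega)]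
        rw [← abs_of_pos hX0, ← abs_mul, ← hμ, h4, abs_neg, abs_of_pos (pow_pos hξ0 _)]
      have h5 : ξ * X ≤ ξ ^ (2 * (l - 2)) := by
        rw [hX, ← pow_succ']
        exact pow_le_pow_right₀ hξ1 (by omega)
      rw [← h3] at h5
      exact le_of_mul_le_mul_right h5 hX0
    have hlow : ξ / 2 ≤ |u - μ| := by
      have := abs_sub_abs_le_abs_sub μ u
      rw [abs_sub_comm] at this
      linarith
    have hne0 : u - μ ≠ 0 := abs_pos.1 (by linarith)
    refine key hne0 ?_
    rw [sub_zero, abs_div, div_le_div_iff₀ (abs_pos.2 hne0) hξ0]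
    calc |u + 1| * ξ ≤ 3 * ρ * ξ := mul_le_mul_of_nonneg_right hu3 hξ0.le
      _ ≤ 6 * ρ * |u - μ| := by nlinarith
      _ ≤ 24 * ρ ^ 3 * |u - μ| := mul_le_mul_of_nonneg_right (by linarith) (abs_nonneg _)

/-- The polynomial `nodePoly` divided by all node factors but one. -/
theorem nodePoly_eval_eq_mul {q : ℕ} {μ a : ℕ → ℝ} {p : ℕ} (hp : p ∈ Finset.Icc 1 (q + 1)) {z : ℝ}
    (hz : ∀ l ∈ Finset.Icc 1 (q + 1), l ≠ p → z - μ l ≠ 0) :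
    (nodePoly q μ a).eval z = (∏ j ∈ (Finset.Icc 1 (q + 1)).erase p, (z - μ j)) *
      ∑ l ∈ Finset.Icc 1 (q + 1), a l * (if l = p then 1 else (z - μ p) / (z - μ l)) := by
  rw [nodePoly_eval, Finset.mul_sum]
  refine Finset.sum_congr rfl fun l hl => ?_
  split_ifs with h
  · rw [h]; ring
  · have h1 := Finset.mul_prod_erase _ (fun j => z - μ j) hl
    have h2 := Finset.mul_prod_erase _ (fun j => z - μ j) hp
    have h3 := hz l hl h
    rw [← h2] at h1
    field_simp
    linear_combination (a l) * h1

/-- With $u=-(L_n/L_{n+1})(1+e)$ the reduced numerator tends to $L_{n+1}+L_n/u=L_{n+1}\,e/(1+e)$,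
which changes sign at `e = 0`. The error is at most `E / ξ`, so the sign change persists on an
interval of length of order $\xi^{-1}$. In `E` the first term comes from the `q + 1` node weights,
and `C * (1 + 2 * ρ)` from replacing the two partial sums by `L`. -/
theorem exists_root_near {q n : ℕ} (hn : n ∈ Finset.Icc 1 (q - 1)) {ξ C m ρ E : ℝ} {a L : ℕ → ℝ}
    (hm : 0 < m) (hρ : 1 ≤ ρ) (hC : C = ρ * m)
    (hE : E = (q + 1) * C * (24 * ρ ^ 3) + C * (1 + 2 * ρ))
    (hξ : 4 * ρ ≤ ξ) (hξE : 4 * E ≤ m * ξ)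
    (ha : ∀ l ∈ Finset.Icc 1 (q + 1), |a l| ≤ C)
    (hs : ∀ n ∈ Finset.Icc 1 q, |∑ l ∈ Finset.Icc 1 n, a l - L n| ≤ C / ξ)
    (hL : ∀ n ∈ Finset.Icc 1 q, m ≤ |L n| ∧ |L n| ≤ C) :
    ∃ e : ℝ, |e| ≤ 2 * E / m / ξ ∧ |e| ≤ 1 / 2 ∧ (nodePoly q (lam ξ) a).eval
      (-(L n / L (n + 1)) * ξ ^ (2 * (n - 1)) * (1 + e)) = 0 := by
  rw [Finset.mem_Icc] at hn
  have hξ0 : 0 < ξ := by linarith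
  have hC0 : 0 < C := by rw [hC]; positivity
  have hE0 : 0 < E := by rw [hE]; positivity
  obtain ⟨hL1, hL1'⟩ := hL n (Finset.mem_Icc.2 (by omega))
  obtain ⟨hL2, hL2'⟩ := hL (n + 1) (Finset.mem_Icc.2 (by omega))
  have hs1 := hs n (Finset.mem_Icc.2 (by omega))
  have hs2 := hs (n + 1) (Finset.mem_Icc.2 (by omega))
  have hn0 : L n ≠ 0 := abs_pos.1 (by linarith)
  have hn0' : L (n + 1) ≠ 0 := abs_pos.1 (by linarith)
  set y := -(L n / L (n + 1)) with hy
  have hyabs : |y| = |L n| / |L (n + 1)| := by rw [hy, abs_neg, abs_div]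
  have hy1 : |y| ≤ ρ := by
    rw [hyabs, div_le_iff₀ (by linarith)]
    nlinarith
  have hy2 : 1 ≤ ρ * |y| := by
    rw [hyabs, ← mul_div_assoc, one_le_div (by linarith)]
    nlinarith
  -- After division by `L (n + 1)` the error is at most `η / 2`, while `e / (1 + e)` at `e = ±η` has
  -- modulus at least `η / 2`.
  set η := 2 * E / m / ξ with hη
  have hη0 : 0 < η := by rw [hη]; positivity
  have hη1 : η ≤ 1 / 2 := by
    rw [hη, div_div, div_le_iff₀ (by positivity)]; linarith
  have hp : n + 1 ∈ Finset.Icc 1 (q + 1) := Finset.mem_Icc.2 (by omega)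
  -- the values at the points `u = y (1 + e)`
  have hu : ∀ e ∈ Set.Icc (-η) η, 1 ≤ 2 * ρ * |y * (1 + e)| ∧ |y * (1 + e)| ≤ 2 * ρ ∧
      0 < 1 + e := by
    intro e he
    have h1 : 1 / 2 ≤ 1 + e := by linarith [he.1]
    have h2 : 1 + e ≤ 2 := by linarith [he.2]
    rw [abs_mul, abs_of_pos (show 0 < 1 + e by linarith)]
    refine ⟨?_, ?_, by linarith⟩
    · nlinarith [mul_le_mul_of_nonneg_left h1 (show 0 ≤ 2 * ρ * |y| by positivity)]
    · nlinarith [mul_le_mul hy1 h2 (by linarith) (by linarith)]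
  let w : ℝ → ℕ → ℝ := fun e l => if l = n + 1 then 1 else
    (y * (1 + e) * ξ ^ (2 * (n - 1)) - lam ξ (n + 1)) / (y * (1 + e) * ξ ^ (2 * (n - 1)) - lam ξ l)
  let H : ℝ → ℝ := fun e => ∑ l ∈ Finset.Icc 1 (q + 1), a l * w e l
  have hden : ∀ e ∈ Set.Icc (-η) η, ∀ l ∈ Finset.Icc 1 (q + 1), l ≠ n + 1 →
      y * (1 + e) * ξ ^ (2 * (n - 1)) - lam ξ l ≠ 0 := fun e he l hl hne =>
    (node_weight_estimate hρ hξ (hu e he).1 (hu e he).2.1 hn.1 (Finset.mem_Icc.1 hl).1 hne).1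
  have hHcont : ContinuousOn H (Set.Icc (-η) η) := by
    refine continuousOn_finsetSum _ fun l hl => continuousOn_const.mul ?_
    simp only [w]
    split_ifs with h
    · exact continuousOn_const
    · exact ContinuousOn.div (by fun_prop) (by fun_prop) fun e he => hden e he l hl h
  have hHest : ∀ e ∈ Set.Icc (-η) η, |H e - L (n + 1) * (e / (1 + e))| ≤ E / ξ := by
    intro e he
    obtain ⟨hu1, hu2, he1⟩ := hu e he
    set u := y * (1 + e) with hudef
    have hu0 : u ≠ 0 := by
      intro h0; rw [h0, abs_zero, mul_zero] at hu1; linarith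
    let w0 : ℕ → ℝ := fun l => if l = n + 1 then 1 else if l ≤ n then (u + 1) / u else 0
    have hw : ∀ l ∈ Finset.Icc 1 (q + 1), |w e l - w0 l| ≤ 24 * ρ ^ 3 / ξ := by
      intro l hl
      simp only [w, w0]
      by_cases h : l = n + 1
      · simp only [if_pos h, sub_self, abs_zero]; positivity
      · simp only [if_neg h]
        exact (node_weight_estimate hρ hξ hu1 hu2 hn.1 (Finset.mem_Icc.1 hl).1 h).2
    have h1 : |H e - ∑ l ∈ Finset.Icc 1 (q + 1), a l * w0 l| ≤
        (q + 1) * C * (24 * ρ ^ 3) / ξ := by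
      simp only [H]
      rw [← Finset.sum_sub_distrib]
      refine (Finset.abs_sum_le_sum_abs _ _).trans ?_
      have : ∀ l ∈ Finset.Icc 1 (q + 1), |a l * w e l - a l * w0 l| ≤ C * (24 * ρ ^ 3 / ξ) := by
        intro l hl
        rw [← mul_sub, abs_mul]
        exact mul_le_mul (ha l hl) (hw l hl) (abs_nonneg _) hC0.le
      refine (Finset.sum_le_card_nsmul _ _ _ this).trans (le_of_eq ?_)
      rw [Nat.card_Icc, nsmul_eq_mul]
      push_cast [Nat.add_sub_cancel]
      ring
    -- The first `n` terms carry the factor `1 + 1 / u` and term `n + 1` the factor one, so only two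
    -- partial sums remain.
    have h2 : ∑ l ∈ Finset.Icc 1 (q + 1), a l * w0 l =
        ∑ l ∈ Finset.Icc 1 (n + 1), a l + (∑ l ∈ Finset.Icc 1 n, a l) / u := by
      rw [← Finset.sum_subset (s₁ := Finset.Icc 1 (n + 1)), Finset.sum_Icc_succ_top (by omega),
        Finset.sum_Icc_succ_top (by omega)]
      · have h3 : ∀ l ∈ Finset.Icc 1 n, a l * w0 l = a l * ((u + 1) / u) := by
          intro l hl
          rw [Finset.mem_Icc] at hl
          simp only [w0]
          rw [if_neg (by omega), if_pos hl.2]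
        rw [Finset.sum_congr rfl h3, ← Finset.sum_mul]
        simp only [w0, if_true]
        field_simp
        ring
      · intro l hl
        rw [Finset.mem_Icc] at hl ⊢; omega
      · intro l hl hl'
        rw [Finset.mem_Icc] at hl hl'
        simp only [w0]
        rw [if_neg (by omega), if_neg (by omega), mul_zero]
    have h3 : L (n + 1) * (e / (1 + e)) = L (n + 1) + L n / u := by
      rw [hudef, hy]
      field_simp
      ring
    rw [h3]
    have h4 : |(∑ l ∈ Finset.Icc 1 n, a l - L n) / u| ≤ C / ξ * (2 * ρ) := by
      rw [abs_div, div_le_iff₀ (abs_pos.2 hu0)]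
      have : C / ξ * (2 * ρ) * |u| = C / ξ * (2 * ρ * |u|) := by ring
      rw [this]
      exact hs1.trans (le_mul_of_one_le_right (by positivity) hu1)
    have h5 : H e - (L (n + 1) + L n / u) =
        (H e - ∑ l ∈ Finset.Icc 1 (q + 1), a l * w0 l) +
        (∑ l ∈ Finset.Icc 1 (n + 1), a l - L (n + 1)) +
        (∑ l ∈ Finset.Icc 1 n, a l - L n) / u := by
      rw [h2]; ring
    rw [h5]
    refine (abs_add_three _ _ _).trans ((add_le_add (add_le_add h1 hs2) h4).trans (le_of_eq ?_))
    rw [hE]; ring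
  have hquot : ∀ e ∈ Set.Icc (-η) η, |H e / L (n + 1) - e / (1 + e)| ≤ η / 2 := by
    intro e he
    have h1 : H e / L (n + 1) - e / (1 + e) = (H e - L (n + 1) * (e / (1 + e))) / L (n + 1) := by
      field_simp
    rw [h1, abs_div, div_le_iff₀ (by linarith)]
    refine (hHest e he).trans ?_
    have h2 : E / ξ = η / 2 * m := by rw [hη]; field_simp
    rw [h2]
    exact mul_le_mul_of_nonneg_left hL2 (by linarith)
  have hmem1 : -η ∈ Set.Icc (-η) η := ⟨le_rfl, by linarith⟩
  have hmem2 : η ∈ Set.Icc (-η) η := ⟨by linarith, le_rfl⟩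
  have hneg : H (-η) / L (n + 1) ≤ 0 := by
    have h1 := (abs_le.1 (hquot _ hmem1)).2
    have h2 : -η / (1 + -η) ≤ -η := by
      rw [div_le_iff₀ (by linarith)]; nlinarith
    linarith
  have hpos : 0 ≤ H η / L (n + 1) := by
    have h1 := (abs_le.1 (hquot _ hmem2)).1
    have h2 : η / 2 ≤ η / (1 + η) := div_le_div_of_nonneg_left hη0.le (by linarith) (by linarith)
    linarith
  obtain ⟨e, he, he0⟩ := intermediate_value_Icc (by linarith : -η ≤ η)
    (hHcont.div_const (L (n + 1))) ⟨hneg, hpos⟩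
  have habs : |e| ≤ η := abs_le.2 he
  refine ⟨e, habs, habs.trans hη1, ?_⟩
  have hz : y * ξ ^ (2 * (n - 1)) * (1 + e) = y * (1 + e) * ξ ^ (2 * (n - 1)) := by ring
  rw [hz, nodePoly_eval_eq_mul hp (hden e he)]
  have h0 : H e = 0 := (div_eq_zero_iff.1 he0).resolve_right hn0'
  rw [show (∑ l ∈ Finset.Icc 1 (q + 1), a l * (if l = n + 1 then 1 else
    (y * (1 + e) * ξ ^ (2 * (n - 1)) - lam ξ (n + 1)) /
      (y * (1 + e) * ξ ^ (2 * (n - 1)) - lam ξ l))) = H e from rfl, h0, mul_zero]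

/-- The approximate roots lie at the scales `ξ ^ (2 * (n - 1))`, so they are distinct. The vanishing
sum of the `a l` lowers the degree to `q - 1`, and therefore there are no further roots. All
constants depend on `q`, `m` and `C` only, which gives uniformity in the time and in the wave
function. -/
theorem exists_roots {q : ℕ} (hq : 1 ≤ q) {m C : ℝ} (hm : 0 < m) (hmC : m ≤ C) :
    ∃ ξ₀ C' : ℝ, 1 ≤ ξ₀ ∧ 0 ≤ C' ∧ ∀ ξ, ξ₀ < ξ → ∀ a L : ℕ → ℝ,
      ∑ l ∈ Finset.Icc 1 (q + 1), a l = 0 →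
      (∀ l ∈ Finset.Icc 1 (q + 1), |a l| ≤ C) →
      (∀ n ∈ Finset.Icc 1 q, |∑ l ∈ Finset.Icc 1 n, a l - L n| ≤ C / ξ) →
      (∀ n ∈ Finset.Icc 1 q, m ≤ |L n| ∧ |L n| ≤ C) →
      ∃ (γ : ℕ → ℝ) (R : ℝ), R ≠ 0 ∧
        (∀ z, (nodePoly q (lam ξ) a).eval z = R * ∏ n ∈ Finset.Icc 1 (q - 1), (z - γ n)) ∧
        ∀ n ∈ Finset.Icc 1 (q - 1), ∃ e : ℝ, |e| ≤ C' / ξ ∧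
          γ n = -(L n / L (n + 1)) * ξ ^ (2 * (n - 1)) * (1 + e) := by
  set ρ := C / m with hρdef
  have hρ : 1 ≤ ρ := (one_le_div hm).2 hmC
  have hC : C = ρ * m := by rw [hρdef]; field_simp
  have hC0 : 0 < C := by linarith
  set E := (q + 1) * C * (24 * ρ ^ 3) + C * (1 + 2 * ρ) with hE
  have hE0 : 0 < E := by rw [hE]; positivity
  -- The three terms serve to separate the moduli of the roots, to make the sign-change interval
  -- short, and to keep `a 1` away from zero.
  refine ⟨4 * ρ ^ 2 + 4 * E / m + C / m, 2 * E / m, ?_, by positivity, ?_⟩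
  · have : 0 ≤ 4 * E / m := by positivity
    have : 0 ≤ C / m := by positivity
    nlinarith
  intro ξ hξ a L hsum ha hs hL
  have p1 : 0 < 4 * E / m := by positivity
  have p2 : 0 < C / m := by positivity
  have p3 : ρ ≤ ρ ^ 2 := le_self_pow₀ hρ (by norm_num)
  have hξ1 : 4 * ρ ≤ ξ := by linarith
  have hξ2 : 4 * E ≤ m * ξ := by
    have : 4 * E / m ≤ ξ := by nlinarith
    rw [div_le_iff₀ hm] at this; linarith
  have hξ3 : 4 * ρ ^ 2 < ξ := by linarith
  have hξ4 : C < m * ξ := by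
    have : C / m < ξ := by nlinarith
    rw [div_lt_iff₀ hm] at this; linarith
  have hξ0 : 0 < ξ := by linarith
  have hex := fun n (hn : n ∈ Finset.Icc 1 (q - 1)) =>
    exists_root_near hn hm hρ hC hE hξ1 hξ2 ha hs hL
  choose! e he1 he2 he3 using hex
  set γ : ℕ → ℝ := fun n => -(L n / L (n + 1)) * ξ ^ (2 * (n - 1)) * (1 + e n) with hγ
  have hbound : ∀ n ∈ Finset.Icc 1 (q - 1), |γ n| ≤ 2 * ρ * ξ ^ (2 * (n - 1)) ∧
      ξ ^ (2 * (n - 1)) ≤ 2 * ρ * |γ n| := by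
    intro n hn
    have hn' := Finset.mem_Icc.1 hn
    obtain ⟨hL1, hL1'⟩ := hL n (Finset.mem_Icc.2 (by omega))
    obtain ⟨hL2, hL2'⟩ := hL (n + 1) (Finset.mem_Icc.2 (by omega))
    have h1 := abs_le.1 (he2 n hn)
    have hX : 0 < ξ ^ (2 * (n - 1)) := pow_pos hξ0 _
    simp only [hγ]
    rw [abs_mul, abs_mul, abs_neg, abs_div, abs_of_pos hX,
      abs_of_pos (show 0 < 1 + e n by linarith)]
    have hy1 : |L n| / |L (n + 1)| ≤ ρ := by
      rw [div_le_iff₀ (by linarith)]; nlinarith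
    have hy2 : 1 ≤ ρ * (|L n| / |L (n + 1)|) := by
      rw [← mul_div_assoc, one_le_div (by linarith)]; nlinarith
    set Y := |L n| / |L (n + 1)| with hY
    have hY0 : 0 ≤ Y := by positivity
    constructor
    · have : Y * (1 + e n) ≤ ρ * 2 := mul_le_mul hy1 (by linarith) (by linarith) (by linarith)
      nlinarith
    · have : 1 ≤ 2 * ρ * Y * (1 + e n) := by
        nlinarith [mul_le_mul_of_nonneg_left (show 1 / 2 ≤ 1 + e n by linarith)
          (show 0 ≤ 2 * ρ * Y by positivity)]
      nlinarith
  have hlt : ∀ i ∈ Finset.Icc 1 (q - 1), ∀ j ∈ Finset.Icc 1 (q - 1), i < j → |γ i| < |γ j| := by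
    intro i hi j hj hij
    have h1 := (hbound i hi).1
    have h2 := (hbound j hj).2
    rw [Finset.mem_Icc] at hi hj
    have h3 : ξ ^ (2 * (i - 1)) * ξ ≤ ξ ^ (2 * (j - 1)) := by
      rw [← pow_succ]; exact pow_le_pow_right₀ (by linarith) (by omega)
    have hX : 0 < ξ ^ (2 * (i - 1)) := pow_pos hξ0 _
    have h4 : 2 * ρ * |γ i| < 2 * ρ * |γ j| := by
      calc 2 * ρ * |γ i| ≤ 2 * ρ * (2 * ρ * ξ ^ (2 * (i - 1))) :=
            mul_le_mul_of_nonneg_left h1 (by linarith)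
        _ = ξ ^ (2 * (i - 1)) * (4 * ρ ^ 2) := by ring
        _ < ξ ^ (2 * (i - 1)) * ξ := mul_lt_mul_of_pos_left hξ3 hX
        _ ≤ _ := h3.trans h2
    exact lt_of_mul_lt_mul_left h4 (by linarith)
  have hinj : Set.InjOn γ (Finset.Icc 1 (q - 1)) := by
    intro i hi j hj hij
    by_contra hne
    rcases lt_or_gt_of_ne hne with h | h
    · exact absurd (congr_arg abs hij) (hlt i hi j hj h).ne
    · exact absurd (congr_arg abs hij) (hlt j hj i hi h).ne'
  have hdeg : (nodePoly q (lam ξ) a).natDegree ≤ q - 1 := by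
    refine Polynomial.natDegree_le_iff_coeff_eq_zero.2 fun k hk => ?_
    rcases (show q ≤ k by omega).eq_or_lt with rfl | h
    · rw [nodePoly_coeff, hsum]
    · exact Polynomial.coeff_eq_zero_of_natDegree_lt ((nodePoly_natDegree_le _ _ _).trans_lt h)
  have hfac := eval_eq_of_roots hdeg hinj he3
  refine ⟨γ, _, fun hR => ?_, hfac, fun n hn => ⟨e n, he1 n hn, rfl⟩⟩
  have h1 : 1 ∈ Finset.Icc 1 (q + 1) := Finset.mem_Icc.2 (by omega)
  -- If the leading factor `R` were zero, the polynomial would vanish at the first node, where its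
  -- value is `a 1` times a nonzero product.
  have h2 := hfac (lam ξ 1)
  rw [hR, zero_mul, nodePoly_eval_node _ _ _ h1] at h2
  have hξ5 : 1 < ξ := by linarith
  rcases mul_eq_zero.1 h2 with h3 | h3
  · have h4 := hs 1 (Finset.mem_Icc.2 ⟨le_rfl, hq⟩)
    have h5 := (hL 1 (Finset.mem_Icc.2 ⟨le_rfl, hq⟩)).1
    rw [Finset.Icc_self, Finset.sum_singleton, h3, zero_sub, abs_neg] at h4
    have h6 := h5.trans h4
    rw [le_div_iff₀ hξ0] at h6
    linarith
  · have h4 := node_prod_sign (lam_strictAnti hξ5 (q + 1)) h1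
    rw [h3, mul_zero] at h4
    exact lt_irrefl _ h4

end Roots

/-! ### Leading order of the zeros -/

section Zeros

variable {N M J : ℕ} [NeZero J]

/-- `D e^{θ_j}`. -/
def darbouxExp (A : Matrix (Fin N) (Fin M) ℝ) (k : Fin M → ℝ) (t : Fin J → ℝ) (j : ℕ) : ℝ :=
  darbouxPoly A k t (phase k j) * Real.exp (theta (phase k j) t)

theorem darboux_expSum' (A : Matrix (Fin N) (Fin M) ℝ) (k : Fin M → ℝ) (c : ℕ → ℝ)
    (t : Fin J → ℝ) : darboux A k (expSum c k) t =
      ∑ j ∈ Finset.Icc 1 M, c j * darbouxExp A k t j := by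
  rw [darboux_expSum]
  exact Finset.sum_congr rfl fun j _ => mul_assoc _ _ _

theorem sum_entry_mul_darbouxExp {A : Matrix (Fin N) (Fin M) ℝ} (hA : IsNormalizedBanded A)
    (hNM : N ≤ M) {k : Fin M → ℝ} (hk : StrictMono k) (t : Fin J → ℝ) {i : ℕ}
    (hi : i ∈ Finset.Icc 1 N) : ∑ j ∈ Finset.Icc 1 M, entry A i j * darbouxExp A k t j = 0 := by
  rw [← darboux_expSum', ← heat_eq_expSum, darboux_heat hA hNM hk t hi]

theorem leadingSum_eq (A : Matrix (Fin N) (Fin M) ℝ) (k : Fin M → ℝ) (t : Fin J → ℝ) {r n : ℕ}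
    (h : N - r + n ≤ M) : leadingSum A k r n t =
      ∑ j ∈ Finset.Icc 1 M, partialCoeff A r n j * darbouxExp A k t j := by
  unfold partialCoeff leadingSum darbouxExp
  simp only [ite_mul, zero_mul]
  rw [Finset.sum_ite_mem, Finset.inter_eq_right.2]
  · exact Finset.sum_congr rfl fun j _ => mul_assoc _ _ _
  · intro s; simp only [Finset.mem_Icc]; omega

theorem continuous_darbouxExp {A : Matrix (Fin N) (Fin M) ℝ} (hA : IsNormalizedBanded A)
    (hNM : N ≤ M) {k : Fin M → ℝ} (hk : StrictMono k) (j : ℕ) :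
    Continuous fun t : Fin J → ℝ => darbouxExp A k t j := by
  refine Continuous.mul (continuous_iff_continuousAt.2 fun t => ?_)
    (Real.continuous_exp.comp (continuous_theta continuous_const continuous_id))
  have h := continuousAt_darbouxPoly hA hNM hk t j
  exact h.comp (f := fun t : Fin J → ℝ => (k, t)) (Continuous.prodMk_right k).continuousAt

theorem continuous_leadingSum {A : Matrix (Fin N) (Fin M) ℝ} (hA : IsNormalizedBanded A)
    (hNM : N ≤ M) {k : Fin M → ℝ} (hk : StrictMono k) (r n : ℕ) :
    Continuous fun t : Fin J → ℝ => leadingSum A k r n t :=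
  continuous_iff_continuousAt.2 fun t => (continuousAt_leadingSum hA hNM hk t r n).comp
    (f := fun t : Fin J → ℝ => (k, t)) (Continuous.prodMk_right k).continuousAt

theorem IsVacuum.DV_eq {A : Matrix (Fin N) (Fin M) ℝ} {ξ : ℝ} {d : VacuumData}
    {k : Fin M → ℝ} (hd : IsVacuum (J := J) A k ξ d) (h : IsAdmissible A ξ)
    (hNM : N ≤ M) (hk : StrictMono k) {r : ℕ} (hr : r ∈ Finset.Icc 1 N) {l : ℕ}
    (hl : l ∈ Finset.Icc 1 (M - N + 1)) (t : Fin J → ℝ) :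
    DV A k ξ d r l t = ∑ j ∈ Finset.Icc 1 M, canV A ξ r l j * darbouxExp A k t j := by
  rw [DV, funext ((hd.eq_can h hNM hk hr).1 l hl), darboux_expSum']

theorem IsVacuum.DPsi_eq {A : Matrix (Fin N) (Fin M) ℝ} {ξ : ℝ} {d : VacuumData}
    {k : Fin M → ℝ} (hd : IsVacuum (J := J) A k ξ d) (h : IsAdmissible A ξ)
    (hNM : N ≤ M) (hk : StrictMono k) {r : ℕ} (hr : r ∈ Finset.Icc 1 N) (z : ℝ) (t : Fin J → ℝ) :
    DPsi A k ξ d r z t = (nodePoly (M - N) (lam ξ) fun l => canB A ξ r l *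
      ∑ j ∈ Finset.Icc 1 M, canV A ξ r l j * darbouxExp A k t j).eval z /
        ∏ i ∈ Finset.Icc 1 (M - N), (z - d.b r i) := by
  obtain ⟨hv, hB⟩ := hd.eq_can h hNM hk hr
  have h1 : vacuum N k ξ d r z = expSum (J := J) (fun j => ∑ l ∈ Finset.Icc 1 (M - N + 1),
      (canB A ξ r l * ((∏ j ∈ (Finset.Icc 1 (M - N + 1)).erase l, (z - lam ξ j)) /
        ∏ i ∈ Finset.Icc 1 (M - N), (z - d.b r i))) * canV A ξ r l j) k := by
    funext t
    rw [vacuum_eq N k ξ d (Finset.mem_Icc.1 hr).1, ← sum_mul_expSum]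
    exact Finset.sum_congr rfl fun l hl => by rw [hv l hl, hB l hl]
  rw [DPsi, h1, darboux_expSum', nodePoly_eval, Finset.sum_div]
  simp only [Finset.sum_mul, Finset.mul_sum, Finset.sum_div]
  rw [Finset.sum_comm]
  exact Finset.sum_congr rfl fun l _ => Finset.sum_congr rfl fun j _ => by ring

/-- This is the value of $D\Psi^{(r)}$ at infinity: the limit of $\Psi^{(r)}$ is a combination of
the $f_i$, which $D$ annihilates. -/
theorem IsAdmissible.sum_mul_darboux {A : Matrix (Fin N) (Fin M) ℝ} {ξ : ℝ}
    (h : IsAdmissible A ξ) (hA : IsNormalizedBanded A) (hNM : N ≤ M) {k : Fin M → ℝ}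
    (hk : StrictMono k) {r : ℕ} (hr : r ∈ Finset.Icc 1 N) (t : Fin J → ℝ) :
    ∑ l ∈ Finset.Icc 1 (M - N + 1), canB A ξ r l *
      ∑ j ∈ Finset.Icc 1 M, canV A ξ r l j * darbouxExp A k t j = 0 := by
  have hr' := Finset.mem_Icc.1 hr
  simp only [Finset.mul_sum, ← mul_assoc]
  rw [Finset.sum_comm]
  simp only [← Finset.sum_mul]
  rw [Finset.sum_congr rfl fun j hj => by rw [h.sum_canB_mul_canV hA hNM hr hj]]
  simp only [div_mul_eq_mul_div, add_mul, ← Finset.sum_div, Finset.sum_add_distrib, Finset.sum_mul]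
  rw [sum_entry_mul_darbouxExp hA hNM hk t (Finset.mem_Icc.2 (by omega)), Finset.sum_comm,
    Finset.sum_eq_zero, add_zero, zero_div]
  intro i hi
  rw [Finset.mem_Icc] at hi
  simp only [mul_assoc]
  rw [← Finset.mul_sum, sum_entry_mul_darbouxExp hA hNM hk t (Finset.mem_Icc.2 (by omega)),
    mul_zero]

/-- Coefficients that are `O(ξ⁻¹)` close give combinations that are uniformly `O(ξ⁻¹)` close on
sets where the summands are bounded. -/
theorem eventually_sum_close {X : Type*} {K : Set X} {g : X → ℕ → ℝ} {G : ℝ} {s : Finset ℕ}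
    (hg : ∀ t ∈ K, ∀ j ∈ s, |g t j| ≤ G) {F : ℝ → ℕ → ℝ} {c : ℕ → ℝ}
    (hF : ∀ j ∈ s, Near (fun ξ => F ξ j) (c j)) :
    ∀ᶠ C in atTop, ∀ᶠ ξ in atTop, ∀ t ∈ K,
      |∑ j ∈ s, F ξ j * g t j - ∑ j ∈ s, c j * g t j| ≤ C / ξ := by
  have h1 : ∀ j ∈ s, ∃ C : ℝ, ∀ᶠ ξ in atTop, |F ξ j - c j| ≤ C * ξ⁻¹ := by
    intro j hj
    obtain ⟨C, hC⟩ := (hF j hj).bound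
    refine ⟨C, ?_⟩
    filter_upwards [hC, eventually_gt_atTop 0] with ξ h hξ
    rwa [Real.norm_eq_abs, Real.norm_of_nonneg (inv_pos.2 hξ).le] at h
  choose! C hC using h1
  filter_upwards [eventually_ge_atTop (∑ j ∈ s, C j * |G|)] with C' hC'
  filter_upwards [(Finset.eventually_all s).2 hC, eventually_gt_atTop 0] with ξ h hξ t ht
  rw [← Finset.sum_sub_distrib]
  have h2 : ∀ j ∈ s, |F ξ j * g t j - c j * g t j| ≤ C j * |G| * ξ⁻¹ := by
    intro j hj
    rw [← sub_mul, abs_mul, mul_right_comm]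
    exact mul_le_mul (h j hj) ((hg t ht j hj).trans (le_abs_self G)) (abs_nonneg _)
      ((abs_nonneg _).trans (h j hj))
  refine (Finset.abs_sum_le_sum_abs _ _).trans ((Finset.sum_le_sum h2).trans ?_)
  rw [← Finset.sum_mul, div_eq_mul_inv]
  exact mul_le_mul_of_nonneg_right hC' (inv_pos.2 hξ).le

/-- Transfers an asymptotic formula from the limits $L$ to nearby sums $s$. The correction is `e + a
* (1 + e) + b * ((1 + e) * (1 + a))`, with relative errors `a`, `b` at most `2 * C / m / ξ`; the
factors `2` and `4` in front of them give `12 * C / m`. -/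
theorem exists_ratio_correction {m C C' ξ L₁ L₂ s₁ s₂ e : ℝ} (hm : 0 < m) (hC : 0 ≤ C)
    (hξ : 0 < ξ) (hξC : 2 * C ≤ m * ξ) (hξC' : C' ≤ ξ) (h1 : m ≤ |L₁|) (h2 : m ≤ |L₂|)
    (hs1 : |s₁ - L₁| ≤ C / ξ) (hs2 : |s₂ - L₂| ≤ C / ξ) (he : |e| ≤ C' / ξ) :
    s₁ ≠ 0 ∧ s₂ ≠ 0 ∧ ∃ δ : ℝ, |δ| ≤ (C' + 12 * C / m) / ξ ∧
      ∀ X, -(L₁ / L₂) * X * (1 + e) = -(s₁ / s₂) * X * (1 + δ) := by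
  have hκ : C / ξ ≤ m / 2 := by rw [div_le_div_iff₀ hξ two_pos]; linarith
  have hs1' : m / 2 ≤ |s₁| := by
    have := abs_sub_abs_le_abs_sub L₁ s₁
    rw [abs_sub_comm] at this; linarith
  have hs2' : m / 2 ≤ |s₂| := by
    have := abs_sub_abs_le_abs_sub L₂ s₂
    rw [abs_sub_comm] at this; linarith
  have hs10 : s₁ ≠ 0 := abs_pos.1 (by linarith)
  have hs20 : s₂ ≠ 0 := abs_pos.1 (by linarith)
  have hL20 : L₂ ≠ 0 := abs_pos.1 (by linarith)
  refine ⟨hs10, hs20, (1 + e) * (L₁ / s₁) * (s₂ / L₂) - 1, ?_, fun X => by field_simp; ring⟩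
  set a := (L₁ - s₁) / s₁ with ha
  set b := (s₂ - L₂) / L₂ with hb
  have ha' : |a| ≤ 2 * C / m / ξ := by
    rw [ha, abs_div, div_le_iff₀ (by linarith), abs_sub_comm]
    refine hs1.trans ?_
    calc C / ξ = 2 * C / m / ξ * (m / 2) := by field_simp
      _ ≤ _ := mul_le_mul_of_nonneg_left hs1' (by positivity)
  have hb' : |b| ≤ 2 * C / m / ξ := by
    rw [hb, abs_div, div_le_iff₀ (by linarith)]
    refine hs2.trans ?_
    calc C / ξ = 2 * C / m / ξ * (m / 2) := by field_simp
      _ ≤ _ := mul_le_mul_of_nonneg_left (by linarith) (by positivity)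
  have ha1 : |a| ≤ 1 := ha'.trans (by
    rw [div_div, div_le_one (by positivity)]; linarith)
  have he1 : |e| ≤ 1 := he.trans (by rwa [div_le_one hξ])
  have h3 : (1 + e) * (L₁ / s₁) * (s₂ / L₂) - 1 = e + a * (1 + e) + b * ((1 + e) * (1 + a)) := by
    rw [ha, hb]; field_simp; ring
  have h4 : |1 + e| ≤ 2 := (abs_add_le _ _).trans (by rw [abs_one]; linarith)
  have h5 : |1 + a| ≤ 2 := (abs_add_le _ _).trans (by rw [abs_one]; linarith)
  rw [h3]
  refine (abs_add_three _ _ _).trans ?_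
  rw [abs_mul, abs_mul, abs_mul]
  have h6 : |a| * |1 + e| ≤ 2 * C / m / ξ * 2 :=
    mul_le_mul ha' h4 (abs_nonneg _) (by positivity)
  have h7 : |b| * (|1 + e| * |1 + a|) ≤ 2 * C / m / ξ * (2 * 2) :=
    mul_le_mul hb' (mul_le_mul h4 h5 (abs_nonneg _) (by norm_num)) (by positivity) (by positivity)
  calc _ ≤ C' / ξ + 2 * C / m / ξ * 2 + 2 * C / m / ξ * (2 * 2) := by linarith
    _ = (C' + 12 * C / m) / ξ := by field_simp; ring

/-- Compactness of `K` bounds the functions $De^{\theta_j}$ and keeps the $L_n$ away from zero,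
which supplies the constants of `exists_roots` for all `t ∈ K` at once. Since the vacuum data are
unique for admissible `ξ`, the constants do not depend on `d`. Partial sums formed with the exact
coefficients locate the roots; those formed with `Bhat` enter only in rewriting the first formula.
-/
theorem zeros_asymptotics {A : Matrix (Fin N) (Fin M) ℝ} (hA : IsNormalizedBanded A)
    (hNM : N < M) {k : Fin M → ℝ} (hk : StrictMono k) {r : ℕ} (hr : r ∈ Finset.Icc 1 N)
    {K : Set (Fin J → ℝ)} (hK : IsCompact K) (hgen : ∀ t ∈ K, IsGeneric A k r t) :
    ∃ ξ₀ C : ℝ, 1 ≤ ξ₀ ∧ ∀ ξ : ℝ, ξ₀ < ξ → ∀ d : VacuumData, IsVacuum (J := J) A k ξ d →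
      ∀ t ∈ K, ∃ γ : ℕ → ℝ, IsZeroDivisor A k ξ d r t γ ∧
        ∀ n ∈ Finset.Icc 1 (M - N - 1),
          partialSum A k ξ d r n t ≠ 0 ∧
          partialSum A k ξ d r (n + 1) t ≠ 0 ∧
          (∃ δ : ℝ, |δ| ≤ C / ξ ∧
            γ n = -(partialSum A k ξ d r n t / partialSum A k ξ d r (n + 1) t) *
              ξ ^ (2 * (n - 1)) * (1 + δ)) ∧
          (∃ δ : ℝ, |δ| ≤ C / ξ ∧
            γ n = -(leadingSum A k r n t / leadingSum A k r (n + 1) t) *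
              ξ ^ (2 * (n - 1)) * (1 + δ)) := by
  have hr' := Finset.mem_Icc.1 hr
  have hV := coeffAsymptotics_canV hA hNM hr
  have hB := hV.solAsymptotics hA hNM.le hr
  -- bounds on `K`
  have hGex : ∀ᶠ G in atTop, ∀ j ∈ Finset.Icc 1 M, ∀ t ∈ K, |darbouxExp A k t j| ≤ G := by
    refine (Finset.eventually_all _).2 fun j _ => ?_
    obtain ⟨C, hC⟩ := hK.exists_bound_of_continuousOn (continuous_darbouxExp hA hNM.le hk j).continuousOn
    filter_upwards [eventually_ge_atTop C] with G hG t ht using (hC t ht).trans hG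
  obtain ⟨G, hG⟩ := hGex.exists
  have hG' : ∀ t ∈ K, ∀ j ∈ Finset.Icc 1 M, |darbouxExp A k t j| ≤ G := fun t ht j hj => hG j hj t ht
  have hmex : ∀ᶠ m in 𝓝[>] (0 : ℝ), ∀ n ∈ Finset.Icc 1 (M - N), ∀ t ∈ K,
      m ≤ |leadingSum A k r n t| := by
    refine (Finset.eventually_all _).2 fun n hn => ?_
    obtain ⟨m, hm, hm'⟩ := hK.exists_forall_le'
      (continuous_leadingSum hA hNM.le hk r n).abs.continuousOn (a := 0)
      fun t ht => abs_pos.2 (hgen t ht n hn)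
    filter_upwards [Ioo_mem_nhdsGT hm] with x hx t ht using hx.2.le.trans (hm' t ht)
  obtain ⟨m, hm, hm0⟩ := (hmex.and self_mem_nhdsWithin).exists
  have hCL : ∀ᶠ C in atTop, ∀ n ∈ Finset.Icc 1 (M - N), ∀ t ∈ K, |leadingSum A k r n t| ≤ C := by
    refine (Finset.eventually_all _).2 fun n _ => ?_
    obtain ⟨C, hC⟩ := hK.exists_bound_of_continuousOn (continuous_leadingSum hA hNM.le hk r n).continuousOn
    filter_upwards [eventually_ge_atTop C] with C' hC' t ht using (hC t ht).trans hC'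
  -- closeness
  have hnearV : ∀ l ∈ Finset.Icc 1 (M - N + 1), ∀ j,
      Near (fun ξ => canB A ξ r l * canV A ξ r l j) (Bhat A r l * limitCoeff A r l j) :=
    fun l hl j => (hB.near l hl).mul (hV.near l hl j)
  have hsub : ∀ n ∈ Finset.Icc 1 (M - N), ∀ l ∈ Finset.Icc 1 n, l ∈ Finset.Icc 1 (M - N + 1) := by
    intro n hn l hl
    rw [Finset.mem_Icc] at *; omega
  have hclose1 : ∀ᶠ C in atTop, ∀ n ∈ Finset.Icc 1 (M - N), ∀ᶠ ξ in atTop, ∀ t ∈ K,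
      |∑ l ∈ Finset.Icc 1 n, canB A ξ r l *
        ∑ j ∈ Finset.Icc 1 M, canV A ξ r l j * darbouxExp A k t j - leadingSum A k r n t| ≤ C / ξ := by
    refine (Finset.eventually_all _).2 fun n hn => ?_
    have hn' := Finset.mem_Icc.1 hn
    have h := eventually_sum_close hG' (F := fun ξ j => ∑ l ∈ Finset.Icc 1 n,
      canB A ξ r l * canV A ξ r l j) (c := partialCoeff A r n) fun j _ => by
        rw [← hA.sum_Bhat_mul_limitCoeff hNM.le hr j (by omega)]
        exact near_sum _ fun l hl => hnearV l (hsub n hn l hl) j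
    filter_upwards [h] with C hC
    filter_upwards [hC] with ξ hξ t ht
    rw [leadingSum_eq A k t (by omega)]
    convert hξ t ht using 3
    simp only [Finset.mul_sum, Finset.sum_mul]
    rw [Finset.sum_comm]
    exact Finset.sum_congr rfl fun j _ => Finset.sum_congr rfl fun l _ => by ring
  have hclose2 : ∀ᶠ C in atTop, ∀ n ∈ Finset.Icc 1 (M - N), ∀ᶠ ξ in atTop, ∀ t ∈ K,
      |∑ l ∈ Finset.Icc 1 n, Bhat A r l *
        ∑ j ∈ Finset.Icc 1 M, canV A ξ r l j * darbouxExp A k t j - leadingSum A k r n t| ≤ C / ξ := by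
    refine (Finset.eventually_all _).2 fun n hn => ?_
    have hn' := Finset.mem_Icc.1 hn
    have h := eventually_sum_close hG' (F := fun ξ j => ∑ l ∈ Finset.Icc 1 n,
      Bhat A r l * canV A ξ r l j) (c := partialCoeff A r n) fun j _ => by
        rw [← hA.sum_Bhat_mul_limitCoeff hNM.le hr j (by omega)]
        exact near_sum _ fun l hl => (near_const _).mul (hV.near l (hsub n hn l hl) j)
    filter_upwards [h] with C hC
    filter_upwards [hC] with ξ hξ t ht
    rw [leadingSum_eq A k t (by omega)]
    convert hξ t ht using 3
    simp only [Finset.mul_sum, Finset.sum_mul]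
    rw [Finset.sum_comm]
    exact Finset.sum_congr rfl fun j _ => Finset.sum_congr rfl fun l _ => by ring
  have habs : ∀ᶠ C in atTop, ∀ l ∈ Finset.Icc 1 (M - N + 1), ∀ᶠ ξ in atTop, ∀ t ∈ K,
      |canB A ξ r l * ∑ j ∈ Finset.Icc 1 M, canV A ξ r l j * darbouxExp A k t j| ≤ C := by
    refine (Finset.eventually_all _).2 fun l hl => ?_
    obtain ⟨C, hC⟩ := (eventually_sum_close hG' (F := fun ξ j => canB A ξ r l * canV A ξ r l j)
      (c := fun j => Bhat A r l * limitCoeff A r l j) fun j _ => hnearV l hl j).exists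
    filter_upwards [eventually_ge_atTop
      (1 + ∑ j ∈ Finset.Icc 1 M, |Bhat A r l * limitCoeff A r l j| * G)] with C' hC'
    filter_upwards [hC, eventually_gt_atTop 0, eventually_ge_atTop C] with ξ hξ hξ0 hξC t ht
    have h1 := hξ t ht
    have h2 : C / ξ ≤ 1 := (div_le_one hξ0).2 hξC
    have h3 : |∑ j ∈ Finset.Icc 1 M, Bhat A r l * limitCoeff A r l j * darbouxExp A k t j| ≤
        ∑ j ∈ Finset.Icc 1 M, |Bhat A r l * limitCoeff A r l j| * G := by
      refine (Finset.abs_sum_le_sum_abs _ _).trans (Finset.sum_le_sum fun j hj => ?_)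
      rw [abs_mul]
      exact mul_le_mul_of_nonneg_left (hG' t ht j hj) (abs_nonneg _)
    have h4 : canB A ξ r l * ∑ j ∈ Finset.Icc 1 M, canV A ξ r l j * darbouxExp A k t j =
        ∑ j ∈ Finset.Icc 1 M, canB A ξ r l * canV A ξ r l j * darbouxExp A k t j := by
      rw [Finset.mul_sum]
      exact Finset.sum_congr rfl fun j _ => by ring
    rw [h4]
    have h5 := abs_sub_abs_le_abs_sub
      (∑ j ∈ Finset.Icc 1 M, canB A ξ r l * canV A ξ r l j * darbouxExp A k t j)
      (∑ j ∈ Finset.Icc 1 M, Bhat A r l * limitCoeff A r l j * darbouxExp A k t j)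
    linarith
  obtain ⟨C, hCm, hCL, hc1, hc2, hCa⟩ := ((eventually_ge_atTop m).and
    (hCL.and (hclose1.and (hclose2.and habs)))).exists
  have hC0 : 0 < C := by linarith
  obtain ⟨ξ₁, C', hξ₁, hC', hroots⟩ := exists_roots (q := M - N) (by omega) hm0 hCm
  have hev : ∀ᶠ ξ in atTop, IsAdmissible A ξ ∧ ξ₁ < ξ ∧ 2 * C ≤ m * ξ ∧ C' ≤ ξ ∧
      (∀ n ∈ Finset.Icc 1 (M - N), ∀ t ∈ K, |∑ l ∈ Finset.Icc 1 n, canB A ξ r l *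
        ∑ j ∈ Finset.Icc 1 M, canV A ξ r l j * darbouxExp A k t j - leadingSum A k r n t| ≤ C / ξ) ∧
      (∀ n ∈ Finset.Icc 1 (M - N), ∀ t ∈ K, |∑ l ∈ Finset.Icc 1 n, Bhat A r l *
        ∑ j ∈ Finset.Icc 1 M, canV A ξ r l j * darbouxExp A k t j - leadingSum A k r n t| ≤ C / ξ) ∧
      ∀ l ∈ Finset.Icc 1 (M - N + 1), ∀ t ∈ K,
        |canB A ξ r l * ∑ j ∈ Finset.Icc 1 M, canV A ξ r l j * darbouxExp A k t j| ≤ C :=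
    (eventually_isAdmissible hA hNM).and ((eventually_gt_atTop ξ₁).and
      (((tendsto_id.const_mul_atTop hm0).eventually_ge_atTop _).and
      ((eventually_ge_atTop C').and (((Finset.eventually_all _).2 hc1).and
      (((Finset.eventually_all _).2 hc2).and ((Finset.eventually_all _).2 hCa))))))
  obtain ⟨ξ₂, hξ₂⟩ := eventually_atTop.1 hev
  refine ⟨max 1 ξ₂, C' + 12 * C / m, le_max_left _ _, fun ξ hξ d hd t ht => ?_⟩
  obtain ⟨hadm, hξ1, hξC, hξC', h1, h2, h3⟩ := hξ₂ ξ ((le_max_right _ _).trans hξ.le)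
  have hξ0 : 0 < ξ := by linarith [hadm.one_lt]
  obtain ⟨γ, R, hR, hfac, hγ⟩ := hroots ξ hξ1 (fun l => canB A ξ r l *
      ∑ j ∈ Finset.Icc 1 M, canV A ξ r l j * darbouxExp A k t j)
    (fun n => leadingSum A k r n t) (hadm.sum_mul_darboux hA hNM.le hk hr t)
    (fun l hl => h3 l hl t ht) (fun n hn => h1 n hn t ht)
    (fun n hn => ⟨hm n hn t ht, hCL n hn t ht⟩)
  have hps : ∀ n ∈ Finset.Icc 1 (M - N), partialSum A k ξ d r n t = ∑ l ∈ Finset.Icc 1 n,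
      Bhat A r l * ∑ j ∈ Finset.Icc 1 M, canV A ξ r l j * darbouxExp A k t j := fun n hn =>
    Finset.sum_congr rfl fun l hl => by rw [hd.DV_eq hadm hNM.le hk hr (hsub n hn l hl)]
  refine ⟨γ, ⟨R, hR, fun z _ => ?_⟩, fun n hn => ?_⟩
  · rw [hd.DPsi_eq hadm hNM.le hk hr, hfac]
  · have hn' := Finset.mem_Icc.1 hn
    have hn1 : n ∈ Finset.Icc 1 (M - N) := Finset.mem_Icc.2 (by omega)
    have hn2 : n + 1 ∈ Finset.Icc 1 (M - N) := Finset.mem_Icc.2 (by omega)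
    obtain ⟨e, he, hγe⟩ := hγ n hn
    obtain ⟨hs1, hs2, δ, hδ, hδe⟩ := exists_ratio_correction (C := C) hm0 hC0.le hξ0 hξC hξC'
      (hm n hn1 t ht) (hm (n + 1) hn2 t ht) (h2 n hn1 t ht) (h2 (n + 1) hn2 t ht) he
    rw [hps n hn1, hps (n + 1) hn2]
    refine ⟨hs1, hs2, ⟨δ, hδ, by rw [hγe, hδe]⟩, ⟨e, he.trans ?_, hγe⟩⟩
    refine div_le_div_of_nonneg_right ?_ hξ0.le
    have : 0 ≤ 12 * C / m := by positivity
    linarith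

end Zeros

/-! ### Genericity -/

section Generic

variable {N M J : ℕ}

theorem IsNormalizedBanded.eq_zero_of_sum_eq_zero {A : Matrix (Fin N) (Fin M) ℝ}
    (hA : IsNormalizedBanded A) {c : Fin N → Fin M} (hc : StrictMono c) {a : Fin N → ℝ}
    (h : ∀ q, ∑ i, a i * A i (c q) = 0) : a = 0 :=
  Matrix.eq_zero_of_vecMul_eq_zero (hA.maximal_minors c hc).ne' (funext h)

/-- The support has at most `n ≤ M - N` columns, so at least `N` columns remain outside; a
combination of the rows vanishing on these must be trivial. -/
theorem exists_columns_partialCoeff_eq_zero (A : Matrix (Fin N) (Fin M) ℝ) (r : ℕ) {n : ℕ}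
    (hNM : N ≤ M) (hn : n ≤ M - N) :
    ∃ c : Fin N → Fin M, StrictMono c ∧ ∀ q, partialCoeff A r n ((c q : ℕ) + 1) = 0 := by
  classical
  set u : Finset (Fin M) :=
    Finset.univ.filter fun j => (j : ℕ) + 1 ∈ Finset.Icc (N - r + 1) (N - r + n)
  have hu : u.card ≤ n := by
    have h : (u.image fun j : Fin M => (j : ℕ) + 1).card = u.card :=
      Finset.card_image_of_injective _ fun i j hij => Fin.ext (by simpa using hij)
    rw [← h]
    refine (Finset.card_le_card (t := Finset.Icc (N - r + 1) (N - r + n)) ?_).trans ?_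
    · intro j hj
      obtain ⟨i, hi, rfl⟩ := Finset.mem_image.1 hj
      exact (Finset.mem_filter.1 hi).2
    · simp only [Nat.card_Icc]; omega
  have hcard : N ≤ uᶜ.card := by
    rw [Finset.card_compl, Fintype.card_fin]; omega
  obtain ⟨s, hs, hsN⟩ := Finset.exists_subset_card_eq hcard
  refine ⟨s.orderEmbOfFin hsN, (s.orderEmbOfFin hsN).strictMono, fun q => ?_⟩
  have hq := Finset.mem_compl.1 (hs (s.orderEmbOfFin_mem hsN q))
  exact if_neg fun h => hq (Finset.mem_filter.2 ⟨Finset.mem_univ _, h⟩)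

theorem expSum_sub_sum (c : ℕ → ℝ) (a : Fin N → ℝ) (e : Fin N → ℕ → ℝ) (k : Fin M → ℝ)
    (t : Fin J → ℝ) : expSum (fun j => c j - ∑ i, a i * e i j) k t =
      expSum c k t - ∑ i, a i * expSum (e i) k t := by
  simp only [expSum, sub_mul, Finset.sum_sub_distrib, Finset.sum_mul, Finset.mul_sum]
  rw [Finset.sum_comm]
  simp only [mul_assoc]

variable [NeZero J]

theorem hasDerivAt_expSum_update (c : ℕ → ℝ) (k : Fin M → ℝ) (t : Fin J → ℝ) (x : ℝ) :
    HasDerivAt (fun x => expSum c k (Function.update t 0 x))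
      (expSum (fun j => c j * phase k j) k (Function.update t 0 x)) x := by
  simp only [expSum_update]
  exact hasDerivAt_sum_exp _ _ _ _ _

/-- An exponential sum whose first `N` derivatives vanish at a point and which is annihilated by
the Darboux operator to the right of that point vanishes there. -/
theorem expSum_eq_zero_of_darboux_eq_zero (hN : 1 ≤ N) {A : Matrix (Fin N) (Fin M) ℝ}
    (hA : IsNormalizedBanded A) (hNM : N ≤ M) {k : Fin M → ℝ} (hk : StrictMono k)
    {c : ℕ → ℝ} {t : Fin J → ℝ} {b : ℝ}
    (h0 : ∀ m < N, expSum (fun j => c j * phase k j ^ m) k t = 0)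
    (hD : ∀ x ∈ Set.Icc (t 0) b, darboux A k (expSum c k) (Function.update t 0 x) = 0) :
    ∀ x ∈ Set.Icc (t 0) b, expSum c k (Function.update t 0 x) = 0 := by
  let y : ℕ → ℝ → ℝ := fun m x => expSum (fun j => c j * phase k j ^ m) k (Function.update t 0 x)
  have hy : ∀ m x, HasDerivAt (y m) (y (m + 1) x) x := fun m x => by
    have h := hasDerivAt_expSum_update (fun j => c j * phase k j ^ m) k t x
    simpa only [y, pow_succ, mul_assoc] using h
  have hw : ∀ m : Fin N, ∃ C, ∀ x ∈ Set.Icc (t 0) b,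
      ‖darbouxCoeff A k (Function.update t 0 x) m‖ ≤ C := fun m => by
    refine isCompact_Icc.exists_bound_of_continuousOn (Continuous.continuousOn ?_)
    refine continuous_iff_continuousAt.2 fun x => ?_
    have h1 := (continuous_apply m).continuousAt.comp
      (continuousAt_darbouxCoeff hA hNM hk (Function.update t 0 x))
    exact h1.comp (f := fun x => (k, Function.update t 0 x))
      (Continuous.prodMk continuous_const (continuous_const.update 0 continuous_id)).continuousAt
  choose C hC using hw
  let Y : ℝ → Fin N → ℝ := fun x m => y m x
  have hY : ∀ x, HasDerivAt Y (fun m => y (m + 1) x) x := fun x =>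
    hasDerivAt_pi.2 fun m => hy m x
  have hle : ∀ x (m : ℕ), m < N → |y m x| ≤ ‖Y x‖ := fun x m hm =>
    norm_le_pi_norm (Y x) ⟨m, hm⟩
  -- The vector of the first `N` derivatives satisfies a linear first order system: the lower
  -- derivatives are shifted and the top one is expressed through $D$. Bounded coefficients then
  -- give the inequality needed for Gronwall uniqueness.
  have hbound : ∀ x ∈ Set.Ico (t 0) b,
      ‖fun m : Fin N => y (m + 1) x‖ ≤ (1 + ∑ m, |C m|) * ‖Y x‖ := fun x hx => by
    have hx' : x ∈ Set.Icc (t 0) b := ⟨hx.1, hx.2.le⟩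
    have hS : 0 ≤ ∑ m, |C m| := Finset.sum_nonneg fun _ _ => abs_nonneg _
    refine (pi_norm_le_iff_of_nonneg (by positivity)).2 fun m => ?_
    rcases Nat.lt_or_ge ((m : ℕ) + 1) N with hm | hm
    · refine (hle x _ hm).trans ?_
      nlinarith [norm_nonneg (Y x)]
    · have hmN : (m : ℕ) + 1 = N := by omega
      have h := hD x hx'
      unfold darboux at h
      simp only [dx_expSum] at h
      have h' : y N x = ∑ m : Fin N,
          darbouxCoeff A k (Function.update t 0 x) m * y (N - 1 - (m : ℕ)) x := by
        linarith
      rw [hmN, h', Real.norm_eq_abs]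
      calc _ ≤ ∑ m : Fin N, |darbouxCoeff A k (Function.update t 0 x) m *
              y (N - 1 - (m : ℕ)) x| := Finset.abs_sum_le_sum_abs _ _
        _ ≤ ∑ m : Fin N, |C m| * ‖Y x‖ := Finset.sum_le_sum fun m _ => by
            rw [abs_mul]
            exact mul_le_mul (((hC m x hx').trans (le_abs_self _))) (hle x _ (by omega))
              (abs_nonneg _) (abs_nonneg _)
        _ ≤ _ := by rw [← Finset.sum_mul]; nlinarith [norm_nonneg (Y x)]
  intro x hx
  have h := eq_zero_of_abs_deriv_le_mul_abs_self_of_eq_zero_right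
    (fun x _ => (hY x).continuousAt.continuousWithinAt)
    (fun x _ => (hY x).hasDerivWithinAt)
    (by funext m; simpa [Y, y] using h0 m m.2) hbound x hx
  have h' := congr_fun h ⟨0, hN⟩
  simpa [Y, y] using h'

/-- The kernel of the Darboux operator on exponential sums is spanned by the heat solutions. -/
theorem exists_combination_of_darboux_eq_zero (hN : 1 ≤ N) {A : Matrix (Fin N) (Fin M) ℝ}
    (hA : IsNormalizedBanded A) (hNM : N ≤ M) {k : Fin M → ℝ} (hk : StrictMono k) {c : ℕ → ℝ}
    {t : Fin J → ℝ}
    (h : ∀ᶠ x in 𝓝 (t 0), darboux A k (expSum c k) (Function.update t 0 x) = 0) :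
    ∃ a : Fin N → ℝ, ∀ j ∈ Finset.Icc 1 M, c j = ∑ i : Fin N, a i * entry A ((i : ℕ) + 1) j := by
  let β : Fin N → ℝ := fun m => dx (N - 1 - (m : ℕ)) (expSum c k) t
  -- The combination of the heat solutions with the same first `N` derivatives at `t`; the nonzero
  -- Wronskian makes it available.
  let a : Fin N → ℝ := Matrix.vecMul β (wronskian A k t)⁻¹
  have ha : Matrix.vecMul a (wronskian A k t) = β := by
    rw [Matrix.vecMul_vecMul, Matrix.nonsing_inv_mul _
      (isUnit_iff_ne_zero.2 (wronskian_det_ne_zero hA hNM hk t)), Matrix.vecMul_one]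
  let u : ℕ → ℝ := fun j => c j - ∑ i : Fin N, a i * entry A ((i : ℕ) + 1) j
  have hu0 : ∀ m < N, expSum (fun j => u j * phase k j ^ m) k t = 0 := fun m hm => by
    have h1 := congr_fun ha ⟨N - 1 - m, by omega⟩
    have h2 : N - 1 - (N - 1 - m) = m := by omega
    simp only [β, Matrix.vecMul, dotProduct, wronskian, Matrix.of_apply, h2, heat_eq_expSum,
      dx_expSum] at h1
    have h3 := expSum_sub_sum (fun j => c j * phase k j ^ m) a
      (fun i j => entry A ((i : ℕ) + 1) j * phase k j ^ m) k t
    rw [h1, sub_self] at h3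
    rw [← h3]
    congr 1
    funext j
    simp only [u, sub_mul, Finset.sum_mul, mul_assoc]
  have huD : ∀ s : Fin J → ℝ, darboux A k (expSum c k) s = 0 → darboux A k (expSum u k) s = 0 := by
    intro s hs
    rw [darboux_expSum'] at hs ⊢
    simp only [u, sub_mul, Finset.sum_sub_distrib, hs, Finset.sum_mul, mul_assoc]
    rw [Finset.sum_comm]
    simp only [← Finset.mul_sum]
    rw [Finset.sum_eq_zero, sub_zero]
    intro i _
    rw [sum_entry_mul_darbouxExp hA hNM hk s (Finset.mem_Icc.2 ⟨by omega, i.2⟩), mul_zero]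
  obtain ⟨δ, hδ, hball⟩ := Metric.eventually_nhds_iff.1 h
  have hzero := expSum_eq_zero_of_darboux_eq_zero hN hA hNM hk (c := u) (t := t)
    (b := t 0 + δ / 2) hu0 fun x hx => huD _ <| hball <| by
      rw [Real.dist_eq, abs_of_nonneg (by linarith [hx.1])]; linarith [hx.2]
  refine ⟨a, fun j hj => sub_eq_zero.1 ?_⟩
  -- Vanishing is known only to the right of `t 0`, so linear independence is applied at an interior
  -- point of that interval.
  refine expSum_eq_zero_of_eventually hk (c := u) (t := Function.update t 0 (t 0 + δ / 4)) ?_ hj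
  rw [Function.update_self]
  filter_upwards [Icc_mem_nhds (show t 0 < t 0 + δ / 4 by linarith)
    (show t 0 + δ / 4 < t 0 + δ / 2 by linarith)] with x hx
  rw [Function.update_idem]
  exact hzero x hx

/-- The leading sums do not vanish on a neighbourhood of any time. -/
theorem dense_leadingSum_ne_zero (hN : 1 ≤ N) {A : Matrix (Fin N) (Fin M) ℝ}
    (hA : IsNormalizedBanded A) (hNM : N ≤ M) {k : Fin M → ℝ} (hk : StrictMono k) {r n : ℕ}
    (hr : r ∈ Finset.Icc 1 N) (hn : n ∈ Finset.Icc 1 (M - N)) :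
    Dense {t : Fin J → ℝ | leadingSum A k r n t ≠ 0} := by
  have hr' := Finset.mem_Icc.1 hr
  have hn' := Finset.mem_Icc.1 hn
  intro t
  by_contra ht
  rw [mem_closure_iff_frequently, not_frequently] at ht
  have hcont : ContinuousAt (fun x => Function.update t 0 x) (t 0) :=
    (continuous_const.update 0 continuous_id).continuousAt
  have hev : ∀ᶠ x in 𝓝 (t 0), darboux A k (expSum (partialCoeff A r n) k)
      (Function.update t 0 x) = 0 := by
    rw [← Function.update_eq_self 0 t] at ht
    refine (hcont.eventually ht).mono fun x hx => ?_
    rw [darboux_expSum', ← leadingSum_eq A k _ (by omega)]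
    simpa using hx
  obtain ⟨a, ha⟩ := exists_combination_of_darboux_eq_zero hN hA hNM hk hev
  obtain ⟨c, hc, hc0⟩ := exists_columns_partialCoeff_eq_zero A r hNM hn'.2
  -- On the columns outside the support the combination of rows vanishes, which kills it; but the
  -- coefficients of the leading sum have positive total.
  have ha0 : a = 0 := hA.eq_zero_of_sum_eq_zero hc fun q => by
    have h := ha ((c q : ℕ) + 1) (Finset.mem_Icc.2 ⟨by omega, (c q).2⟩)
    simp only [entry_succ] at h
    rw [← h, hc0]
  have h := hA.sum_partialCoeff_pos hNM hr (n := n) (Finset.mem_Icc.2 ⟨hn'.1, by omega⟩)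
  rw [Finset.sum_eq_zero fun j hj => by rw [ha j hj, ha0]; simp] at h
  exact lt_irrefl _ h

theorem isOpen_dense_generic (hN : 1 ≤ N) {A : Matrix (Fin N) (Fin M) ℝ}
    (hA : IsNormalizedBanded A) (hNM : N ≤ M) {k : Fin M → ℝ} (hk : StrictMono k) :
    IsOpen {t : Fin J → ℝ | ∀ r ∈ Finset.Icc 1 N, IsGeneric A k r t} ∧
      Dense {t : Fin J → ℝ | ∀ r ∈ Finset.Icc 1 N, IsGeneric A k r t} := by
  have hopen : ∀ r n, IsOpen {t : Fin J → ℝ | leadingSum A k r n t ≠ 0} := fun r n =>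
    isOpen_ne.preimage (continuous_leadingSum hA hNM hk r n)
  have hset : {t : Fin J → ℝ | ∀ r ∈ Finset.Icc 1 N, IsGeneric A k r t} =
      ⋂ p ∈ Finset.Icc 1 N ×ˢ Finset.Icc 1 (M - N),
        {t : Fin J → ℝ | leadingSum A k p.1 p.2 t ≠ 0} := by
    ext t
    simp only [IsGeneric, Set.mem_ofPred_eq, Set.mem_iInter, Finset.mem_product, Prod.forall]
    exact ⟨fun h r n hrn => h r hrn.1 n hrn.2, fun h r hr n hn => h r n ⟨hr, hn⟩⟩
  rw [hset]
  refine ⟨isOpen_biInter_finset fun p _ => hopen p.1 p.2, ?_⟩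
  have h := dense_biInter_of_isOpen (S := (↑(Finset.Icc 1 N ×ˢ Finset.Icc 1 (M - N)) : Set (ℕ × ℕ)))
    (f := fun p => {t : Fin J → ℝ | leadingSum A k p.1 p.2 t ≠ 0})
    (fun p _ => hopen p.1 p.2) (Finset.countable_toSet _) fun p hp =>
      dense_leadingSum_ne_zero hN hA hNM hk (Finset.mem_product.1 hp).1 (Finset.mem_product.1 hp).2
  simpa only [Finset.mem_coe] using h

/-! ### Generic phases -/

theorem isOpen_strictMono (M : ℕ) : IsOpen {k : Fin M → ℝ | StrictMono k} := by
  have : {k : Fin M → ℝ | StrictMono k} =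
      ⋂ (i : Fin M) (j : Fin M) (_ : i < j), {k : Fin M → ℝ | k i < k j} := by
    ext k
    simp only [Set.mem_iInter, Set.mem_ofPred_eq]
    exact Iff.rfl
  rw [this]
  exact isOpen_iInter_of_finite fun i => isOpen_iInter_of_finite fun j =>
    isOpen_iInter_of_finite fun _ => isOpen_lt (continuous_apply i) (continuous_apply j)

theorem isOpen_generic_phases {A : Matrix (Fin N) (Fin M) ℝ} (hA : IsNormalizedBanded A)
    (hNM : N ≤ M) : IsOpen {k : Fin M → ℝ | StrictMono k ∧
      ∀ r ∈ Finset.Icc 1 N, IsGeneric A k r (0 : Fin J → ℝ)} := by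
  refine isOpen_iff_eventually.2 fun k hk => ?_
  refine ((isOpen_strictMono M).eventually_mem hk.1).and ?_
  refine (Filter.eventually_all_finset _).2 fun r hr => (Filter.eventually_all_finset _).2 fun n hn => ?_
  have h := (continuousAt_leadingSum hA hNM hk.1 (0 : Fin J → ℝ) r n).comp
    (f := fun k : Fin M → ℝ => (k, (0 : Fin J → ℝ))) (Continuous.prodMk_left _).continuousAt
  exact h.eventually_ne (hk.2 r hr n hn)

/-- A polynomial vanishing on a neighbourhood vanishes on a product of infinite sets, hence is zero.
-/
theorem dense_eval_ne_zero {p : MvPolynomial (Fin M) ℝ} (hp : p ≠ 0) :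
    Dense {k : Fin M → ℝ | MvPolynomial.eval k p ≠ 0} := by
  intro k
  by_contra hk
  rw [mem_closure_iff_frequently, not_frequently] at hk
  obtain ⟨δ, hδ, hball⟩ := Metric.eventually_nhds_iff.1 hk
  refine hp (MvPolynomial.funext_set (fun i => Set.Ioo (k i - δ) (k i + δ))
    (fun i => Set.Ioo_infinite (by linarith)) fun x hx => ?_)
  rw [map_zero]
  have hx' : dist x k < δ := by
    rw [dist_pi_lt_iff hδ]
    intro i
    have := hx i trivial
    rw [Real.dist_eq, abs_lt]
    constructor <;> linarith [this.1, this.2]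
  simpa using hball hx'

/-- The matrix `A` bordered by a further row `g`, multiplied with the Vandermonde matrix of `x`. -/
def borderedMat {R : Type*} [CommRing R] [Algebra ℝ R] (A : Matrix (Fin N) (Fin M) ℝ)
    (g : Fin M → ℝ) (x : Fin M → R) : Matrix (Fin (N + 1)) (Fin (N + 1)) R :=
  Matrix.of fun i m => ∑ j : Fin M,
    algebraMap ℝ R ((Fin.cons g (fun i => A i) : Fin (N + 1) → Fin M → ℝ) i j) * x j ^ (m : ℕ)

theorem eval_det_borderedMat (A : Matrix (Fin N) (Fin M) ℝ) (g : Fin M → ℝ) (k : Fin M → ℝ) :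
    MvPolynomial.eval k (borderedMat A g (MvPolynomial.X : Fin M → MvPolynomial (Fin M) ℝ)).det =
      (borderedMat A g k).det := by
  rw [RingHom.map_det]
  congr 1
  ext i m
  simp [borderedMat]

/-- The determinant is a polynomial in the phases, so any point may be used to see that it is
nonzero, ordered or not. Placing `1, …, N` on the columns where `g` vanishes and `0` elsewhere
decouples a left null vector: positive powers see only the chosen columns and kill the rows of `A`,
while the zeroth power sees the total of `g`. -/
theorem det_borderedMat_ne_zero {A : Matrix (Fin N) (Fin M) ℝ} (hA : IsNormalizedBanded A)
    {g : Fin M → ℝ} {c : Fin N → Fin M} (hc : StrictMono c) (hgc : ∀ q, g (c q) = 0)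
    (hg : ∑ j, g j ≠ 0) : ∃ k : Fin M → ℝ, (borderedMat A g k).det ≠ 0 := by
  let k : Fin M → ℝ := Function.extend c (fun q => (q : ℝ) + 1) 0
  have hkc : ∀ q, k (c q) = (q : ℝ) + 1 := fun q => hc.injective.extend_apply _ _ q
  have hk0 : ∀ j, (∀ q, c q ≠ j) → k j = 0 := fun j hj =>
    Function.extend_apply' _ _ _ fun ⟨q, hq⟩ => hj q hq
  refine ⟨k, fun hdet => ?_⟩
  obtain ⟨v, hv, hv0⟩ := Matrix.exists_vecMul_eq_zero_iff.2 hdet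
  let u : Fin M → ℝ := fun j => v 0 * g j + ∑ i : Fin N, v i.succ * A i j
  have hu : ∀ m : Fin (N + 1), ∑ j, u j * k j ^ (m : ℕ) = 0 := fun m => by
    have h := congr_fun hv0 m
    simp only [Matrix.vecMul, dotProduct, borderedMat, Matrix.of_apply, Fin.sum_univ_succ,
      Fin.cons_zero, Fin.cons_succ, Algebra.algebraMap_self, RingHom.id_apply, Pi.zero_apply,
      Finset.mul_sum] at h
    rw [Finset.sum_comm, ← Finset.sum_add_distrib] at h
    rw [← h]
    refine Finset.sum_congr rfl fun j _ => ?_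
    simp only [u, add_mul, Finset.sum_mul, mul_assoc]
  have huc : (fun q => u (c q) * ((q : ℝ) + 1)) = 0 := by
    refine Matrix.eq_zero_of_forall_pow_sum_mul_pow_eq_zero
      (f := fun q : Fin N => (q : ℝ) + 1) (fun p q hpq => Fin.ext (by simpa using hpq)) fun m => ?_
    rw [← hu m.succ, ← Finset.sum_subset (Finset.subset_univ (Finset.univ.image c)),
      Finset.sum_image fun p _ q _ h => hc.injective h]
    · refine Finset.sum_congr rfl fun q _ => ?_
      rw [hkc, Fin.val_succ, pow_succ]; ring
    · intro j _ hj
      rw [hk0 j fun q hq => hj (Finset.mem_image.2 ⟨q, Finset.mem_univ _, hq⟩)]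
      simp
  have hvA : (fun i : Fin N => v i.succ) = 0 := hA.eq_zero_of_sum_eq_zero hc fun q => by
    have h := congr_fun huc q
    simp only [Pi.zero_apply, mul_eq_zero, u, hgc, mul_zero, zero_add] at h
    exact h.resolve_right (by positivity)
  have hv1 : ∀ i : Fin N, v i.succ = 0 := fun i => congr_fun hvA i
  have hv2 : v 0 = 0 := by
    have h := hu 0
    simp only [u, hv1, zero_mul, Finset.sum_const_zero, add_zero, Fin.val_zero, pow_zero, mul_one,
      ← Finset.mul_sum] at h
    exact (mul_eq_zero.1 h).resolve_right hg
  exact hv (funext fun i => by refine Fin.cases ?_ ?_ i <;> simp [hv1, hv2])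

theorem darbouxExp_zero (A : Matrix (Fin N) (Fin M) ℝ) (k : Fin M → ℝ) (j : ℕ) :
    darbouxExp A k (0 : Fin J → ℝ) j = darbouxPoly A k (0 : Fin J → ℝ) (phase k j) := by
  simp [darbouxExp, theta]

/-- At `t = 0` the coefficient vector of $P^{(0)}$ is orthogonal to every row coming from `A`, since
$Df_i=0$. If the leading sum vanished, it would be orthogonal to the bordering row too, and hence a
null vector. -/
theorem leadingSum_ne_zero_of_det {A : Matrix (Fin N) (Fin M) ℝ} (hA : IsNormalizedBanded A)
    (hNM : N ≤ M) {k : Fin M → ℝ} (hk : StrictMono k) {r n : ℕ} (h : N - r + n ≤ M)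
    (hdet : (borderedMat A (fun j : Fin M => partialCoeff A r n ((j : ℕ) + 1)) k).det ≠ 0) :
    leadingSum A k r n (0 : Fin J → ℝ) ≠ 0 := by
  intro hL
  let w := darbouxCoeff A k (0 : Fin J → ℝ)
  -- The coefficients of $P^{(0)}$ in increasing degree; the leading coefficient one makes the
  -- vector nonzero.
  let v : Fin (N + 1) → ℝ := Fin.snoc (fun m : Fin N => -w m.rev) 1
  have hv : v ≠ 0 := fun h0 => by simpa [v] using congr_fun h0 (Fin.last N)
  have hP : ∀ z : ℝ, ∑ m : Fin (N + 1), z ^ (m : ℕ) * v m =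
      darbouxPoly A k (0 : Fin J → ℝ) z := fun z => by
    rw [Fin.sum_univ_castSucc]
    simp only [v, Fin.snoc_castSucc, Fin.snoc_last, darbouxPoly, Fin.val_castSucc, Fin.val_last]
    rw [← Equiv.sum_comp Fin.revPerm]
    simp only [Fin.revPerm_apply, Fin.rev_rev, Fin.val_rev, mul_neg, Finset.sum_neg_distrib]
    rw [mul_one, add_comm, sub_eq_add_neg]
    congr 2
    refine Finset.sum_congr rfl fun m _ => ?_
    rw [mul_comm, Nat.sub_sub, add_comm 1]
  refine hdet (Matrix.exists_mulVec_eq_zero_iff.1 ⟨v, hv, ?_⟩)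
  have key : ∀ e : ℕ → ℝ, ∑ j ∈ Finset.Icc 1 M, e j * darbouxExp A k (0 : Fin J → ℝ) j = 0 →
      ∑ m : Fin (N + 1), (∑ j : Fin M, e ((j : ℕ) + 1) * k j ^ (m : ℕ)) * v m = 0 := fun e he => by
    simp only [Finset.sum_mul]
    rw [Finset.sum_comm, ← he, sum_Icc_one_eq_sum_fin]
    refine Finset.sum_congr rfl fun j _ => ?_
    rw [darbouxExp_zero, phase_succ, ← hP, Finset.mul_sum]
    simp only [mul_assoc]
  funext i
  simp only [Matrix.mulVec, dotProduct, borderedMat, Matrix.of_apply, Pi.zero_apply,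
    Algebra.algebraMap_self, RingHom.id_apply]
  refine Fin.cases ?_ (fun i => ?_) i
  · exact key (partialCoeff A r n) (by rw [← leadingSum_eq A k _ h, hL])
  · have h := key (entry A ((i : ℕ) + 1))
      (sum_entry_mul_darbouxExp hA hNM hk _ (Finset.mem_Icc.2 ⟨by omega, i.2⟩))
    simpa only [entry_succ, Fin.cons_succ] using h

/-- The product of the bordered determinants over all sheets and all `n` is a nonzero polynomial.
Its nonvanishing set is dense, hence dense in the open set of ordered phases. -/
theorem strictMono_subset_closure_generic {A : Matrix (Fin N) (Fin M) ℝ}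
    (hA : IsNormalizedBanded A) (hNM : N ≤ M) :
    {k : Fin M → ℝ | StrictMono k} ⊆ closure {k : Fin M → ℝ | StrictMono k ∧
      ∀ r ∈ Finset.Icc 1 N, IsGeneric A k r (0 : Fin J → ℝ)} := by
  let p : MvPolynomial (Fin M) ℝ := ∏ s ∈ Finset.Icc 1 N ×ˢ Finset.Icc 1 (M - N),
    (borderedMat A (fun j : Fin M => partialCoeff A s.1 s.2 ((j : ℕ) + 1))
      (MvPolynomial.X : Fin M → MvPolynomial (Fin M) ℝ)).det
  have hp : p ≠ 0 := Finset.prod_ne_zero_iff.2 fun s hs h0 => by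
    obtain ⟨hr, hn⟩ := Finset.mem_product.1 hs
    have hn' := Finset.mem_Icc.1 hn
    obtain ⟨c, hc, hc0⟩ := exists_columns_partialCoeff_eq_zero A s.1 hNM hn'.2
    have hpos := hA.sum_partialCoeff_pos hNM hr (n := s.2) (Finset.mem_Icc.2 ⟨hn'.1, by omega⟩)
    rw [sum_Icc_one_eq_sum_fin] at hpos
    obtain ⟨k, hk⟩ := det_borderedMat_ne_zero hA hc hc0 hpos.ne'
    exact hk (by rw [← eval_det_borderedMat, h0, map_zero])
  refine ((dense_eval_ne_zero hp).open_subset_closure_inter (isOpen_strictMono M)).trans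
    (closure_mono ?_)
  rintro k ⟨hk, hkp⟩
  refine ⟨hk, fun r hr n hn => ?_⟩
  have hr' := Finset.mem_Icc.1 hr
  have hn' := Finset.mem_Icc.1 hn
  refine leadingSum_ne_zero_of_det hA hNM hk (by omega) ?_
  rw [Set.mem_ofPred_eq, map_prod] at hkp
  rw [← eval_det_borderedMat]
  exact Finset.prod_ne_zero_iff.1 hkp (r, n) (Finset.mem_product.2 ⟨hr, hn⟩)

end Generic

end KPSoliton

end
-- Assembly of the theorem
theorem mainTheorem9 {N M J : ℕ} [NeZero J] (hN : 1 ≤ N) (hNM : N < M)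
    (A : Matrix (Fin N) (Fin M) ℝ) (hA : KPSoliton.IsNormalizedBanded A) :
    (∀ k : Fin M → ℝ, StrictMono k →
      -- the construction is possible for all large `ξ`
      (∃ ξ₀ : ℝ, 1 ≤ ξ₀ ∧ ∀ ξ : ℝ, ξ₀ < ξ →
        ∃ d : KPSoliton.VacuumData, KPSoliton.IsVacuum (J := J) A k ξ d) ∧
      -- generic times form an open dense set
      (IsOpen {t : Fin J → ℝ | ∀ r ∈ Finset.Icc 1 N, KPSoliton.IsGeneric A k r t} ∧
        Dense {t : Fin J → ℝ | ∀ r ∈ Finset.Icc 1 N, KPSoliton.IsGeneric A k r t}) ∧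
      -- leading order of the zeros, uniformly on compact sets of generic times
      (∀ r ∈ Finset.Icc 1 N, ∀ K : Set (Fin J → ℝ), IsCompact K →
        (∀ t ∈ K, KPSoliton.IsGeneric A k r t) →
        ∃ ξ₀ C : ℝ, 1 ≤ ξ₀ ∧ ∀ ξ : ℝ, ξ₀ < ξ →
          ∀ d : KPSoliton.VacuumData, KPSoliton.IsVacuum (J := J) A k ξ d →
          ∀ t ∈ K, ∃ γ : ℕ → ℝ, KPSoliton.IsZeroDivisor A k ξ d r t γ ∧
            ∀ n ∈ Finset.Icc 1 (M - N - 1),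
              KPSoliton.partialSum A k ξ d r n t ≠ 0 ∧
              KPSoliton.partialSum A k ξ d r (n + 1) t ≠ 0 ∧
              (∃ δ : ℝ, |δ| ≤ C / ξ ∧
                γ n = -(KPSoliton.partialSum A k ξ d r n t /
                    KPSoliton.partialSum A k ξ d r (n + 1) t) * ξ ^ (2 * (n - 1)) * (1 + δ)) ∧
              (∃ δ : ℝ, |δ| ≤ C / ξ ∧
                γ n = -(KPSoliton.leadingSum A k r n t /
                    KPSoliton.leadingSum A k r (n + 1) t) * ξ ^ (2 * (n - 1)) * (1 + δ))) ∧
      -- the Krichever divisor, `t = 0`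
      (∀ r ∈ Finset.Icc 1 N, KPSoliton.IsGeneric A k r (0 : Fin J → ℝ) →
        ∃ ξ₀ C : ℝ, 1 ≤ ξ₀ ∧ ∀ ξ : ℝ, ξ₀ < ξ →
          ∀ d : KPSoliton.VacuumData, KPSoliton.IsVacuum (J := J) A k ξ d →
          ∃ γ : ℕ → ℝ, KPSoliton.IsZeroDivisor A k ξ d r (0 : Fin J → ℝ) γ ∧
            ∀ n ∈ Finset.Icc 1 (M - N - 1),
              ∃ δ : ℝ, |δ| ≤ C / ξ ∧
                γ n = -((∑ j ∈ Finset.Icc (N - r + 1) (N - r + n),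
                      KPSoliton.minorRatio A r n j *
                        KPSoliton.darbouxPoly A k (0 : Fin J → ℝ) (KPSoliton.phase k j)) /
                    (∑ j ∈ Finset.Icc (N - r + 1) (N - r + n + 1),
                      KPSoliton.minorRatio A r (n + 1) j *
                        KPSoliton.darbouxPoly A k (0 : Fin J → ℝ) (KPSoliton.phase k j))) *
                  ξ ^ (2 * (n - 1)) * (1 + δ))) ∧
    -- `t = 0` is generic for an open dense set of ordered phases
    (IsOpen {k : Fin M → ℝ | StrictMono k ∧
        ∀ r ∈ Finset.Icc 1 N, KPSoliton.IsGeneric A k r (0 : Fin J → ℝ)} ∧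
      {k : Fin M → ℝ | StrictMono k} ⊆ closure {k : Fin M → ℝ | StrictMono k ∧
        ∀ r ∈ Finset.Icc 1 N, KPSoliton.IsGeneric A k r (0 : Fin J → ℝ)}) := by
  refine ⟨fun k hk => ⟨?_, KPSoliton.isOpen_dense_generic hN hA hNM.le hk,
    fun r hr K hK hgen => KPSoliton.zeros_asymptotics hA hNM hk hr hK hgen, fun r hr h0 => ?_⟩,
    KPSoliton.isOpen_generic_phases hA hNM.le,
    KPSoliton.strictMono_subset_closure_generic hA hNM.le⟩
  · obtain ⟨ξ₀, hξ₀⟩ := eventually_atTop.1 (KPSoliton.eventually_isAdmissible hA hNM)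
    exact ⟨max 1 ξ₀, le_max_left _ _, fun ξ hξ =>
      (hξ₀ ξ ((le_max_right _ _).trans hξ.le)).exists_isVacuum hA hNM.le k⟩
  -- The Krichever divisor is the case `K = {0}`, where all exponentials equal one.
  · obtain ⟨ξ₀, C, h1, h⟩ := KPSoliton.zeros_asymptotics hA hNM hk hr (isCompact_singleton (x := 0))
      fun t ht => (Set.mem_singleton_iff.1 ht) ▸ h0
    refine ⟨ξ₀, C, h1, fun ξ hξ d hd => ?_⟩
    obtain ⟨γ, hγ, hn⟩ := h ξ hξ d hd 0 rfl
    refine ⟨γ, hγ, fun n hn' => ?_⟩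
    have h2 := (hn n hn').2.2.2
    simpa only [KPSoliton.leadingSum, KPSoliton.theta, Pi.zero_apply, mul_zero,
      Finset.sum_const_zero, Real.exp_zero, mul_one, ← add_assoc] using h2
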